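/- **Conventions.** A graph is a finite triple $G=(V,E,\mathrm{Inc})$ with $\mathrm{Inc}\subseteq E\times V$ such that every edge has either $0$ or $2$ endpoints (multiple edges are allowed, loops are not). CMSO formulas are built from variables for vertices, edges, sets of vertices and sets of edges, the atomic predicates $x\in X$, $y\in Y$, $\mathrm{Inc}(x,y)$, $\mathrm{card}_{a,r}(Z)$ (meaning $|Z|\equiv a \pmod r$, where $0\le a<r$ and $r\ge 2$) and equality of variables of the same sort, the connectives $\vee,\wedge,\neg,\Rightarrow,\Leftrightarrow$, and the quantifiers $\exists,\forall$ over all four sorts of variables. A sentence is a formula without free variables, and $|\varphi|$ is the length of $\varphi$ written as a word over a fixed finite alphabet, with variable names and the numbers $a,r$ in binary. A $t$-concrete bag is a pair $(B,b)$ with $b\subseteq B\subseteq\{1,\dots,t\}$ and $b=\emptyset$ or $|b|=2$; $\mathcal B(t)$ is the finite set of all of them. A $t$-concrete tree decomposition is a term $\mathbf T\in\mathrm{Ter}(\mathcal B(t))$, that is, a term whose symbols lie in $\mathcal B(t)$ and are used with arity $0$, $1$ or $2$; $\mathbf T[p]=(\mathbf T[p].B,\mathbf T[p].b)$ is the bag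 at the position $p$. For $s\in\{1,\dots,t\}$, a non-empty set $P$ of positions is $s$-maximal if it is connected in the tree of positions, $s\in\mathbf T[p].B$ for all $p\in P$, and every connected set $P'$ of positions with $s\in\mathbf T[p].B$ for all $p\in P'$ is either disjoint from $P$ or contained in $P$. The graph $\mathcal G(\mathbf T)$ has a vertex $v_{s,P}$ for each $s\in\{1,\dots,t\}$ and each $s$-maximal set $P$, and an edge $e_p$ for each position $p$ with $\mathbf T[p].b\neq\emptyset$; the edge $e_p$ is incident with $v_{s,P}$ if and only if $s\in\mathbf T[p].b$ and $p\in P$. A (bottom-up, nondeterministic) tree automaton over a finite alphabet $\Sigma$ consists of a finite set of states, a set of final states, and transitions $(q_1,\dots,q_r,a,q)$ with $0\le r\le 2$, $a\in\Sigma$. A term $a(\mathbf T_1,\dots,\mathbf T_r)$ reaches the state $q$ if there is a transition $(q_1,\dots,q_r,a,q)$ such that $\mathbf T_j$ reaches $q_j$ for each $j$; the language $\mathcal L(\mathcal A)$ is the set of all terms that reach some final state. **Theorem (Variant of Courcelle's Theorem).** There exist a computable function $f:\mathbb N\times\mathbb N\to\mathbb N$ and an algorithm (a Turing machine) which, given a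 CMSO sentence $\varphi$ and $t\in\mathbb N$, constructs in time at most $f(|\varphi|,t)$ (an explicit listing of) a tree automaton $\mathcal A(\varphi,t)$ over $\mathcal B(t)$ such that $$\mathcal L(\mathcal A(\varphi,t))=\{\mathbf T\in\mathrm{Ter}(\mathcal B(t)) : \mathcal G(\mathbf T)\models\varphi\}.$$ -/

import Mathlib

namespace ConcreteCMSO

/-! ### Graphs -/

/-- A finite graph `(V, E, Inc)`: multiple edges are allowed, loops are not, and the set of
endpoints of an edge has zero or two elements. -/
structure IncGraph where
  V : Type
  E : Type
  Inc : E → V → Prop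
  finite_V : Finite V
  finite_E : Finite E
  endpts_card : ∀ e, {v | Inc e v}.encard = 0 ∨ {v | Inc e v}.encard = 2

/-! ### Counting monadic second-order logic -/

/-- The four sorts of variables. -/
inductive Sort4
  | vertex
  | edge
  | vertexSet
  | edgeSet
  deriving DecidableEq

/-- CMSO formulas. The variables of each sort are named by natural numbers. -/
inductive Formula
  /-- `x ∈ X`, for a vertex variable `x` and a vertex-set variable `X` -/
  | memV (x X : ℕ)
  /-- `y ∈ Y`, for an edge variable `y` and an edge-set variable `Y` -/
  | memE (y Y : ℕ)
  /-- `Inc(x, y)`, for a vertex variable `x` and an edge variable `y` -/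
  | inc (x y : ℕ)
  /-- `card_{a,r}(X)`, for a vertex-set variable `X` -/
  | cardV (a r : ℕ) (har : a < r) (hr : 2 ≤ r) (X : ℕ)
  /-- `card_{a,r}(Y)`, for an edge-set variable `Y` -/
  | cardE (a r : ℕ) (har : a < r) (hr : 2 ≤ r) (Y : ℕ)
  /-- `z = z'`, for two variables of the same sort `k` -/
  | eq (k : Sort4) (z z' : ℕ)
  | not (φ : Formula)
  | and (φ ψ : Formula)
  | or (φ ψ : Formula)
  | imp (φ ψ : Formula)
  | iff (φ ψ : Formula)
  /-- `∃ z, φ`, where `z` is a variable of sort `k` -/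
  | ex (k : Sort4) (z : ℕ) (φ : Formula)
  /-- `∀ z, φ`, where `z` is a variable of sort `k` -/
  | all (k : Sort4) (z : ℕ) (φ : Formula)

/-- The free variables of a formula, each with its sort. -/
def Formula.freeVars : Formula → Set (Sort4 × ℕ)
  | .memV x X => {(.vertex, x), (.vertexSet, X)}
  | .memE y Y => {(.edge, y), (.edgeSet, Y)}
  | .inc x y => {(.vertex, x), (.edge, y)}
  | .cardV _ _ _ _ X => {(.vertexSet, X)}
  | .cardE _ _ _ _ Y => {(.edgeSet, Y)}
  | .eq k z z' => {(k, z), (k, z')}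
  | .not φ => φ.freeVars
  | .and φ ψ => φ.freeVars ∪ ψ.freeVars
  | .or φ ψ => φ.freeVars ∪ ψ.freeVars
  | .imp φ ψ => φ.freeVars ∪ ψ.freeVars
  | .iff φ ψ => φ.freeVars ∪ ψ.freeVars
  | .ex k z φ => φ.freeVars \ {(k, z)}
  | .all k z φ => φ.freeVars \ {(k, z)}

/-- A CMSO sentence is a CMSO formula without free variables. -/
def Sentence : Type := {φ : Formula // φ.freeVars = ∅}

/-- The objects over which the variables of sort `k` range. -/
def IncGraph.Dom (G : IncGraph) : Sort4 → Type
  | .vertex => G.V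
  | .edge => G.E
  | .vertexSet => Set G.V
  | .edgeSet => Set G.E

/-- A partial interpretation of the variables in `G`; it is partial because `G` may have no
vertices or no edges. An atomic formula with an uninterpreted variable counts as false, a
convention that plays no role in the truth of sentences. -/
abbrev IncGraph.Interp (G : IncGraph) : Type := (k : Sort4) → ℕ → Option (G.Dom k)

/-- The interpretation `I` changed so that the variable `z` of sort `k` denotes `u`. -/
def IncGraph.Interp.set {G : IncGraph} (I : G.Interp) (k : Sort4) (z : ℕ) (u : G.Dom k) :
    G.Interp :=
  Function.update I k (Function.update (I k) z (some u))

/-- Truth of a formula in `G` under an interpretation of its free variables. -/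
def IncGraph.Sat (G : IncGraph) : Formula → G.Interp → Prop
  | .memV x X, I =>
      ∃ (v : G.V) (S : Set G.V), I .vertex x = some v ∧ I .vertexSet X = some S ∧ v ∈ S
  | .memE y Y, I =>
      ∃ (e : G.E) (S : Set G.E), I .edge y = some e ∧ I .edgeSet Y = some S ∧ e ∈ S
  | .inc x y, I =>
      ∃ (v : G.V) (e : G.E), I .vertex x = some v ∧ I .edge y = some e ∧ G.Inc e v
  | .cardV a r _ _ X, I => ∃ S : Set G.V, I .vertexSet X = some S ∧ S.ncard ≡ a [MOD r]
  | .cardE a r _ _ Y, I => ∃ S : Set G.E, I .edgeSet Y = some S ∧ S.ncard ≡ a [MOD r]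
  | .eq k z z', I => ∃ u : G.Dom k, I k z = some u ∧ I k z' = some u
  | .not φ, I => ¬ G.Sat φ I
  | .and φ ψ, I => G.Sat φ I ∧ G.Sat ψ I
  | .or φ ψ, I => G.Sat φ I ∨ G.Sat ψ I
  | .imp φ ψ, I => G.Sat φ I → G.Sat ψ I
  | .iff φ ψ, I => (G.Sat φ I ↔ G.Sat ψ I)
  | .ex k z φ, I => ∃ u : G.Dom k, G.Sat φ (I.set k z u)
  | .all k z φ, I => ∀ u : G.Dom k, G.Sat φ (I.set k z u)

/-- `G ⊨ φ`, for a sentence `φ`. -/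
def IncGraph.Models (G : IncGraph) (φ : Sentence) : Prop :=
  G.Sat φ.1 fun _ _ => none

/-! ### Terms -/

/-- Terms over the unranked alphabet `A`, whose symbols are used with arity 0, 1 or 2. -/
inductive Term (A : Type)
  | leaf (a : A)
  | unary (a : A) (T : Term A)
  | binary (a : A) (T₁ T₂ : Term A)

namespace Term

variable {A : Type}

/-- The positions of a term: strings over `{1, 2}`. -/
def positions : Term A → Finset (List ℕ)
  | leaf _ => {[]}
  | unary _ T => {[]} ∪ T.positions.image (List.cons 1)
  | binary _ T₁ T₂ =>
      {[]} ∪ (T₁.positions.image (List.cons 1) ∪ T₂.positions.image (List.cons 2))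

/-- The symbol at a position, and `none` at a string that is not a position. -/
def symbol? : Term A → List ℕ → Option A
  | leaf a, [] => some a
  | unary a _, [] => some a
  | binary a _ _, [] => some a
  | unary _ T, 1 :: p => T.symbol? p
  | binary _ T₁ _, 1 :: p => T₁.symbol? p
  | binary _ _ T₂, 2 :: p => T₂.symbol? p
  | _, _ => none

theorem isSome_symbol? (T : Term A) (p : List ℕ) (hp : p ∈ T.positions) :
    (T.symbol? p).isSome := by
  induction T generalizing p with
  | leaf a => simp [positions] at hp; subst hp; simp [symbol?]
  | unary a T ih =>
    simp only [positions, Finset.mem_union, Finset.mem_singleton, Finset.mem_image] at hp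
    rcases hp with rfl | ⟨q, hq, rfl⟩
    · simp [symbol?]
    · simpa [symbol?] using ih q hq
  | binary a T₁ T₂ ih₁ ih₂ =>
    simp only [positions, Finset.mem_union, Finset.mem_singleton, Finset.mem_image] at hp
    rcases hp with rfl | ⟨q, hq, rfl⟩ | ⟨q, hq, rfl⟩
    · simp [symbol?]
    · simpa [symbol?] using ih₁ q hq
    · simpa [symbol?] using ih₂ q hq

/-- The type of positions of a term. -/
abbrev Pos (T : Term A) : Type := {p : List ℕ // p ∈ T.positions}

/-- The symbol `T[p]` at the position `p`. -/
def symbol (T : Term A) (p : T.Pos) : A :=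
  (T.symbol? p.1).get (T.isSome_symbol? p.1 p.2)

/-- The tree on the positions of `T`: each position `p` is joined to its children `pj`. -/
def tree (T : Term A) : SimpleGraph T.Pos where
  Adj p q := (∃ j : ℕ, q.1 = p.1 ++ [j]) ∨ ∃ j : ℕ, p.1 = q.1 ++ [j]
  symm := ⟨fun _ _ h => h.symm⟩
  loopless := ⟨fun p h => by
    rcases h with ⟨j, h⟩ | ⟨j, h⟩ <;> simpa using congrArg List.length h⟩

end Term

/-! ### Tree automata -/

/-- Transitions `(q₁, …, q_r, a, q)` with `r ≤ 2`. -/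
inductive Transition (Q A : Type)
  | leaf (a : A) (q : Q)
  | unary (q₁ : Q) (a : A) (q : Q)
  | binary (q₁ q₂ : Q) (a : A) (q : Q)

/-- A bottom-up tree automaton over the alphabet `A`, given in the explicit form in which an
algorithm can output it: the states are `0, …, numStates - 1`, and the set of final states and the
set of transitions are listed. -/
structure TreeAutomaton (A : Type) where
  numStates : ℕ
  final : List (Fin numStates)
  transitions : List (Transition (Fin numStates) A)

namespace TreeAutomaton

variable {A : Type}

/-- `𝒜.Reaches T q`: the term `T` reaches the state `q`. -/
def Reaches (𝒜 : TreeAutomaton A) : Term A → Fin 𝒜.numStates → Prop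
  | .leaf a, q => .leaf a q ∈ 𝒜.transitions
  | .unary a T, q => ∃ q₁, 𝒜.Reaches T q₁ ∧ .unary q₁ a q ∈ 𝒜.transitions
  | .binary a T₁ T₂, q =>
      ∃ q₁ q₂, 𝒜.Reaches T₁ q₁ ∧ 𝒜.Reaches T₂ q₂ ∧ .binary q₁ q₂ a q ∈ 𝒜.transitions

/-- The language accepted by `𝒜`: the terms that reach some final state. -/
def language (𝒜 : TreeAutomaton A) : Set (Term A) :=
  {T | ∃ q ∈ 𝒜.final, 𝒜.Reaches T q}

end TreeAutomaton

/-! ### Concrete bags and the graph of a concrete tree decomposition -/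

/-- A `t`-concrete bag `(B, b)`. The elements `0, …, t - 1` of `Fin t` stand for `1, …, t`. -/
structure ConcreteBag (t : ℕ) where
  B : Finset (Fin t)
  b : Finset (Fin t)
  sub : b ⊆ B
  card_b : b = ∅ ∨ b.card = 2

/-- A `t`-concrete tree decomposition is a term over the alphabet of `t`-concrete bags. -/
abbrev ConcreteDecomp (t : ℕ) : Type := Term (ConcreteBag t)

namespace ConcreteDecomp

variable {t : ℕ}

/-- `P` is connected, and `s` belongs to the bag at each of its positions. -/
def IsConn (T : ConcreteDecomp t) (s : Fin t) (P : Set T.Pos) : Prop :=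
  (T.tree.induce P).Connected ∧ ∀ p ∈ P, s ∈ (T.symbol p).B

/-- `P` is a non-empty `s`-maximal set of positions. -/
def IsMaximal (T : ConcreteDecomp t) (s : Fin t) (P : Set T.Pos) : Prop :=
  P.Nonempty ∧ IsConn T s P ∧ ∀ P' : Set T.Pos, IsConn T s P' → P ∩ P' = ∅ ∨ P' ⊆ P

theorem existsUnique_isMaximal (T : ConcreteDecomp t) (s : Fin t) (p : T.Pos)
    (hs : s ∈ (T.symbol p).B) : ∃! P : Set T.Pos, IsMaximal T s P ∧ p ∈ P := by
  have hsing : IsConn T s {p} := by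
    refine ⟨?_, by rintro q rfl; exact hs⟩
    exact SimpleGraph.connected_induce_iff.2 (by
      simpa using (SimpleGraph.Subgraph.singletonSubgraph_connected (G := T.tree) (v := p)).mono
        (by simp) (by simp))
  set C : Set (Set T.Pos) := {P | IsConn T s P ∧ p ∈ P} with hC
  have hp : p ∈ ⋃₀ C := ⟨{p}, ⟨hsing, rfl⟩, rfl⟩
  have hconn : IsConn T s (⋃₀ C) := by
    refine ⟨SimpleGraph.induce_sUnion_connected_of_pairwise_not_disjoint ⟨_, hsing, rfl⟩
      (fun hP hQ => ⟨p, hP.2, hQ.2⟩) (fun hP => hP.1.1), ?_⟩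
    rintro q ⟨P, hP, hq⟩
    exact hP.1.2 q hq
  refine ⟨⋃₀ C, ⟨⟨⟨p, hp⟩, hconn, fun P' hP' => ?_⟩, hp⟩, ?_⟩
  · by_cases h : (⋃₀ C) ∩ P' = ∅
    · exact Or.inl h
    · obtain ⟨q, hq⟩ := Set.nonempty_iff_ne_empty.2 h
      refine Or.inr fun r hr => ⟨⋃₀ C ∪ P', ⟨⟨?_, ?_⟩, Or.inl hp⟩, Or.inr hr⟩
      · exact SimpleGraph.induce_union_connected hconn.1.preconnected hP'.1.preconnected ⟨q, hq⟩
      · rintro x (hx | hx)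
        · exact hconn.2 x hx
        · exact hP'.2 x hx
  · rintro P ⟨hP, hpP⟩
    refine Set.Subset.antisymm (fun q hq => ⟨P, ⟨hP.2.1, hpP⟩, hq⟩) ?_
    rcases hP.2.2 _ hconn with h | h
    · exact absurd (show p ∈ P ∩ ⋃₀ C from ⟨hpP, hp⟩) (by simp [h])
    · exact h

/-- The vertices `v_{s,P}` of the graph of `T`. -/
abbrev Vert (T : ConcreteDecomp t) : Type :=
  {x : Fin t × Set T.Pos // IsMaximal T x.1 x.2}

/-- The edges `e_p` of the graph of `T`. -/
abbrev Edge (T : ConcreteDecomp t) : Type :=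
  {p : T.Pos // (T.symbol p).b ≠ ∅}

/-- The edge `e_p` is incident with `v_{s,P}` if `s` belongs to the edge `b` of the bag at `p` and
`P` is the `s`-maximal set that contains `p`. -/
def Incident (T : ConcreteDecomp t) (e : Edge T) (v : Vert T) : Prop :=
  v.1.1 ∈ (T.symbol e.1).b ∧ e.1 ∈ v.1.2

theorem encard_incident (T : ConcreteDecomp t) (e : Edge T) :
    {v | Incident T e v}.encard = 2 := by
  have hcard : (T.symbol e.1).b.card = 2 := (T.symbol e.1).card_b.resolve_left e.2
  have hinj : Set.InjOn (fun v : Vert T => v.1.1) {v | Incident T e v} := by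
    rintro ⟨⟨s, P⟩, hP⟩ hv ⟨⟨s', P'⟩, hP'⟩ hv' (rfl : s = s')
    have := (existsUnique_isMaximal T s e.1 ((T.symbol e.1).sub hv.1)).unique
      ⟨hP, hv.2⟩ ⟨hP', hv'.2⟩
    simpa using this
  have himg : (fun v : Vert T => v.1.1) '' {v | Incident T e v} = ((T.symbol e.1).b : Set (Fin t)) := by
    ext s
    constructor
    · rintro ⟨v, hv, rfl⟩
      exact hv.1
    · intro hs
      obtain ⟨P, ⟨hP, hp⟩, -⟩ := existsUnique_isMaximal T s e.1 ((T.symbol e.1).sub hs)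
      exact ⟨⟨(s, P), hP⟩, ⟨hs, hp⟩, rfl⟩
  rw [← hinj.encard_image, himg, Set.encard_coe_eq_coe_finsetCard, hcard]
  rfl

/-- The graph `𝒢(T)` associated with a concrete tree decomposition `T`. -/
def graph (T : ConcreteDecomp t) : IncGraph where
  V := Vert T
  E := Edge T
  Inc := Incident T
  finite_V := inferInstance
  finite_E := inferInstance
  endpts_card e := Or.inr (encard_incident T e)

end ConcreteDecomp

/-! ### Words for formulas and automata

Words are over the four-letter alphabet `Turing.PartrecToTM2.Γ'`; the word
`Turing.PartrecToTM2.trList l` lists the natural numbers of `l` in binary, each followed by a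
separator. -/

def Sort4.code : Sort4 → ℕ
  | .vertex => 0
  | .edge => 1
  | .vertexSet => 2
  | .edgeSet => 3

/-- A formula written in prefix notation, as a list of natural numbers. -/
def Formula.code : Formula → List ℕ
  | .memV x X => [0, x, X]
  | .memE y Y => [1, y, Y]
  | .inc x y => [2, x, y]
  | .cardV a r _ _ X => [3, a, r, X]
  | .cardE a r _ _ Y => [4, a, r, Y]
  | .eq k z z' => [5, k.code, z, z']
  | .not φ => 6 :: φ.code
  | .and φ ψ => 7 :: (φ.code ++ ψ.code)
  | .or φ ψ => 8 :: (φ.code ++ ψ.code)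
  | .imp φ ψ => 9 :: (φ.code ++ ψ.code)
  | .iff φ ψ => 10 :: (φ.code ++ ψ.code)
  | .ex k z φ => 11 :: k.code :: z :: φ.code
  | .all k z φ => 12 :: k.code :: z :: φ.code

/-- The size `|φ|`: the length of `φ` written as a word over the four-letter alphabet, where the
names of variables and the numbers `a`, `r` of `card_{a,r}` are written in binary. -/
def Sentence.size (φ : Sentence) : ℕ :=
  (Turing.PartrecToTM2.trList φ.1.code).length

/-- A `t`-concrete bag as a list of `t` digits: `0` off `B`, `1` on `B \ b`, and `2` on `b`. -/
def ConcreteBag.code {t : ℕ} (β : ConcreteBag t) : List ℕ :=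
  List.ofFn fun i : Fin t => if i ∈ β.b then 2 else if i ∈ β.B then 1 else 0

/-- A transition as a list of natural numbers, beginning with its arity. -/
def Transition.code {n t : ℕ} : Transition (Fin n) (ConcreteBag t) → List ℕ
  | .leaf a q => 0 :: (a.code ++ [q.1])
  | .unary q₁ a q => 1 :: q₁.1 :: (a.code ++ [q.1])
  | .binary q₁ q₂ a q => 2 :: q₁.1 :: q₂.1 :: (a.code ++ [q.1])

/-- A tree automaton over the `t`-concrete bags as a list of natural numbers: the number of states,
the number of final states, the final states, the number of transitions, and the transitions. -/
def TreeAutomaton.code {t : ℕ} (𝒜 : TreeAutomaton (ConcreteBag t)) : List ℕ :=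
  𝒜.numStates :: 𝒜.final.length ::
    (𝒜.final.map Fin.val ++ 𝒜.transitions.length :: 𝒜.transitions.flatMap Transition.code)

/-- The Turing machine `M` (with finitely many stacks), started with the word of the list `l` on its
input stack, halts after at most `m` steps with the word of the list `l'` on its output stack. -/
def OutputsInTime
    (M : Turing.TM2ComputableAux Turing.PartrecToTM2.Γ' Turing.PartrecToTM2.Γ')
    (l l' : List ℕ) (m : ℕ) : Prop :=
  Nonempty (Turing.TM2OutputsInTime M.tm
    ((Turing.PartrecToTM2.trList l).map M.inputAlphabet.symm)
    (some ((Turing.PartrecToTM2.trList l').map M.outputAlphabet.symm)) m)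

end ConcreteCMSO

/-! A concrete tree decomposition is read as a labelled tree. The letter at a position is a natural
number whose bits, indexed by `Nat.pair s v`, describe the bag (`v = 0, 1`) and the values of the
variables (`v = varIx k z`). A vertex $v_{s,P}$ is marked by a bit at $s$ in every letter along $P$,
an edge $e_p$ by a bit at place $0$ of the letter at $p$. A deterministic automaton over these
letters is built by recursion on the formula: complement and product for the connectives, and for
$\exists$ the subset construction applied to the conjunction with a test that the new marks encode
an object of the right sort; $\forall$ is $\neg\exists\neg$. `accepts_aut` says that on labels
encoding an interpretation, acceptance is truth.

Atomic formulas and validity tests share one device, `Aut.accepts_atom`: each node gets a weight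
depending on its letter and that of its parent, and the automaton computes the total exactly below
$2$ and modulo $r$ from there on. The combinatorial input is that an $s$-maximal set has exactly one
topmost position (`IsMaximal.exists_isTop`, `IsMaximal.isTop_unique`), so that counting marked tops
counts vertices (`weight_topW_false`), and that marks encode a set of vertices precisely when they
never disagree along a tree edge inside a maximal set (`weight_conflictW`). The automaton over bags
guesses the letters (`Aut.mem_language_toTree`); for a sentence the guessed marks do not influence
the verdict.

For effectiveness, all automata are tables of numbers, so the output list is primitive recursive in
$t$ and the nodes of $\varphi$ (`IsPrimrec.autCode_fun`). `exists_code_of_nodes` turns this into a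
`ToPartrec.Code` that is total on all lists, and this code is compiled to a stack machine. The
running time is not estimated: halting times are computable by simulation, and a word of given
length comes from one of finitely many lists, so summing the halting times over a finite set
containing these lists bounds the time computably (`exists_machine`). -/

namespace ConcreteCMSO

/-! ### Primitive recursive functions -/

/-- A primitive recursive function; a structure, so that it is not unfolded. -/
@[fun_prop]
structure IsPrimrec {α β : Type*} [Primcodable α] [Primcodable β] (f : α → β) : Prop where
  prim : Primrec f

namespace IsPrimrec

variable {α β γ δ : Type*} [Primcodable α] [Primcodable β] [Primcodable γ] [Primcodable δ]

theorem of_eq {f g : α → β} (hf : IsPrimrec f) (h : ∀ x, f x = g x) : IsPrimrec g :=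
  ⟨hf.prim.of_eq h⟩

@[fun_prop] theorem id_fun : IsPrimrec (fun x : α => x) :=
  ⟨_root_.Primrec.id⟩

@[fun_prop] theorem const_fun (c : β) : IsPrimrec (fun _ : α => c) :=
  ⟨_root_.Primrec.const c⟩

@[fun_prop] theorem comp_fun {f : β → γ} {g : α → β} (hf : IsPrimrec f) (hg : IsPrimrec g) :
    IsPrimrec (fun x => f (g x)) :=
  ⟨hf.prim.comp hg.prim⟩

@[fun_prop] theorem prod_mk {f : α → β} {g : α → γ} (hf : IsPrimrec f) (hg : IsPrimrec g) :
    IsPrimrec (fun x => (f x, g x)) :=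
  ⟨hf.prim.pair hg.prim⟩

@[fun_prop] theorem fst_fun {f : α → β × γ} (hf : IsPrimrec f) : IsPrimrec (fun x => (f x).1) :=
  ⟨_root_.Primrec.fst.comp hf.prim⟩

@[fun_prop] theorem snd_fun {f : α → β × γ} (hf : IsPrimrec f) : IsPrimrec (fun x => (f x).2) :=
  ⟨_root_.Primrec.snd.comp hf.prim⟩

@[fun_prop] theorem add_fun {f g : α → ℕ} (hf : IsPrimrec f) (hg : IsPrimrec g) :
    IsPrimrec (fun x => f x + g x) :=
  ⟨_root_.Primrec.nat_add.comp hf.prim hg.prim⟩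

@[fun_prop] theorem sub_fun {f g : α → ℕ} (hf : IsPrimrec f) (hg : IsPrimrec g) :
    IsPrimrec (fun x => f x - g x) :=
  ⟨_root_.Primrec.nat_sub.comp hf.prim hg.prim⟩

@[fun_prop] theorem mul_fun {f g : α → ℕ} (hf : IsPrimrec f) (hg : IsPrimrec g) :
    IsPrimrec (fun x => f x * g x) :=
  ⟨_root_.Primrec.nat_mul.comp hf.prim hg.prim⟩

@[fun_prop] theorem div_fun {f g : α → ℕ} (hf : IsPrimrec f) (hg : IsPrimrec g) :
    IsPrimrec (fun x => f x / g x) :=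
  ⟨_root_.Primrec.nat_div.comp hf.prim hg.prim⟩

@[fun_prop] theorem mod_fun {f g : α → ℕ} (hf : IsPrimrec f) (hg : IsPrimrec g) :
    IsPrimrec (fun x => f x % g x) :=
  ⟨_root_.Primrec.nat_mod.comp hf.prim hg.prim⟩

@[fun_prop] theorem natPair_fun {f g : α → ℕ} (hf : IsPrimrec f) (hg : IsPrimrec g) :
    IsPrimrec (fun x => Nat.pair (f x) (g x)) :=
  ⟨Primrec₂.natPair.comp hf.prim hg.prim⟩

@[fun_prop] theorem natUnpair_fun {f : α → ℕ} (hf : IsPrimrec f) :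
    IsPrimrec (fun x => Nat.unpair (f x)) :=
  ⟨_root_.Primrec.unpair.comp hf.prim⟩

@[fun_prop] theorem pow_fun {f g : α → ℕ} (hf : IsPrimrec f) (hg : IsPrimrec g) :
    IsPrimrec (fun x => f x ^ g x) :=
  ⟨(Primrec₂.unpaired'.1 Nat.Primrec.pow).comp hf.prim hg.prim⟩

@[fun_prop] theorem decide_eq {f g : α → β} [DecidableEq β] (hf : IsPrimrec f) (hg : IsPrimrec g) :
    IsPrimrec (fun x => decide (f x = g x)) :=
  ⟨(_root_.Primrec.eq (α := β)).decide.comp hf.prim hg.prim⟩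

@[fun_prop] theorem decide_lt {f g : α → ℕ} (hf : IsPrimrec f) (hg : IsPrimrec g) :
    IsPrimrec (fun x => decide (f x < g x)) :=
  ⟨_root_.Primrec.nat_lt.decide.comp hf.prim hg.prim⟩

@[fun_prop] theorem and_fun {f g : α → Bool} (hf : IsPrimrec f) (hg : IsPrimrec g) :
    IsPrimrec (fun x => f x && g x) :=
  ⟨_root_.Primrec.and.comp hf.prim hg.prim⟩

@[fun_prop] theorem or_fun {f g : α → Bool} (hf : IsPrimrec f) (hg : IsPrimrec g) :
    IsPrimrec (fun x => f x || g x) :=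
  ⟨_root_.Primrec.or.comp hf.prim hg.prim⟩

@[fun_prop] theorem xor_fun {f g : α → Bool} (hf : IsPrimrec f) (hg : IsPrimrec g) :
    IsPrimrec (fun x => xor (f x) (g x)) :=
  ⟨(_root_.Primrec.dom_bool₂ xor).comp hf.prim hg.prim⟩

@[fun_prop] theorem not_fun {f : α → Bool} (hf : IsPrimrec f) :
    IsPrimrec (fun x => !(f x)) :=
  ⟨_root_.Primrec.not.comp hf.prim⟩

@[fun_prop] theorem toNat_fun {f : α → Bool} (hf : IsPrimrec f) :
    IsPrimrec (fun x => (f x).toNat) :=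
  ⟨(_root_.Primrec.dom_bool Bool.toNat).comp hf.prim⟩

@[fun_prop] theorem cond_fun {c : α → Bool} {f g : α → β} (hc : IsPrimrec c) (hf : IsPrimrec f)
    (hg : IsPrimrec g) : IsPrimrec (fun x => cond (c x) (f x) (g x)) :=
  ⟨_root_.Primrec.cond hc.prim hf.prim hg.prim⟩

@[fun_prop] theorem ite_fun {c : α → Prop} [DecidablePred c] {f g : α → β}
    (hc : IsPrimrec (fun x => decide (c x))) (hf : IsPrimrec f) (hg : IsPrimrec g) :
    IsPrimrec (fun x => if c x then f x else g x) :=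
  ⟨_root_.Primrec.ite (_root_.Primrec.primrecPred hc.prim) hf.prim hg.prim⟩

@[fun_prop] theorem testBit_fun {f g : α → ℕ} (hf : IsPrimrec f) (hg : IsPrimrec g) :
    IsPrimrec (fun x => (f x).testBit (g x)) := by
  have : IsPrimrec (fun x => decide (f x / 2 ^ g x % 2 = 1)) := by fun_prop
  exact this.of_eq fun x => (Nat.testBit_eq_decide_div_mod_eq).symm

@[fun_prop] theorem sum_range_fun {n : α → ℕ} {f : α → ℕ → ℕ} (hn : IsPrimrec n)
    (hf : IsPrimrec (fun p : α × ℕ => f p.1 p.2)) :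
    IsPrimrec (fun x => ∑ i ∈ Finset.range (n x), f x i) := by
  have hg : IsPrimrec (fun p : α × ℕ × ℕ => f p.1 p.2.1) :=
    comp_fun (f := fun p : α × ℕ => f p.1 p.2) (g := fun p : α × ℕ × ℕ => (p.1, p.2.1)) hf
      (by fun_prop)
  have h := _root_.Primrec.nat_rec' (f := n) (g := fun _ => (0 : ℕ))
    (h := fun x p => p.2 + f x p.1) hn.prim (_root_.Primrec.const 0)
    (show IsPrimrec (fun p : α × ℕ × ℕ => p.2.2 + f p.1 p.2.1) by fun_prop).prim
  refine ⟨h.of_eq fun x => ?_⟩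
  induction n x with
  | zero => simp
  | succ k ih => simp [Finset.sum_range_succ, ih]

@[fun_prop] theorem range_fun {f : α → ℕ} (hf : IsPrimrec f) :
    IsPrimrec (fun x => List.range (f x)) :=
  ⟨_root_.Primrec.list_range.comp hf.prim⟩

@[fun_prop] theorem map_fun {f : α → List β} {g : α → β → γ} (hf : IsPrimrec f)
    (hg : IsPrimrec (fun p : α × β => g p.1 p.2)) :
    IsPrimrec (fun x => (f x).map (g x)) :=
  ⟨_root_.Primrec.list_map hf.prim hg.prim⟩

@[fun_prop] theorem flatMap_fun {f : α → List β} {g : α → β → List γ} (hf : IsPrimrec f)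
    (hg : IsPrimrec (fun p : α × β => g p.1 p.2)) :
    IsPrimrec (fun x => (f x).flatMap (g x)) :=
  ⟨_root_.Primrec.list_flatMap hf.prim hg.prim⟩

@[fun_prop] theorem foldr_fun {f : α → List β} {g : α → γ} {h : α → β → γ → γ} (hf : IsPrimrec f)
    (hg : IsPrimrec g) (hh : IsPrimrec (fun p : α × β × γ => h p.1 p.2.1 p.2.2)) :
    IsPrimrec (fun x => (f x).foldr (h x) (g x)) :=
  ⟨_root_.Primrec.list_foldr (h := fun x p => h x p.1 p.2) hf.prim hg.prim hh.prim⟩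

@[fun_prop] theorem cons_fun {f : α → β} {g : α → List β} (hf : IsPrimrec f) (hg : IsPrimrec g) :
    IsPrimrec (fun x => f x :: g x) :=
  ⟨_root_.Primrec.list_cons.comp hf.prim hg.prim⟩

@[fun_prop] theorem append_fun {f g : α → List β} (hf : IsPrimrec f) (hg : IsPrimrec g) :
    IsPrimrec (fun x => f x ++ g x) :=
  ⟨_root_.Primrec.list_append.comp hf.prim hg.prim⟩

@[fun_prop] theorem reverse_fun {f : α → List β} (hf : IsPrimrec f) :
    IsPrimrec (fun x => (f x).reverse) :=
  ⟨_root_.Primrec.list_reverse.comp hf.prim⟩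

@[fun_prop] theorem length_fun {f : α → List β} (hf : IsPrimrec f) :
    IsPrimrec (fun x => (f x).length) :=
  ⟨_root_.Primrec.list_length.comp hf.prim⟩

@[fun_prop] theorem flatten_fun {f : α → List (List β)} (hf : IsPrimrec f) :
    IsPrimrec (fun x => (f x).flatten) :=
  ⟨_root_.Primrec.list_flatten.comp hf.prim⟩

@[fun_prop] theorem tail_fun {f : α → List β} (hf : IsPrimrec f) :
    IsPrimrec (fun x => (f x).tail) :=
  ⟨_root_.Primrec.list_tail.comp hf.prim⟩

@[fun_prop] theorem headI_fun [Inhabited β] {f : α → List β} (hf : IsPrimrec f) :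
    IsPrimrec (fun x => (f x).headI) :=
  ⟨_root_.Primrec.list_headI.comp hf.prim⟩

theorem head?_fun {f : α → List β} (hf : IsPrimrec f) :
    IsPrimrec (fun x => (f x).head?) :=
  ⟨_root_.Primrec.list_head?.comp hf.prim⟩

@[fun_prop] theorem getD_fun {f : α → List β} {g : α → ℕ} (d : β) (hf : IsPrimrec f)
    (hg : IsPrimrec g) : IsPrimrec (fun x => (f x).getD (g x) d) :=
  ⟨(_root_.Primrec.list_getD d).comp hf.prim hg.prim⟩

@[fun_prop] theorem sum_fun {f : α → List ℕ} (hf : IsPrimrec f) : IsPrimrec (fun x => (f x).sum) :=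
  foldr_fun (h := fun _ a b => a + b) hf (const_fun 0) (by fun_prop)

@[fun_prop] theorem some_fun {f : α → β} (hf : IsPrimrec f) : IsPrimrec (fun x => some (f x)) :=
  ⟨_root_.Primrec.option_some.comp hf.prim⟩

@[fun_prop] theorem encode_fun {f : α → β} (hf : IsPrimrec f) :
    IsPrimrec (fun x => Encodable.encode (f x)) :=
  ⟨_root_.Primrec.encode.comp hf.prim⟩

@[fun_prop] theorem ofNat_fun {β : Type*} [Denumerable β] {f : α → ℕ} (hf : IsPrimrec f) :
    IsPrimrec (fun x => Denumerable.ofNat β (f x)) :=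
  ⟨(_root_.Primrec.ofNat β).comp hf.prim⟩

@[fun_prop] theorem iterate_fun {n : α → ℕ} {g : α → β} {h : α → β → β} (hn : IsPrimrec n)
    (hg : IsPrimrec g) (hh : IsPrimrec (fun p : α × β => h p.1 p.2)) :
    IsPrimrec (fun x => (h x)^[n x] (g x)) :=
  ⟨_root_.Primrec.nat_iterate hn.prim hg.prim hh.prim⟩

/-- A finite case distinction on the first argument. It lets the step function of a machine be
treated one label at a time. -/
theorem of_finite_left [Finite α] {f : α → β → γ} (hf : ∀ a, IsPrimrec (f a)) :
    IsPrimrec (fun p : α × β => f p.1 p.2) := by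
  classical
  cases nonempty_fintype α
  have key : ∀ l : List α,
      IsPrimrec (fun p : α × β => if p.1 ∈ l then some (f p.1 p.2) else none) := by
    intro l
    induction l with
    | nil => simpa using const_fun none
    | cons a l ih =>
      have h1 : IsPrimrec (fun p : α × β => f a p.2) := comp_fun (hf a) (by fun_prop)
      have : IsPrimrec (fun p : α × β => if p.1 = a then some (f a p.2) else
        if p.1 ∈ l then some (f p.1 p.2) else none) := ite_fun (by fun_prop) (by fun_prop) ih
      refine this.of_eq fun p => ?_
      by_cases h : p.1 = a <;> simp [h]
  exact ⟨_root_.Primrec.option_some_iff.1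
    ((key Finset.univ.toList).of_eq fun p => by simp).prim⟩

end IsPrimrec

/-! ### Binary words as primitive recursive functions -/

open Turing.PartrecToTM2 (trNat trList Γ')

noncomputable instance : Primcodable Γ' :=
  Primcodable.ofEquiv (Fin 4) (Fintype.equivFinOfCardEq (n := 4) rfl)

/-- Words carry the lowest digit first and have no superfluous zero digit; the hypothesis excludes
the digit `0` in front of the empty word of zero. -/
theorem trNat_bit (b : Bool) (n : ℕ) (h : b = true ∨ n ≠ 0) :
    trNat (Nat.bit b n) = (bif b then Γ'.bit1 else Γ'.bit0) :: trNat n := by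
  have e : ∀ m : ℕ, (m : Num) = Num.ofNat' m := fun m => (Num.ofNat'_eq m).symm
  rw [trNat, trNat, e, e, Num.ofNat'_bit]
  have hn : n ≠ 0 → ∃ p, Num.ofNat' n = Num.pos p := by
    intro hn
    rcases hq : Num.ofNat' n with _ | p
    · have := congrArg (fun x : Num => (x : ℕ)) hq
      rw [← e] at this
      simp at this
      exact absurd this hn
    · exact ⟨p, rfl⟩
  cases b
  · obtain ⟨p, hp⟩ := hn (by simpa using h)
    rw [hp]; rfl
  · by_cases h0 : n = 0
    · subst h0; simp; rfl
    · obtain ⟨p, hp⟩ := hn h0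
      rw [hp]; rfl

theorem trNat_eq_cons (n : ℕ) (h : n ≠ 0) :
    trNat n = (if n % 2 = 1 then Γ'.bit1 else Γ'.bit0) :: trNat (n / 2) := by
  have := trNat_bit (decide (n % 2 = 1)) (n / 2) (by simp; omega)
  have hb : Nat.bit (decide (n % 2 = 1)) (n / 2) = n := by
    rw [Nat.bit_val]
    rcases Nat.mod_two_eq_zero_or_one n with h | h <;> simp [h] <;> omega
  rw [hb] at this
  rw [this]
  by_cases h : n % 2 = 1 <;> simp [h]

/-- One step of the conversion of a number to its binary digits. -/
def digitStep (p : ℕ × List Γ') : ℕ × List Γ' :=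
  if p.1 = 0 then p else (p.1 / 2, p.2 ++ [if p.1 % 2 = 1 then Γ'.bit1 else Γ'.bit0])

/-- Halving reaches zero after at most `n` steps, and later steps change nothing; hence `n` itself
is a sufficient, if wasteful, number of iterations. -/
theorem digitStep_iterate (k : ℕ) : ∀ (n : ℕ) (acc : List Γ'), n ≤ k →
    digitStep^[k] (n, acc) = (0, acc ++ trNat n) := by
  induction k with
  | zero => intro n acc h; obtain rfl : n = 0 := by omega
            simp
  | succ k ih =>
    intro n acc h
    rw [Function.iterate_succ_apply]
    by_cases h0 : n = 0
    · subst h0; simp [digitStep, ih 0 acc (by omega)]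
    · rw [digitStep, if_neg h0, ih _ _ (by simp; omega), trNat_eq_cons n h0]
      simp

namespace IsPrimrec

variable {α : Type*} [Primcodable α]

@[fun_prop] theorem trNat_fun {f : α → ℕ} (hf : IsPrimrec f) : IsPrimrec (fun x => trNat (f x)) := by
  have h : IsPrimrec (fun x => (digitStep^[f x] (f x, [])).2) := by
    unfold digitStep
    fun_prop
  refine h.of_eq fun x => ?_
  rw [digitStep_iterate _ _ _ le_rfl]; simp

theorem trList_eq_foldr (l : List ℕ) :
    trList l = l.foldr (fun n w => trNat n ++ Γ'.cons :: w) [] := by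
  induction l with
  | nil => rfl
  | cons a l ih => simp [ih]

@[fun_prop] theorem trList_fun {f : α → List ℕ} (hf : IsPrimrec f) :
    IsPrimrec (fun x => trList (f x)) := by
  simp_rw [trList_eq_foldr]
  fun_prop

end IsPrimrec

end ConcreteCMSO

namespace ConcreteCMSO

open Turing Turing.PartrecToTM2 StateTransition

/-! ### Machines with a computable time bound -/

section Machine

variable {K : Type} [DecidableEq K] {Γ : K → Type} {Λ Λ₂ σ : Type}

/-- Renaming of the labels in a statement. -/
def mapStmt (g : Λ → Λ₂) : TM2.Stmt Γ Λ σ → TM2.Stmt Γ Λ₂ σ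
  | .push k f q => .push k f (mapStmt g q)
  | .peek k f q => .peek k f (mapStmt g q)
  | .pop k f q => .pop k f (mapStmt g q)
  | .load a q => .load a (mapStmt g q)
  | .branch f q₁ q₂ => .branch f (mapStmt g q₁) (mapStmt g q₂)
  | .goto f => .goto fun v => g (f v)
  | .halt => .halt

/-- Renaming of the label of a configuration. -/
def mapCfg (g : Λ → Λ₂) (c : TM2.Cfg Γ Λ σ) : TM2.Cfg Γ Λ₂ σ := ⟨c.l.map g, c.var, c.stk⟩

theorem stepAux_mapStmt (g : Λ → Λ₂) (q : TM2.Stmt Γ Λ σ) (v : σ) (S : ∀ k, List (Γ k)) :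
    TM2.stepAux (mapStmt g q) v S = mapCfg g (TM2.stepAux q v S) := by
  induction q generalizing v S with
  | branch f q₁ q₂ ih₁ ih₂ => simp only [mapStmt, TM2.stepAux]; cases f v <;> simp [ih₁, ih₂]
  | goto f => rfl
  | halt => rfl
  | load a q ih => simp [mapStmt, ih]
  | _ k f q ih => simp [mapStmt, ih]

/-- The evaluator of codes has infinitely many labels, but a run for one code stays in a finite
supporting set. Renaming needs a left inverse on that set only, which yields a machine with finitely
many labels. -/
theorem reaches_mapCfg [Inhabited Λ] (M : Λ → TM2.Stmt Γ Λ σ) (S : Finset Λ)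
    (hS : TM2.Supports M S) (g : Λ → Λ₂) (i : Λ₂ → Λ) (hg : ∀ q ∈ S, i (g q) = q)
    {a b : TM2.Cfg Γ Λ σ} (h : Reaches (TM2.step M) a b) (ha : a.l ∈ Finset.insertNone S) :
    Reaches (TM2.step fun q => mapStmt g (M (i q))) (mapCfg g a) (mapCfg g b) := by
  induction h using Relation.ReflTransGen.head_induction_on with
  | refl => exact Relation.ReflTransGen.refl
  | head h₁ _ ih =>
    refine Relation.ReflTransGen.head ?_ (ih (TM2.step_supports M hS h₁ ha))
    rename_i a' c' _
    rcases a' with ⟨_ | q, v, T⟩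
    · cases h₁
    · cases h₁
      have hq : q ∈ S := Finset.some_mem_insertNone.1 ha
      simp [mapCfg, TM2.step, hg q hq, stepAux_mapStmt]

theorem exists_iterate_of_reaches {τ : Type} {f : τ → Option τ} {a b : τ} (h : Reaches f a b) :
    ∃ k, (flip bind f)^[k] (some a) = some b := by
  induction h using Relation.ReflTransGen.head_induction_on with
  | refl => exact ⟨0, rfl⟩
  | head h₁ _ ih =>
    obtain ⟨k, hk⟩ := ih
    refine ⟨k + 1, ?_⟩
    rw [Function.iterate_succ_apply]
    simpa [flip, Option.mem_def.1 h₁] using hk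

end Machine

/-! ### The step function of a four-stack machine -/

section FourStacks

variable {Λ : Type}

/-- Configurations of a machine with four stacks, as tuples. -/
abbrev Conf (Λ : Type) : Type :=
  Option Λ × Option Γ' × List Γ' × List Γ' × List Γ' × List Γ'

/-- The tuple of a configuration. -/
def Conf.ofCfg (c : TM2.Cfg (fun _ : K' => Γ') Λ (Option Γ')) : Conf Λ :=
  (c.l, c.var, c.stk .main, c.stk .rev, c.stk .aux, c.stk .stack)

/-- One step of a machine; halting configurations are fixed. -/
def Conf.step (M : Λ → TM2.Stmt (fun _ : K' => Γ') Λ (Option Γ')) (c : Conf Λ) : Conf Λ :=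
  c.1.elim c fun q => .ofCfg (TM2.stepAux (M q) c.2.1
    (K'.elim c.2.2.1 c.2.2.2.1 c.2.2.2.2.1 c.2.2.2.2.2))

theorem Conf.elim_stk (c : TM2.Cfg (fun _ : K' => Γ') Λ (Option Γ')) :
    K'.elim (c.stk .main) (c.stk .rev) (c.stk .aux) (c.stk .stack) = c.stk := by
  funext k; cases k <;> rfl

theorem Conf.step_ofCfg (M : Λ → TM2.Stmt (fun _ : K' => Γ') Λ (Option Γ'))
    {a b : TM2.Cfg (fun _ : K' => Γ') Λ (Option Γ')} (h : TM2.step M a = some b) :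
    Conf.step M (.ofCfg a) = .ofCfg b := by
  rcases a with ⟨_ | q, v, S⟩
  · cases h
  · cases h
    simp only [Conf.step, Conf.ofCfg, Option.elim]
    rw [Conf.elim_stk ⟨some q, v, S⟩]

/-- The option-valued iteration is lost after halting, whereas `Conf.step` is total and stays at the
halting configuration. They agree as long as the former is defined, so the total version can be used
for computing halting times. -/
theorem Conf.iterate_step_ofCfg (M : Λ → TM2.Stmt (fun _ : K' => Γ') Λ (Option Γ')) (n : ℕ) :
    ∀ {a b : TM2.Cfg (fun _ : K' => Γ') Λ (Option Γ')},
      (flip bind (TM2.step M))^[n] (some a) = some b →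
        (Conf.step M)^[n] (.ofCfg a) = .ofCfg b := by
  induction n with
  | zero => intro a b h; cases h; rfl
  | succ n ih =>
    intro a b h
    rw [Function.iterate_succ_apply'] at h ⊢
    rcases hc : (flip bind (TM2.step M))^[n] (some a) with _ | c
    · rw [hc] at h; cases h
    · rw [hc] at h
      rw [ih hc]
      exact Conf.step_ofCfg M h

variable [Primcodable Λ]

/-- The statement is fixed, so induction on it unfolds finitely many operations. Each is a list
operation or a function on a finite type of symbols. -/
theorem IsPrimrec.ofCfg_stepAux (q : TM2.Stmt (fun _ : K' => Γ') Λ (Option Γ')) {α : Type}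
    [Primcodable α] {v : α → Option Γ'} {a b c d : α → List Γ'} (hv : IsPrimrec v) (ha : IsPrimrec a)
    (hb : IsPrimrec b) (hc : IsPrimrec c) (hd : IsPrimrec d) :
    IsPrimrec fun x => Conf.ofCfg (TM2.stepAux q (v x) (K'.elim (a x) (b x) (c x) (d x))) := by
  induction q generalizing v a b c d with
  | push k f q ih =>
    have hf : IsPrimrec f := ⟨_root_.Primrec.dom_finite f⟩
    cases k <;> simp only [TM2.stepAux, K'.elim_update_main, K'.elim_update_rev,
      K'.elim_update_aux, K'.elim_update_stack, K'.elim] <;> apply ih <;> fun_prop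
  | peek k f q ih =>
    have hf : IsPrimrec fun p : Option Γ' × Option Γ' => f p.1 p.2 := ⟨_root_.Primrec.dom_finite _⟩
    have hf' : ∀ s : α → List Γ', IsPrimrec s → IsPrimrec fun x => f (v x) (s x).head? :=
      fun s hs => IsPrimrec.comp_fun hf (IsPrimrec.prod_mk hv (IsPrimrec.head?_fun hs))
    cases k <;> simp only [TM2.stepAux, K'.elim] <;> apply ih <;>
      first | assumption | exact hf' _ (by assumption)
  | pop k f q ih =>
    have hf : IsPrimrec fun p : Option Γ' × Option Γ' => f p.1 p.2 := ⟨_root_.Primrec.dom_finite _⟩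
    have hf' : ∀ s : α → List Γ', IsPrimrec s → IsPrimrec fun x => f (v x) (s x).head? :=
      fun s hs => IsPrimrec.comp_fun hf (IsPrimrec.prod_mk hv (IsPrimrec.head?_fun hs))
    cases k <;> simp only [TM2.stepAux, K'.elim_update_main, K'.elim_update_rev,
      K'.elim_update_aux, K'.elim_update_stack, K'.elim] <;> apply ih <;>
      first | assumption | exact hf' _ (by assumption) | fun_prop
  | load f q ih =>
    have hf : IsPrimrec f := ⟨_root_.Primrec.dom_finite f⟩
    simp only [TM2.stepAux]
    apply ih <;> fun_prop
  | branch f q₁ q₂ ih₁ ih₂ =>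
    have hf : IsPrimrec f := ⟨_root_.Primrec.dom_finite f⟩
    have := IsPrimrec.cond_fun (c := fun x => f (v x)) (by fun_prop) (ih₁ hv ha hb hc hd)
      (ih₂ hv ha hb hc hd)
    refine this.of_eq fun x => ?_
    simp only [TM2.stepAux]
    cases f (v x) <;> rfl
  | goto f =>
    have hf : IsPrimrec f := ⟨_root_.Primrec.dom_finite f⟩
    simp only [TM2.stepAux, Conf.ofCfg, K'.elim]
    fun_prop
  | halt =>
    simp only [TM2.stepAux, Conf.ofCfg, K'.elim]
    fun_prop

theorem IsPrimrec.conf_step [Finite Λ]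
    (M : Λ → TM2.Stmt (fun _ : K' => Γ') Λ (Option Γ')) : IsPrimrec (Conf.step M) := by
  have h : IsPrimrec fun p : Λ × Conf Λ => Conf.ofCfg (TM2.stepAux (M p.1) p.2.2.1
      (K'.elim p.2.2.2.1 p.2.2.2.2.1 p.2.2.2.2.2.1 p.2.2.2.2.2.2)) :=
    IsPrimrec.of_finite_left (f := fun q (c : Conf Λ) => Conf.ofCfg (TM2.stepAux (M q) c.2.1
      (K'.elim c.2.2.1 c.2.2.2.1 c.2.2.2.2.1 c.2.2.2.2.2))) fun q =>
        IsPrimrec.ofCfg_stepAux _ (by fun_prop) (by fun_prop) (by fun_prop) (by fun_prop)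
          (by fun_prop)
  have h2 := _root_.Primrec.option_casesOn (o := fun c : Conf Λ => c.1) (f := fun c => c)
    (g := fun c q => Conf.ofCfg (TM2.stepAux (M q) c.2.1
      (K'.elim c.2.2.1 c.2.2.2.1 c.2.2.2.2.1 c.2.2.2.2.2))) _root_.Primrec.fst _root_.Primrec.id
    (IsPrimrec.comp_fun h (g := fun p : Conf Λ × Λ => (p.2, p.1)) (by fun_prop)).prim
  refine ⟨h2.of_eq fun c => ?_⟩
  rcases c with ⟨_ | q, c⟩ <;> rfl

end FourStacks

/-! ### Bounding a list by the length of its word -/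

/-- A bound for the code of a list of at most `k` numbers that are at most `m`. -/
def listBound (m : ℕ) : ℕ → ℕ
  | 0 => 1
  | k + 1 => Nat.pair m (listBound m k) + 2

theorem encode_lt_listBound (m : ℕ) (l : List ℕ) (h : ∀ a ∈ l, a ≤ m) :
    Encodable.encode l < listBound m l.length := by
  induction l with
  | nil => simp [listBound]
  | cons a l ih =>
    have h1 := ih fun b hb => h b (List.mem_cons_of_mem _ hb)
    have h2 : Nat.pair a (Encodable.encode l) ≤ Nat.pair m (listBound m l.length) :=
      (Nat.pair_lt_pair_right a h1).le.trans
        ((h a (by simp)).eq_or_lt.elim (fun e => e ▸ le_rfl) fun h => (Nat.pair_lt_pair_left _ h).le)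
    simp only [listBound, List.length_cons, Encodable.encode_list_cons, Encodable.encode_nat]
    omega

theorem listBound_mono (m : ℕ) : Monotone (listBound m) := by
  refine monotone_nat_of_le_succ fun k => ?_
  have := Nat.right_le_pair m (listBound m k)
  simp only [listBound]; omega

theorem lt_two_pow_length_trPosNum (n : PosNum) : (n : ℕ) < 2 ^ (trPosNum n).length := by
  induction n with
  | one => simp [trPosNum]
  | bit0 n ih => simp only [trPosNum, PosNum.cast_bit0, List.length_cons, pow_succ]; omega
  | bit1 n ih => simp only [trPosNum, PosNum.cast_bit1, List.length_cons, pow_succ]; omega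

theorem lt_two_pow_length_trNat (n : ℕ) : n < 2 ^ (trNat n).length := by
  rw [trNat]
  conv_lhs => rw [← Num.to_of_nat n]
  cases (n : Num) with
  | zero => simp [trNum]
  | pos p => simpa [trNum] using lt_two_pow_length_trPosNum p

theorem length_le_length_trList (l : List ℕ) : l.length ≤ (trList l).length := by
  induction l with
  | nil => simp
  | cons a l ih => simp; omega

theorem lt_two_pow_length_trList (l : List ℕ) : ∀ a ∈ l, a < 2 ^ (trList l).length := by
  induction l with
  | nil => simp
  | cons b l ih =>
    intro a ha
    rcases List.mem_cons.1 ha with rfl | ha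
    · exact (lt_two_pow_length_trNat a).trans_le (Nat.pow_le_pow_right (by simp) (by simp))
    · exact (ih a ha).trans_le (Nat.pow_le_pow_right (by simp) (by simp; omega))

theorem IsPrimrec.listBound_fun : IsPrimrec fun p : ℕ × ℕ => listBound p.1 p.2 := by
  have := _root_.Primrec.nat_rec' (f := fun p : ℕ × ℕ => p.2) (g := fun _ => 1)
    (h := fun p q => Nat.pair p.1 q.2 + 2) _root_.Primrec.snd (_root_.Primrec.const 1)
    (show IsPrimrec (fun p : (ℕ × ℕ) × ℕ × ℕ => Nat.pair p.1.1 p.2.2 + 2) by fun_prop).prim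
  refine ⟨this.of_eq fun p => ?_⟩
  induction p.2 with
  | zero => rfl
  | succ k ih => simp only [listBound, ← ih]

instance : Fintype K' := ⟨{.main, .rev, .aux, .stack}, fun x => by cases x <;> simp⟩

-- Totality on every list, meaningful or not, is essential: the time bound adds up halting times
-- over all lists with small codes, and each of them has to exist.
open ToPartrec in
theorem exists_machine (c : Code) (hc : ∀ v, (c.eval v).Dom) :
    ∃ f : ℕ × ℕ → ℕ, Computable f ∧ ∃ M : TM2ComputableAux Γ' Γ', ∀ (t : ℕ) (l : List ℕ),
      OutputsInTime M (t :: l) ((c.eval (t :: l)).get (hc _)) (f ((trList l).length, t)) := by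
  classical
  let S := codeSupp c Cont'.halt
  let main : Λ' := trNormal c Cont'.halt
  let _ : Inhabited Λ' := ⟨main⟩
  have hS : TM2.Supports tr S := tr_supports c Cont'.halt
  let Λ : Type := {q // q ∈ S}
  let g : Λ' → Λ := fun q => if h : q ∈ S then ⟨q, h⟩ else ⟨main, hS.1⟩
  have hg : ∀ q ∈ S, (g q).1 = q := fun q hq => by simp [g, hq]
  let P : Λ → TM2.Stmt (fun _ : K' => Γ') Λ (Option Γ') := fun q => mapStmt g (tr q.1)
  let _ : Primcodable Λ := Primcodable.ofEquiv (Fin (Fintype.card Λ)) (Fintype.equivFin Λ)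
  let start : List ℕ → TM2.Cfg (fun _ : K' => Γ') Λ (Option Γ') := fun v =>
    ⟨some ⟨main, hS.1⟩, none, K'.elim (trList v) [] [] []⟩
  have hgm : g main = ⟨main, hS.1⟩ := Subtype.ext (hg _ hS.1)
  have hreach : ∀ v, Reaches (TM2.step P) (start v)
      ⟨none, none, K'.elim (trList ((c.eval v).get (hc v))) [] [] []⟩ := by
    intro v
    have h1 : halt ((c.eval v).get (hc v)) ∈ StateTransition.eval (TM2.step tr) (init c v) := by
      rw [PartrecToTM2.tr_eval]
      exact (Part.mem_map_iff _).2 ⟨_, Part.get_mem _, rfl⟩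
    have h2 := reaches_mapCfg tr S hS g (fun q => q.1) hg (mem_eval.1 h1).1
      (Finset.some_mem_insertNone.2 hS.1)
    have h3 : mapCfg g (init c v) = start v := by
      simp only [mapCfg, init, start, Option.map]
      rw [show g (trNormal c Cont'.halt) = ⟨main, hS.1⟩ from hgm]
    rw [h3] at h2
    exact h2
  choose k hk using fun v => exists_iterate_of_reaches (hreach v)
  have hhalt : ∀ v, ((Conf.step P)^[k v] (.ofCfg (start v))).1 = none := fun v => by
    rw [Conf.iterate_step_ofCfg P _ (hk v)]; rfl
  have hex : ∀ v, ∃ n, decide (((Conf.step P)^[n] (.ofCfg (start v))).1 = none) = true :=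
    fun v => ⟨k v, by simpa using hhalt v⟩
  let T : List ℕ → ℕ := fun v => Nat.find (hex v)
  have hT : Computable T := by
    have hp : IsPrimrec fun p : List ℕ × ℕ =>
        decide (((Conf.step P)^[p.2] (.ofCfg (start p.1))).1 = none) := by
      have h0 : IsPrimrec (Conf.step P) := IsPrimrec.conf_step P
      simp only [Conf.ofCfg, start, K'.elim]
      fun_prop
    -- The halting time is found by unbounded search through a primitive recursive simulation; the
    -- search always succeeds by `hex`.
    have h2 : Partrec fun v => Nat.rfind fun n =>
        (Part.some (decide (((Conf.step P)^[n] (.ofCfg (start v))).1 = none)) : Part Bool) :=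
      Partrec.rfind hp.prim.to_comp.partrec
    refine h2.of_eq fun v => ?_
    refine Part.eq_some_iff.2 (Nat.mem_rfind.2 ⟨?_, fun {m} hm => ?_⟩)
    · exact Part.mem_some_iff.2 (Nat.find_spec (hex v)).symm
    · exact Part.mem_some_iff.2 (Bool.eq_false_iff.2 (Nat.find_min (hex v) hm)).symm
  -- At time `T v` the total simulation has halted. If `k v` were larger, the option-valued
  -- iteration would be `none` at time `k v`, contradicting `hk`.
  have hkT : ∀ v, k v ≤ T v := by
    intro v
    by_contra hlt
    push Not at hlt
    obtain ⟨d, hd⟩ := Nat.exists_eq_add_of_lt hlt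
    have hkv := hk v
    rw [show k v = d + 1 + T v by omega, Function.iterate_add_apply] at hkv
    rcases hb : (flip bind (TM2.step P))^[T v] (some (start v)) with _ | b
    · rw [hb] at hkv
      have : ∀ n, (flip bind (TM2.step P))^[n] none = none := fun n => by
        induction n with
        | zero => rfl
        | succ n ih => rw [Function.iterate_succ_apply', ih]; rfl
      rw [this] at hkv; cases hkv
    · have hl : b.l = none := by
        have := Nat.find_spec (hex v)
        rw [Conf.iterate_step_ofCfg P _ hb] at this
        exact of_decide_eq_true this
      have hn : TM2.step P b = none := by rcases b with ⟨_ | _, _, _⟩ <;> simp_all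
      rw [hb, Function.iterate_succ_apply] at hkv
      have h0 : flip bind (TM2.step P) (some b) = none := hn
      have : ∀ n, (flip bind (TM2.step P))^[n] none = none := fun n => by
        induction n with
        | zero => rfl
        | succ n ih => rw [Function.iterate_succ_apply', ih]; rfl
      rw [h0, this] at hkv; cases hkv
  -- A sum is used in place of a maximum: it dominates each summand. The range contains the code of
  -- every list whose word has length `p.1`.
  let f : ℕ × ℕ → ℕ := fun p =>
    ∑ m ∈ Finset.range (listBound (2 ^ p.1) p.1), T (p.2 :: Denumerable.ofNat (List ℕ) m)
  let tm : FinTM2 :=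
    { K := K', k₀ := K'.main, k₁ := K'.main, Γ := fun _ => Γ', Λ := Λ, main := ⟨main, hS.1⟩,
      σ := Option Γ', initialState := none, m := P }
  have hstk : ∀ w : List Γ', (fun j : K' => if j = K'.main then w else []) =
      K'.elim w [] [] [] := fun w => by funext j; cases j <;> rfl
  refine ⟨f, ?_, ⟨tm, Equiv.refl Γ', Equiv.refl Γ'⟩, fun t l => ⟨⟨⟨k (t :: l), ?_⟩, ?_⟩⟩⟩
  · have h1 : Computable fun p : ℕ × ℕ => listBound (2 ^ p.1) p.1 :=
      (IsPrimrec.comp_fun IsPrimrec.listBound_fun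
        (g := fun p : ℕ × ℕ => (2 ^ p.1, p.1)) (by fun_prop)).prim.to_comp
    have h2 : Computable fun q : (ℕ × ℕ) × ℕ × ℕ =>
        q.2.2 + T (q.1.2 :: Denumerable.ofNat (List ℕ) q.2.1) :=
      Computable.comp (f := fun p : ℕ × ℕ => p.1 + p.2)
        (g := fun q : (ℕ × ℕ) × ℕ × ℕ => (q.2.2, T (q.1.2 :: Denumerable.ofNat (List ℕ) q.2.1)))
        _root_.Primrec.nat_add.to_comp
        (Computable.pair (IsPrimrec.prim (by fun_prop)).to_comp
          (hT.comp (IsPrimrec.prim (by fun_prop)).to_comp))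
    have h3 := Computable.nat_rec (g := fun _ => 0)
      (h := fun (p : ℕ × ℕ) q => q.2 + T (p.2 :: Denumerable.ofNat (List ℕ) q.1)) h1
      (Computable.const 0) h2
    refine h3.of_eq fun p => ?_
    simp only [f]
    induction listBound (2 ^ p.1) p.1 with
    | zero => simp
    | succ j ih => simp [Finset.sum_range_succ, ih]
  · have hi : ∀ w : List Γ', initList tm (w.map (Equiv.refl Γ').symm) =
        ⟨some ⟨main, hS.1⟩, none, K'.elim w [] [] []⟩ := fun w => by
      simp only [initList, Equiv.refl_symm, Equiv.coe_refl, List.map_id]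
      congr 1
      exact hstk w
    have ho : ∀ w : List Γ', haltList tm (w.map (Equiv.refl Γ').symm) =
        ⟨none, none, K'.elim w [] [] []⟩ := fun w => by
      simp only [haltList, Equiv.refl_symm, Equiv.coe_refl, List.map_id]
      congr 1
      exact hstk w
    have h := hk (t :: l)
    rw [← ho] at h
    simp only [start] at h
    rw [← hi] at h
    exact h
  · refine (hkT _).trans ?_
    -- A word of length `n` has at most `n` separators, hence entries, and each entry has at most
    -- `n` binary digits.
    have hm : Encodable.encode l <
        listBound (2 ^ (trList l).length) (trList l).length :=
      (encode_lt_listBound _ _ fun a ha => (lt_two_pow_length_trList l a ha).le).trans_le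
        (listBound_mono _ (length_le_length_trList l))
    have := Finset.single_le_sum (f := fun m => T (t :: Denumerable.ofNat (List ℕ) m))
      (fun i _ => Nat.zero_le _) (Finset.mem_range.2 hm)
    simpa [f] using this

end ConcreteCMSO

namespace ConcreteCMSO

open Turing.ToPartrec Encodable Denumerable

/-! ### Reading formulas -/

section Codes

theorem comp_eval_of_eq {f g : Code} {v w : List ℕ} (h : g.eval v = Part.some w) :
    (f.comp g).eval v = f.eval w := by
  rw [Code.comp_eval]
  exact (congrArg (fun x => Part.bind x f.eval) h).trans (Part.bind_some _ _)

theorem exists_code₁ {g : ℕ → ℕ} (hg : IsPrimrec g) :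
    ∃ c : Code, ∀ v : List ℕ, c.eval v = Part.some [g v.headI] := by
  obtain ⟨c, hc⟩ := Code.exists_code (n := 1) (f := fun v => Part.some (g v.head))
    (Nat.Partrec'.prim (Nat.Primrec'.prim_iff₁.2 hg.prim))
  refine ⟨c.comp Code.head, fun v => ?_⟩
  rw [comp_eval_of_eq (w := [v.headI]) (by simp)]
  exact hc ⟨[v.headI], rfl⟩

theorem exists_code₂ {g : ℕ → ℕ → ℕ} (hg : IsPrimrec fun p : ℕ × ℕ => g p.1 p.2) :
    ∃ c : Code, ∀ v : List ℕ, c.eval v = Part.some [g v.headI v.tail.headI] := by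
  obtain ⟨c, hc⟩ := Code.exists_code (n := 2) (f := fun v => Part.some (g v.head v.tail.head))
    (Nat.Partrec'.prim (Nat.Primrec'.prim_iff₂.2 hg.prim))
  refine ⟨c.comp (Code.cons Code.head (Code.cons Code.tail Code.nil)), fun v => ?_⟩
  rw [comp_eval_of_eq (w := [v.headI, v.tail.headI]) (by simp)]
  exact hc ⟨[v.headI, v.tail.headI], rfl⟩

theorem fix_eval_zero {c : Code} {v w : List ℕ} (h : c.eval v = Part.some (0 :: w)) :
    (Code.fix c).eval v = Part.some w := by
  rw [Code.fix_eval]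
  refine Part.eq_some_iff.2 (PFun.fix_stop ?_)
  rw [h]; simp

theorem fix_eval_next {c : Code} {v w : List ℕ} {n : ℕ} (h : c.eval v = Part.some ((n + 1) :: w)) :
    (Code.fix c).eval v = (Code.fix c).eval w := by
  rw [Code.fix_eval]
  refine PFun.fix_fwd_eq ?_
  rw [h]; simp

/-- The code that turns the number of a list into the list, in reversed order. -/
theorem exists_code_decode :
    ∃ c : Code, ∀ l : List ℕ, c.eval [encode l] = Part.some l.reverse := by
  obtain ⟨a, ha⟩ := exists_code₁ (g := fun n => n.unpair.2) (by fun_prop)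
  obtain ⟨b, hb⟩ := exists_code₁ (g := fun n => n.unpair.1) (by fun_prop)
  -- The code of `x :: l` is the successor of the pair of `x` and the code of `l`, and `nil` has
  -- code `0`. One pass moves `x` to the output and keeps the code of `l`; the loop ends at `0`.
  let body : Code := Code.case Code.zero'
    (Code.cons (Code.succ.comp Code.zero) (Code.cons a (Code.cons b Code.tail)))
  have h0 : ∀ v, body.eval (0 :: v) = Part.some (0 :: v) := fun v => by simp [body]
  have h1 : ∀ n v, body.eval ((n + 1) :: v) = Part.some (1 :: n.unpair.2 :: n.unpair.1 :: v) :=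
    fun n v => by simp [body, ha, hb]
  have h : ∀ (l out : List ℕ), (Code.fix body).eval (encode l :: out) =
      Part.some (l.reverse ++ out) := by
    intro l
    induction l with
    | nil => intro out; exact fix_eval_zero (h0 out)
    | cons x l ih =>
      intro out
      rw [encode_list_cons, fix_eval_next (h1 _ _)]
      simpa using ih (x :: out)
  exact ⟨Code.fix body, fun l => by simpa using h l []⟩

/-- A code that feeds a list to a step function, until a state with `isDone` is reached. -/
theorem exists_code_stream {σ : Type} [Denumerable σ] {step : σ → ℕ → σ} {isDone : σ → Bool}
    (hstep : IsPrimrec fun p : σ × ℕ => step p.1 p.2) (hdone : IsPrimrec isDone) :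
    ∃ c : Code, ∀ (x : σ) (v : List ℕ), c.eval (encode x :: v) =
      bif isDone (step x v.headI) then Part.some (encode (step x v.headI) :: v.tail)
      else c.eval (encode (step x v.headI) :: v.tail) := by
  obtain ⟨a, ha⟩ := exists_code₂ (g := fun s n => encode (step (ofNat σ s) n))
    (show IsPrimrec fun p : ℕ × ℕ => encode (step (ofNat σ p.1) p.2) by fun_prop)
  obtain ⟨b, hb⟩ := exists_code₂ (g := fun s n => (!isDone (step (ofNat σ s) n)).toNat)
    (show IsPrimrec fun p : ℕ × ℕ => (!isDone (step (ofNat σ p.1) p.2)).toNat by fun_prop)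
  let body : Code := Code.cons b (Code.cons a (Code.tail.comp Code.tail))
  have h : ∀ x v, body.eval (encode x :: v) = Part.some
      ((!isDone (step x v.headI)).toNat :: encode (step x v.headI) :: v.tail) := fun x v => by
    simp [body, ha, hb]
  refine ⟨Code.fix body, fun x v => ?_⟩
  cases hs : isDone (step x v.headI)
  · exact fix_eval_next (n := 0) ((h x v).trans (by simp [hs]))
  · exact fix_eval_zero ((h x v).trans (by simp [hs]))

end Codes

/-! ### A reader of prefix notation -/

/-- The nodes of a formula in prefix order, each as a tag with its arguments. -/
def Formula.nodes : Formula → List (List ℕ)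
  | .memV x X => [[0, x, X]]
  | .memE y Y => [[1, y, Y]]
  | .inc x y => [[2, x, y]]
  | .cardV a r _ _ X => [[3, a, r, X]]
  | .cardE a r _ _ Y => [[4, a, r, Y]]
  | .eq k z z' => [[5, k.code, z, z']]
  | .not φ => [6] :: φ.nodes
  | .and φ ψ => [7] :: (φ.nodes ++ ψ.nodes)
  | .or φ ψ => [8] :: (φ.nodes ++ ψ.nodes)
  | .imp φ ψ => [9] :: (φ.nodes ++ ψ.nodes)
  | .iff φ ψ => [10] :: (φ.nodes ++ ψ.nodes)
  | .ex k z φ => [11, k.code, z] :: φ.nodes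
  | .all k z φ => [12, k.code, z] :: φ.nodes

theorem Formula.flatten_nodes (φ : Formula) : φ.nodes.flatten = φ.code := by
  induction φ <;> simp_all [nodes, code]

/-- The number of arguments of a node with a given tag. -/
def tagArgs (a : ℕ) : ℕ := [2, 2, 2, 3, 3, 3, 0, 0, 0, 0, 0, 2, 2].getD a 0

/-- The number of subformulas of a node with a given tag. -/
def tagSubs (a : ℕ) : ℕ := [0, 0, 0, 0, 0, 0, 1, 2, 2, 2, 2, 1, 1].getD a 0

/-- The state of a reader of prefix code: the parameter `t`, the number of pending subformulas, the
number of pending arguments of the last node, and the nodes read so far, the last one first. -/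
abbrev Reader : Type := ℕ × ℕ × ℕ × List (List ℕ)

/-- The reader reads a number. -/
def Reader.step (x : Reader) (a : ℕ) : Reader :=
  if x.2.2.1 = 0 then (x.1, x.2.1 - 1 + tagSubs a, tagArgs a, [a] :: x.2.2.2)
  else (x.1, x.2.1, x.2.2.1 - 1, (x.2.2.2.headI ++ [a]) :: x.2.2.2.tail)

/-- The reader has read a complete formula. -/
def Reader.isDone (x : Reader) : Bool := decide (x.2.1 = 0) && decide (x.2.2.1 = 0)

@[fun_prop] theorem IsPrimrec.tagArgs_fun : IsPrimrec tagArgs :=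
  getD_fun 0 (const_fun _) id_fun

@[fun_prop] theorem IsPrimrec.tagSubs_fun : IsPrimrec tagSubs :=
  getD_fun 0 (const_fun _) id_fun

theorem IsPrimrec.reader_step : IsPrimrec fun p : Reader × ℕ => p.1.step p.2 := by
  unfold Reader.step
  fun_prop

theorem IsPrimrec.reader_isDone : IsPrimrec Reader.isDone := by
  unfold Reader.isDone
  fun_prop

section Reading

variable {c : Code} (hc : ∀ (x : Reader) (v : List ℕ), c.eval (encode x :: v) =
  bif (x.step v.headI).isDone then Part.some (encode (x.step v.headI) :: v.tail)
  else c.eval (encode (x.step v.headI) :: v.tail))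

/-- The result of the reader with code `c` on the list `v`, beginning in the state `x`. -/
def readFrom (c : Code) (x : Reader) (v : List ℕ) : Part (List ℕ) :=
  bif x.isDone then Part.some (encode x :: v) else c.eval (encode x :: v)

include hc

theorem readFrom_of_not_done (x : Reader) (v : List ℕ) (h : x.isDone = false) :
    readFrom c x v = readFrom c (x.step v.headI) v.tail := by
  rw [readFrom, h, cond_false, hc]; rfl

theorem readFrom_tag (t p a : ℕ) (acc : List (List ℕ)) (v : List ℕ) :
    readFrom c (t, p + 1, 0, acc) (a :: v) =
      readFrom c (t, p + tagSubs a, tagArgs a, [a] :: acc) v := by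
  rw [readFrom_of_not_done hc _ _ (by simp [Reader.isDone])]
  simp [Reader.step]

theorem readFrom_arg (t p n a : ℕ) (b : List ℕ) (acc : List (List ℕ)) (v : List ℕ) :
    readFrom c (t, p, n + 1, b :: acc) (a :: v) = readFrom c (t, p, n, (b ++ [a]) :: acc) v := by
  rw [readFrom_of_not_done hc _ _ (by simp [Reader.isDone])]
  simp [Reader.step]

/-- Prefix notation is self-delimiting: reading a whole subformula settles exactly one pending
subformula. The general `p`, `acc` and `v` make the induction go through for the left operand of a
binary connective. -/
theorem readFrom_code (φ : Formula) : ∀ (t p : ℕ) (acc : List (List ℕ)) (v : List ℕ),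
    readFrom c (t, p + 1, 0, acc) (φ.code ++ v) =
      readFrom c (t, p, 0, φ.nodes.reverse ++ acc) v := by
  have htag := readFrom_tag hc
  have harg := readFrom_arg hc
  induction φ with
  | not φ ih =>
    intro t p acc v
    simp [Formula.code, Formula.nodes, htag, tagSubs, tagArgs, ih]
  | ex k z φ ih | all k z φ ih =>
    intro t p acc v
    simp [Formula.code, Formula.nodes, htag, harg, tagSubs, tagArgs, ih]
  | and φ ψ ih₁ ih₂ | or φ ψ ih₁ ih₂ | imp φ ψ ih₁ ih₂ | iff φ ψ ih₁ ih₂ =>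
    intro t p acc v
    simp only [Formula.code, Formula.nodes, List.cons_append, htag, tagSubs, tagArgs]
    simp [ih₁ t (p + 1), ih₂]
  | _ => intro t p acc v; simp [Formula.code, Formula.nodes, htag, harg, tagSubs, tagArgs]

/-- Past the end of the input the reader sees zeros. As a tag, zero has two arguments and no
subformula, so it trades a pending subformula of weight `3` for two arguments of weight `1`; an
argument costs one. Hence the measure decreases and malformed input cannot cause a loop. -/
theorem readFrom_nil_dom (m : ℕ) : ∀ x : Reader, 3 * x.2.1 + x.2.2.1 ≤ m →
    (readFrom c x []).Dom := by
  induction m with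
  | zero =>
    intro x h
    have : x.isDone = true := by simp [Reader.isDone]; omega
    simp [readFrom, this]
  | succ m ih =>
    intro x h
    cases hs : x.isDone
    · rw [readFrom_of_not_done hc _ _ hs]
      refine ih _ ?_
      simp only [Reader.isDone, Bool.and_eq_false_iff, decide_eq_false_iff_not] at hs
      simp only [Reader.step, List.headI, tagSubs, tagArgs]
      split_ifs <;> simp <;> omega
    · simp [readFrom, hs]

theorem readFrom_dom (v : List ℕ) : ∀ x : Reader, (readFrom c x v).Dom := by
  induction v with
  | nil => exact fun x => readFrom_nil_dom hc _ x le_rfl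
  | cons a v ih =>
    intro x
    cases hs : x.isDone
    · rw [readFrom_of_not_done hc _ _ hs]; exact ih _
    · simp [readFrom, hs]

end Reading

/-- Every primitive recursive function of `t` and the nodes of `φ` has a total code that reads `t`
and the word of `φ`. -/
theorem exists_code_of_nodes {F : ℕ → List (List ℕ) → List ℕ}
    (hF : IsPrimrec fun p : ℕ × List (List ℕ) => F p.1 p.2) :
    ∃ c : Code, (∀ v, (c.eval v).Dom) ∧
      ∀ (t : ℕ) (φ : Formula), c.eval (t :: φ.code) = Part.some (F t φ.nodes) := by
  obtain ⟨r, hr⟩ := exists_code_stream IsPrimrec.reader_step IsPrimrec.reader_isDone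
  obtain ⟨i, hi⟩ := exists_code₁ (g := fun t => encode ((t, 1, 0, []) : Reader)) (by fun_prop)
  obtain ⟨d, hd⟩ := exists_code_decode
  -- The result is reversed before encoding because the decoder `d` outputs the reverse of the list.
  obtain ⟨o, ho⟩ := exists_code₁ (g := fun s => encode
    (F (ofNat Reader s).1 (ofNat Reader s).2.2.2.reverse).reverse) (by
      have : IsPrimrec fun s : ℕ => ofNat Reader s := ⟨_root_.Primrec.ofNat Reader⟩
      have h2 : IsPrimrec fun s : ℕ => F (ofNat Reader s).1 (ofNat Reader s).2.2.2.reverse :=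
        IsPrimrec.comp_fun hF (g := fun s : ℕ => ((ofNat Reader s).1, (ofNat Reader s).2.2.2.reverse))
          (by fun_prop)
      fun_prop)
  have hread : ∀ v : List ℕ, ((r.comp (Code.cons i Code.tail)).eval v) =
      readFrom r (v.headI, 1, 0, []) v.tail := fun v => by
    rw [comp_eval_of_eq (w := encode ((v.headI, 1, 0, []) : Reader) :: v.tail)
      (by simp only [Code.cons_eval, hi]; simp)]
    rfl
  have hout : ∀ w : List ℕ, (d.comp o).eval w = Part.some
      (F (ofNat Reader w.headI).1 (ofNat Reader w.headI).2.2.2.reverse) := fun w => by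
    rw [comp_eval_of_eq (ho w), hd, List.reverse_reverse]
  refine ⟨(d.comp o).comp (r.comp (Code.cons i Code.tail)), fun v => ?_, fun t φ => ?_⟩
  · rw [Code.comp_eval]
    refine Part.bind_dom.2 ⟨?_, ?_⟩
    · rw [hread]; exact readFrom_dom hr _ _
    · rw [hout]; trivial
  · have := readFrom_code hr φ t 0 [] []
    simp only [List.append_nil, zero_add] at this
    have e : readFrom r (t, 0, 0, φ.nodes.reverse) [] =
      Part.some [encode ((t, 0, 0, φ.nodes.reverse) : Reader)] := rfl
    rw [comp_eval_of_eq ((hread (t :: φ.code)).trans (this.trans e)), hout, List.headI_cons, ofNat_encode,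
      List.reverse_reverse]

end ConcreteCMSO

namespace ConcreteCMSO

/-! ### Tabulated automata on labelled trees -/

/-- A deterministic automaton on binary trees whose nodes are labelled with natural numbers: the
number `N` of states `1, …, N`, the table of the transitions and the table of the final states. The
number `0` stands for a missing child. -/
abbrev Aut : Type := ℕ × List ℕ × List Bool

namespace Aut

/-- The state reached with the letter `x` from the states `i` and `j` of the children. -/
def next (A : Aut) (x i j : ℕ) : ℕ := A.2.1.getD (Nat.pair x (Nat.pair i j)) 0

/-- Whether a state is final. -/
def final (A : Aut) (q : ℕ) : Bool := A.2.2.getD q false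

/-- The automaton with `N` states over the letters below `L` with given transitions and final
states. -/
def tabulate (L N : ℕ) (d : ℕ → ℕ → ℕ → ℕ) (f : ℕ → Bool) : Aut :=
  (N, (List.range (Nat.pair L (Nat.pair (N + 1) (N + 1)))).map
    fun n => d n.unpair.1 n.unpair.2.unpair.1 n.unpair.2.unpair.2, (List.range (N + 1)).map f)

theorem next_tabulate {L N : ℕ} (d : ℕ → ℕ → ℕ → ℕ) (f : ℕ → Bool) {x i j : ℕ} (hx : x < L)
    (hi : i ≤ N) (hj : j ≤ N) : (tabulate L N d f).next x i j = d x i j := by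
  have h : Nat.pair x (Nat.pair i j) < Nat.pair L (Nat.pair (N + 1) (N + 1)) :=
    (Nat.pair_lt_pair_left _ hx).trans (Nat.pair_lt_pair_right _
      ((Nat.pair_lt_pair_left _ (by omega)).trans (Nat.pair_lt_pair_right _ (by omega))))
  simp [next, tabulate, List.getD_eq_getElem?_getD, List.getElem?_range h]

theorem final_tabulate {L N : ℕ} (d : ℕ → ℕ → ℕ → ℕ) (f : ℕ → Bool) {q : ℕ} (hq : q ≤ N) :
    (tabulate L N d f).final q = f q := by
  have h : q < N + 1 := by omega
  simp [final, tabulate, List.getD_eq_getElem?_getD, List.getElem?_range h]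

variable {B : Type}

/-- The state reached on the tree of positions of `T` with the labels `ℓ`. -/
def run (A : Aut) : Term B → (List ℕ → ℕ) → ℕ
  | .leaf _, ℓ => A.next (ℓ []) 0 0
  | .unary _ T, ℓ => A.next (ℓ []) (A.run T fun p => ℓ (1 :: p)) 0
  | .binary _ T₁ T₂, ℓ =>
      A.next (ℓ []) (A.run T₁ fun p => ℓ (1 :: p)) (A.run T₂ fun p => ℓ (2 :: p))

/-- The automaton accepts the tree of positions of `T` with the labels `ℓ`. -/
def Accepts (A : Aut) (T : Term B) (ℓ : List ℕ → ℕ) : Prop := A.final (A.run T ℓ) = true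

/-- On trees with labels below `L` the automaton stays within its states. -/
def Bounded (A : Aut) (B : Type) (L : ℕ) : Prop :=
  ∀ (T : Term B) (ℓ : List ℕ → ℕ), (∀ p, ℓ p < L) → 0 < A.run T ℓ ∧ A.run T ℓ ≤ A.1

/-- The common induction for products, projections and weighted sums: a function obeying the
recursion of the table and staying within its range is the run. Each construction then only has to
name its intended state. -/
theorem run_tabulate {L N : ℕ} {d : ℕ → ℕ → ℕ → ℕ} {f : ℕ → Bool}
    {r : Term B → (List ℕ → ℕ) → ℕ} (hN : ∀ T ℓ, (∀ p, ℓ p < L) → r T ℓ ≤ N)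
    (h₀ : ∀ a ℓ, (∀ p, ℓ p < L) → r (.leaf a) ℓ = d (ℓ []) 0 0)
    (h₁ : ∀ a T ℓ, (∀ p, ℓ p < L) → r (.unary a T) ℓ = d (ℓ []) (r T fun p => ℓ (1 :: p)) 0)
    (h₂ : ∀ a T₁ T₂ ℓ, (∀ p, ℓ p < L) → r (.binary a T₁ T₂) ℓ =
      d (ℓ []) (r T₁ fun p => ℓ (1 :: p)) (r T₂ fun p => ℓ (2 :: p)))
    (T : Term B) : ∀ ℓ, (∀ p, ℓ p < L) → (tabulate L N d f).run T ℓ = r T ℓ := by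
  induction T with
  | leaf a => intro ℓ h; rw [run, next_tabulate _ _ (h _) (by omega) (by omega), h₀ _ _ h]
  | unary a T ih =>
    intro ℓ h
    have h' : ∀ p, ℓ (1 :: p) < L := fun p => h _
    rw [run, ih _ h', next_tabulate _ _ (h _) (hN _ _ h') (by omega), h₁ _ _ _ h]
  | binary a T₁ T₂ ih₁ ih₂ =>
    intro ℓ h
    have h' : ∀ p, ℓ (1 :: p) < L := fun p => h _
    have h'' : ∀ p, ℓ (2 :: p) < L := fun p => h _
    rw [run, ih₁ _ h', ih₂ _ h'', next_tabulate _ _ (h _) (hN _ _ h') (hN _ _ h''), h₂ _ _ _ _ h]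

/-! #### Complement -/

/-- The complement. -/
def compl (A : Aut) : Aut := (A.1, A.2.1, (List.range (A.1 + 1)).map fun q => !A.final q)

theorem run_compl (A : Aut) (T : Term B) : ∀ ℓ, A.compl.run T ℓ = A.run T ℓ := by
  induction T with
  | leaf a => intro ℓ; rfl
  | unary a T ih => intro ℓ; simp only [run, ih]; rfl
  | binary a T₁ T₂ ih₁ ih₂ => intro ℓ; simp only [run, ih₁, ih₂]; rfl

theorem Bounded.compl {A : Aut} {L : ℕ} (hA : A.Bounded B L) : A.compl.Bounded B L := by
  intro T ℓ h
  rw [run_compl]; exact hA T ℓ h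

theorem accepts_compl {A : Aut} {L : ℕ} (hA : A.Bounded B L) (T : Term B) {ℓ : List ℕ → ℕ}
    (h : ∀ p, ℓ p < L) : A.compl.Accepts T ℓ ↔ ¬ A.Accepts T ℓ := by
  have := (hA T ℓ h).2
  rw [Accepts, Accepts, run_compl, final, compl]
  simp [List.getD_eq_getElem?_getD, List.getElem?_range (show A.run T ℓ < A.1 + 1 by omega)]

/-! #### Boolean combinations -/

/-- The product, with the final states combined by `op`. -/
def prod (op : Bool → Bool → Bool) (L : ℕ) (A A' : Aut) : Aut :=
  tabulate L (Nat.pair A.1 A'.1)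
    (fun x i j => Nat.pair (A.next x i.unpair.1 j.unpair.1) (A'.next x i.unpair.2 j.unpair.2))
    (fun q => op (A.final q.unpair.1) (A'.final q.unpair.2))

theorem pair_le_pair {a b c d : ℕ} (h : a ≤ c) (h' : b ≤ d) : Nat.pair a b ≤ Nat.pair c d :=
  (h.eq_or_lt.elim (fun e => e ▸ le_rfl) fun h => (Nat.pair_lt_pair_left _ h).le).trans
    (h'.eq_or_lt.elim (fun e => e ▸ le_rfl) fun h => (Nat.pair_lt_pair_right _ h).le)

theorem run_prod (op : Bool → Bool → Bool) {L : ℕ} {A A' : Aut} (hA : A.Bounded B L)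
    (hA' : A'.Bounded B L) (T : Term B) (ℓ : List ℕ → ℕ) (h : ∀ p, ℓ p < L) :
    (prod op L A A').run T ℓ = Nat.pair (A.run T ℓ) (A'.run T ℓ) := by
  refine run_tabulate (r := fun T ℓ => Nat.pair (A.run T ℓ) (A'.run T ℓ)) ?_ ?_ ?_ ?_ T ℓ h
  · exact fun T ℓ h => pair_le_pair (hA T ℓ h).2 (hA' T ℓ h).2
  -- For missing children this uses that `0` unpairs to `(0, 0)`: a child missing in the product is
  -- missing in both factors.
  all_goals intros; simp [run]

theorem Bounded.prod (op : Bool → Bool → Bool) {L : ℕ} {A A' : Aut} (hA : A.Bounded B L)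
    (hA' : A'.Bounded B L) : (prod op L A A').Bounded B L := by
  intro T ℓ h
  rw [run_prod op hA hA' T ℓ h]
  exact ⟨(hA T ℓ h).1.trans_le (Nat.left_le_pair _ _), pair_le_pair (hA T ℓ h).2 (hA' T ℓ h).2⟩

theorem accepts_prod (op : Bool → Bool → Bool) {L : ℕ} {A A' : Aut} (hA : A.Bounded B L)
    (hA' : A'.Bounded B L) (T : Term B) {ℓ : List ℕ → ℕ} (h : ∀ p, ℓ p < L) :
    (Aut.prod op L A A').Accepts T ℓ ↔
      op (A.final (A.run T ℓ)) (A'.final (A'.run T ℓ)) = true := by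
  rw [Accepts, run_prod op hA hA' T ℓ h, Aut.prod,
    final_tabulate _ _ (pair_le_pair (hA T ℓ h).2 (hA' T ℓ h).2)]
  simp

/-! #### Projection -/

/-- The number whose binary digits below `n` are given by `P`. -/
def mask (n : ℕ) (P : ℕ → Bool) : ℕ := ∑ i ∈ Finset.range n, (P i).toNat * 2 ^ i

theorem mask_lt (n : ℕ) (P : ℕ → Bool) : mask n P < 2 ^ n := by
  induction n with
  | zero => simp [mask]
  | succ n ih =>
    rw [mask, Finset.sum_range_succ, ← mask, pow_succ]
    have := Bool.toNat_le (P n)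
    nlinarith

theorem testBit_mask (n : ℕ) (P : ℕ → Bool) (i : ℕ) :
    (mask n P).testBit i = (decide (i < n) && P i) := by
  induction n with
  | zero => simp [mask]
  | succ n ih =>
    rw [mask, Finset.sum_range_succ, ← mask]
    rcases lt_trichotomy i n with h | rfl | h
    · cases hP : P n
      · simp [ih, h, h.trans (Nat.lt_succ_self n)]
      · simp only [Bool.toNat_true, one_mul]
        rw [add_comm, Nat.testBit_two_pow_add_gt h, ih]
        simp [h, h.trans (Nat.lt_succ_self n)]
    · cases hP : P i
      · simp [ih]
      · simp only [Bool.toNat_true, one_mul]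
        rw [add_comm, Nat.testBit_two_pow_add_eq, ih]
        simp
    · have hlt : mask n P + (P n).toNat * 2 ^ n < 2 ^ i := by
        have h1 := mask_lt (n + 1) P
        rw [mask, Finset.sum_range_succ, ← mask] at h1
        exact h1.trans_le (Nat.pow_le_pow_right (by simp) h)
      rw [Nat.testBit_lt_two_pow hlt]
      simp; omega

/-- Membership in the set of states denoted by a number; `0` denotes the missing child. -/
def memSet (I i : ℕ) : Bool := bif decide (I = 0) then decide (i = 0) else I.testBit i

/-- Bounded existential quantification. -/
def bexists (n : ℕ) (P : ℕ → Bool) : Bool := decide (0 < ∑ i ∈ Finset.range n, (P i).toNat)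

theorem bexists_iff {n : ℕ} {P : ℕ → Bool} : bexists n P = true ↔ ∃ i < n, P i = true := by
  have h : ∀ b : Bool, 0 < b.toNat ↔ b = true := by decide
  simp [bexists, Finset.sum_pos_iff, h]

/-- The projection along a relation `R` of letters. -/
def proj (L : ℕ) (R : ℕ → ℕ → Bool) (A : Aut) : Aut :=
  tabulate L (2 ^ (A.1 + 1))
    (fun x I J => mask (A.1 + 1) fun q => bexists L fun x' => R x x' &&
      bexists (A.1 + 1) fun i => memSet I i && bexists (A.1 + 1) fun j => memSet J j &&
        decide (A.next x' i j = q))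
    (fun I => bexists (A.1 + 1) fun q => I.testBit q && A.final q)

open Classical in
/-- The set of the states that `A` reaches with labels related to `ℓ`, as a number. -/
noncomputable def projRun (L : ℕ) (R : ℕ → ℕ → Bool) (A : Aut) (T : Term B) (ℓ : List ℕ → ℕ) : ℕ :=
  mask (A.1 + 1) fun q => decide (∃ ℓ' : List ℕ → ℕ, (∀ p, ℓ' p < L) ∧
    (∀ p, R (ℓ p) (ℓ' p) = true) ∧ A.run T ℓ' = q)

section Projection

variable {L : ℕ} {R : ℕ → ℕ → Bool} {A : Aut}

theorem testBit_projRun (hA : A.Bounded B L) (T : Term B) (ℓ : List ℕ → ℕ) (q : ℕ) :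
    (projRun L R A T ℓ).testBit q = true ↔ ∃ ℓ' : List ℕ → ℕ, (∀ p, ℓ' p < L) ∧
      (∀ p, R (ℓ p) (ℓ' p) = true) ∧ A.run T ℓ' = q := by
  rw [projRun, testBit_mask]
  simp only [Bool.and_eq_true, decide_eq_true_eq, and_iff_right_iff_imp]
  rintro ⟨ℓ', h, -, rfl⟩
  have := (hA T ℓ' h).2
  omega

variable (hR : ∀ x < L, R x x = true)

include hR

/-- By reflexivity of `R` the labels `ℓ` are related to themselves, so the set of reachable states
is non-empty. Its number is therefore never confused with `0`, the missing child. -/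
theorem projRun_pos (hA : A.Bounded B L) (T : Term B) {ℓ : List ℕ → ℕ} (h : ∀ p, ℓ p < L) :
    projRun L R A T ℓ ≠ 0 := by
  intro h0
  have := (testBit_projRun (R := R) hA T ℓ (A.run T ℓ)).2 ⟨ℓ, h, fun p => hR _ (h p), rfl⟩
  rw [h0] at this
  simp at this

theorem memSet_projRun (hA : A.Bounded B L) (T : Term B) {ℓ : List ℕ → ℕ} (h : ∀ p, ℓ p < L)
    (q : ℕ) : memSet (projRun L R A T ℓ) q = true ↔ ∃ ℓ' : List ℕ → ℕ, (∀ p, ℓ' p < L) ∧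
      (∀ p, R (ℓ p) (ℓ' p) = true) ∧ A.run T ℓ' = q := by
  rw [← testBit_projRun hA, memSet]
  simp [projRun_pos hR hA T h]

/-- The subset construction is exact because the letter of the root and the labels of the two
subtrees can be chosen independently and then glued. -/
theorem run_proj (hA : A.Bounded B L) (T : Term B) (ℓ : List ℕ → ℕ) (h : ∀ p, ℓ p < L) :
    (proj L R A).run T ℓ = projRun L R A T ℓ := by
  have hmem0 : ∀ i, memSet 0 i = true ↔ i = 0 := fun i => by simp [memSet]
  refine run_tabulate (r := projRun L R A) (fun T ℓ _ => (mask_lt _ _).le) ?_ ?_ ?_ T ℓ h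
  · intro a ℓ h
    rw [projRun]
    congr 1
    funext q
    rw [Bool.eq_iff_iff]
    simp only [decide_eq_true_eq, bexists_iff, Bool.and_eq_true, hmem0]
    constructor
    · rintro ⟨ℓ', h', hr, rfl⟩
      exact ⟨ℓ' [], h' _, hr _, 0, by omega, rfl, 0, by omega, rfl, rfl⟩
    · rintro ⟨x, hx, hr, i, -, rfl, j, -, rfl, rfl⟩
      -- Labels are functions on all strings; off the term the old labels are kept, which is allowed
      -- because `R` is reflexive.
      refine ⟨fun p => match p with | [] => x | p => ℓ p, ?_, ?_, rfl⟩
      · rintro (_ | ⟨_, _⟩); exacts [hx, h _]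
      · rintro (_ | ⟨_, _⟩); exacts [hr, hR _ (h _)]
  · intro a T ℓ h
    rw [projRun]
    congr 1
    funext q
    rw [Bool.eq_iff_iff]
    simp only [decide_eq_true_eq, bexists_iff, Bool.and_eq_true, hmem0,
      memSet_projRun hR hA T (ℓ := fun p => ℓ (1 :: p)) fun p => h _]
    constructor
    · rintro ⟨ℓ', h', hr, rfl⟩
      have := (hA T (fun p => ℓ' (1 :: p)) fun p => h' _).2
      exact ⟨ℓ' [], h' _, hr _, _, by omega, ⟨_, fun p => h' _, fun p => hr _, rfl⟩,
        0, by omega, rfl, rfl⟩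
    · rintro ⟨x, hx, hr, _, -, ⟨ℓ₁, h₁, hr₁, rfl⟩, _, -, rfl, rfl⟩
      refine ⟨fun p => match p with | [] => x | 1 :: p => ℓ₁ p | p => ℓ p, ?_, ?_, rfl⟩
      · intro p; dsimp only; split; exacts [hx, h₁ _, h _]
      · intro p; dsimp only; split; exacts [hr, hr₁ _, hR _ (h _)]
  · intro a T₁ T₂ ℓ h
    rw [projRun]
    congr 1
    funext q
    rw [Bool.eq_iff_iff]
    simp only [decide_eq_true_eq, bexists_iff, Bool.and_eq_true,
      memSet_projRun hR hA T₁ (ℓ := fun p => ℓ (1 :: p)) fun p => h _,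
      memSet_projRun hR hA T₂ (ℓ := fun p => ℓ (2 :: p)) fun p => h _]
    constructor
    · rintro ⟨ℓ', h', hr, rfl⟩
      have i₁ := (hA T₁ (fun p => ℓ' (1 :: p)) fun p => h' _).2
      have i₂ := (hA T₂ (fun p => ℓ' (2 :: p)) fun p => h' _).2
      exact ⟨ℓ' [], h' _, hr _, _, by omega, ⟨_, fun p => h' _, fun p => hr _, rfl⟩,
        _, by omega, ⟨_, fun p => h' _, fun p => hr _, rfl⟩, rfl⟩
    · rintro ⟨x, hx, hr, _, -, ⟨ℓ₁, h₁, hr₁, rfl⟩, _, -, ⟨ℓ₂, h₂, hr₂, rfl⟩, rfl⟩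
      refine ⟨fun p => match p with | [] => x | 1 :: p => ℓ₁ p | 2 :: p => ℓ₂ p | p => ℓ p,
        ?_, ?_, rfl⟩
      · intro p; dsimp only; split; exacts [hx, h₁ _, h₂ _, h _]
      · intro p; dsimp only; split; exacts [hr, hr₁ _, hr₂ _, hR _ (h _)]

theorem Bounded.proj (hA : A.Bounded B L) : (proj L R A).Bounded B L := by
  intro T ℓ h
  rw [run_proj hR hA T ℓ h]
  exact ⟨Nat.pos_of_ne_zero (projRun_pos hR hA T h), (mask_lt _ _).le⟩

theorem accepts_proj (hA : A.Bounded B L) (T : Term B) {ℓ : List ℕ → ℕ} (h : ∀ p, ℓ p < L) :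
    (Aut.proj L R A).Accepts T ℓ ↔ ∃ ℓ' : List ℕ → ℕ, (∀ p, ℓ' p < L) ∧
      (∀ p, R (ℓ p) (ℓ' p) = true) ∧ A.Accepts T ℓ' := by
  rw [Accepts, run_proj hR hA T ℓ h, Aut.proj,
    final_tabulate _ _ (show projRun L R A T ℓ ≤ _ from (mask_lt _ _).le)]
  simp only [bexists_iff, Bool.and_eq_true, testBit_projRun hA]
  constructor
  · rintro ⟨_, -, ⟨ℓ', h', hr, rfl⟩, hf⟩
    exact ⟨ℓ', h', hr, hf⟩
  · rintro ⟨ℓ', h', hr, hf⟩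
    have := (hA T ℓ' h').2
    exact ⟨_, by omega, ⟨ℓ', h', hr, rfl⟩, hf⟩

end Projection

/-! #### Weighted sums -/

/-- The representative of `n` in the counter with threshold `2` and period `r`. -/
def red (r n : ℕ) : ℕ := if n < 2 then n else 2 + (n - 2) % r

theorem red_lt {r : ℕ} (hr : 0 < r) (n : ℕ) : red r n < r + 2 := by
  unfold red
  have := Nat.mod_lt (n - 2) hr
  split_ifs <;> omega

/-- Reduction is compatible with addition, so a sum may be reduced at every node of the tree. -/
theorem red_red_add (r a b : ℕ) : red r (red r a + b) = red r (a + b) := by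
  by_cases h : a < 2
  · simp [red, h]
  · simp only [red, h, if_false]
    rw [if_neg (by omega), if_neg (by omega)]
    have h1 : 2 + (a - 2) % r + b - 2 = (a - 2) % r + b := by omega
    have h2 : a + b - 2 = a - 2 + b := by omega
    rw [h1, h2, Nat.mod_add_mod]

theorem red_red_add_add (r a b c d : ℕ) :
    red r (red r a + b + (red r c + d)) = red r (a + b + (c + d)) := by
  rw [show red r a + b + (red r c + d) = red r a + (red r c + (b + d)) by ring, red_red_add,
    show a + (red r c + (b + d)) = red r c + (a + (b + d)) by ring, red_red_add]
  congr 1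
  ring

theorem red_eq_zero_iff {r n : ℕ} : red r n = 0 ↔ n = 0 := by
  unfold red; split_ifs <;> omega

theorem red_eq_one_iff {r n : ℕ} : red r n = 1 ↔ n = 1 := by
  unfold red; split_ifs <;> omega

theorem red_mod (r n : ℕ) : red r n % r = n % r := by
  unfold red
  split_ifs with h
  · rfl
  · rw [Nat.add_mod_mod]; congr 1; omega

/-- The sum of the weights of all nodes but the root; `w (y + 1) x` is the weight of a node with the
letter `x` whose parent has the letter `y`. -/
def innerWeight (w : ℕ → ℕ → ℕ) : Term B → (List ℕ → ℕ) → ℕ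
  | .leaf _, _ => 0
  | .unary _ T, ℓ => innerWeight w T (fun p => ℓ (1 :: p)) + w (ℓ [] + 1) (ℓ [1])
  | .binary _ T₁ T₂, ℓ =>
      (innerWeight w T₁ (fun p => ℓ (1 :: p)) + w (ℓ [] + 1) (ℓ [1])) +
        (innerWeight w T₂ (fun p => ℓ (2 :: p)) + w (ℓ [] + 1) (ℓ [2]))

/-- The sum of the weights of all nodes; `w 0 x` is the weight of a root with the letter `x`. -/
def weight (w : ℕ → ℕ → ℕ) (T : Term B) (ℓ : List ℕ → ℕ) : ℕ := innerWeight w T ℓ + w 0 (ℓ [])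

/-- The contribution of a child in the state `i` to the weight of a node with the letter `x`. -/
def contrib (w : ℕ → ℕ → ℕ) (x i : ℕ) : ℕ :=
  if i = 0 then 0 else (i - 1).unpair.2 + w (x + 1) (i - 1).unpair.1

/-- The automaton that tests whether the reduced weight of the tree satisfies `acc`. -/
def atom (L r : ℕ) (w : ℕ → ℕ → ℕ) (acc : ℕ → Bool) : Aut :=
  tabulate L (Nat.pair L (r + 2) + 1)
    (fun x i j => Nat.pair x (red r (contrib w x i + contrib w x j)) + 1)
    (fun q => acc (red r ((q - 1).unpair.2 + w 0 (q - 1).unpair.1)))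

section Weights

variable {L r : ℕ} (hr : 0 < r) (w : ℕ → ℕ → ℕ) (acc : ℕ → Bool)

include hr

theorem pair_red_le {x : ℕ} (hx : x < L) (n : ℕ) :
    Nat.pair x (red r n) + 1 ≤ Nat.pair L (r + 2) + 1 :=
  Nat.succ_le_succ (pair_le_pair hx.le (red_lt hr n).le)

/-- The weight of a root depends on its parent, which is not yet known. The state thus stores the
letter of the root beside the reduced weight below it, and the root is charged one level higher or
at acceptance. The successor keeps `0` free for a missing child. -/
theorem run_atom (T : Term B) (ℓ : List ℕ → ℕ) (h : ∀ p, ℓ p < L) :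
    (atom L r w acc).run T ℓ = Nat.pair (ℓ []) (red r (innerWeight w T ℓ)) + 1 := by
  refine run_tabulate (r := fun T ℓ => Nat.pair (ℓ []) (red r (innerWeight w T ℓ)) + 1)
    (fun T ℓ h => pair_red_le hr (h _) _) ?_ ?_ ?_ T ℓ h
  · intro a ℓ _; simp [innerWeight, contrib]
  · intro a T ℓ _
    simp only [innerWeight, contrib]
    simp [red_red_add]
  · intro a T₁ T₂ ℓ _
    simp only [innerWeight, contrib]
    simp only [Nat.add_eq_zero_iff, one_ne_zero, and_false, if_false, Nat.add_sub_cancel,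
      Nat.unpair_pair]
    rw [red_red_add_add]

theorem Bounded.atom : (atom L r w acc).Bounded B L := by
  intro T ℓ h
  rw [run_atom hr w acc T ℓ h]
  exact ⟨Nat.succ_pos _, pair_red_le hr (h _) _⟩

theorem accepts_atom (T : Term B) {ℓ : List ℕ → ℕ} (h : ∀ p, ℓ p < L) :
    (Aut.atom L r w acc).Accepts T ℓ ↔ acc (red r (weight w T ℓ)) = true := by
  rw [Accepts, run_atom hr w acc T ℓ h, Aut.atom, final_tabulate _ _ (pair_red_le hr (h _) _)]
  simp [red_red_add, weight]

end Weights

end Aut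

end ConcreteCMSO

namespace ConcreteCMSO

/-! ### Letters -/

/-- The index of the variable `z` of the sort with code `k` in a letter; the indices `0` and `1`
belong to the bag. -/
def varIx (k z : ℕ) : ℕ := 2 + 4 * z + k

/-- The bit of a letter at `s` with index `v`. -/
def bit (x s v : ℕ) : Bool := x.testBit (Nat.pair s v)

/-- `s` belongs to the set `B` of the bag. -/
def inB (x s : ℕ) : Bool := bit x s 0 || bit x s 1

/-- `s` belongs to the set `b` of the bag. -/
def inb (x s : ℕ) : Bool := bit x s 1

/-- The number of `s < t` with `P s`. -/
def count (t : ℕ) (P : ℕ → Bool) : ℕ := ∑ s ∈ Finset.range t, (P s).toNat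

/-- The places where a letter can be marked: at each element of `B` for vertices, and at `0` for
edges if there is an edge. -/
def site (t : ℕ) (e : Bool) (x s : ℕ) : Bool :=
  bif e then decide (s = 0) && Aut.bexists t (inb x) else inB x s

/-- The number of places with both marks. -/
def memW (t : ℕ) (e : Bool) (v v' _y x : ℕ) : ℕ :=
  count t fun s => site t e x s && (bit x s v && bit x s v')

/-- The number of places with exactly one of two marks. -/
def neW (t : ℕ) (e : Bool) (v v' _y x : ℕ) : ℕ :=
  count t fun s => site t e x s && xor (bit x s v) (bit x s v')

/-- The number of marked ends of a marked edge. -/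
def incW (t : ℕ) (v v' _y x : ℕ) : ℕ :=
  count t fun s => inb x s && (bit x s v && bit x 0 v')

/-- The number of marked places that do not continue a place of the parent. -/
def topW (t : ℕ) (e : Bool) (v y x : ℕ) : ℕ :=
  count t fun s => site t e x s && (bit x s v && (e || (decide (y = 0) || !inB (y - 1) s)))

/-- The number of places where the marks at a node and at its parent disagree. -/
def conflictW (t : ℕ) (v y x : ℕ) : ℕ :=
  count t fun s => !decide (y = 0) && (inB (y - 1) s && (inB x s &&
    xor (bit (y - 1) s v) (bit x s v)))

/-- The weight that tests whether the marks `v` encode an object of the sort with code `k`. -/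
def validW (t k v y x : ℕ) : ℕ :=
  if k = 0 then 2 * conflictW t v y x + topW t false v y x
  else if k = 1 then topW t true v y x
  else if k = 2 then conflictW t v y x
  else 0

/-- The total weight of a valid marking: one for an element and zero for a set. -/
def validTarget (k : ℕ) : ℕ := if k < 2 then 1 else 0

/-- The letters `x` and `x'` agree off the marks `v`. -/
def agree (K v x x' : ℕ) : Bool :=
  !Aut.bexists K fun i => xor (x.testBit i) (x'.testBit i) && !decide (i.unpair.2 = v)

/-! ### The automaton of a formula -/

/-- The automaton of `∃ z, φ`, for an automaton of `φ`. -/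
def exAut (t K k z : ℕ) (A : Aut) : Aut :=
  Aut.proj (2 ^ K) (agree K (varIx k z)) (Aut.prod Bool.and (2 ^ K)
    (Aut.atom (2 ^ K) 1 (validW t k (varIx k z)) fun n => decide (n = validTarget k)) A)

/-- The automaton of an atomic formula with tag and arguments. -/
def atomAut (t K tag a b c : ℕ) : Aut :=
  if tag = 0 then
    Aut.atom (2 ^ K) 1 (memW t false (varIx 0 a) (varIx 2 b)) fun n => !decide (n = 0)
  else if tag = 1 then
    Aut.atom (2 ^ K) 1 (memW t true (varIx 1 a) (varIx 3 b)) fun n => !decide (n = 0)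
  else if tag = 2 then
    Aut.atom (2 ^ K) 1 (incW t (varIx 0 a) (varIx 1 b)) fun n => !decide (n = 0)
  else if tag = 3 then
    Aut.atom (2 ^ K) b (topW t false (varIx 2 c)) fun n => decide (n % b = a)
  else if tag = 4 then
    Aut.atom (2 ^ K) b (topW t true (varIx 3 c)) fun n => decide (n % b = a)
  else
    Aut.atom (2 ^ K) 1 (neW t (decide (a % 2 = 1)) (varIx a b) (varIx a c)) fun n => decide (n = 0)

/-- The Boolean function `φ ↔ ψ`. -/
def iffOp (a b : Bool) : Bool := a == b

/-- The Boolean function `φ → ψ`. -/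
def impOp (a b : Bool) : Bool := !a || b

/-- The automaton of a formula over the letters with `K` bits. -/
def Formula.aut (t K : ℕ) : Formula → Aut
  | .memV x X => atomAut t K 0 x X 0
  | .memE y Y => atomAut t K 1 y Y 0
  | .inc x y => atomAut t K 2 x y 0
  | .cardV a r _ _ X => atomAut t K 3 a r X
  | .cardE a r _ _ Y => atomAut t K 4 a r Y
  | .eq k z z' => atomAut t K 5 k.code z z'
  | .not φ => (φ.aut t K).compl
  | .and φ ψ => Aut.prod Bool.and (2 ^ K) (φ.aut t K) (ψ.aut t K)
  | .or φ ψ => Aut.prod Bool.or (2 ^ K) (φ.aut t K) (ψ.aut t K)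
  | .imp φ ψ => Aut.prod impOp (2 ^ K) (φ.aut t K) (ψ.aut t K)
  | .iff φ ψ => Aut.prod iffOp (2 ^ K) (φ.aut t K) (ψ.aut t K)
  | .ex k z φ => exAut t K k.code z (φ.aut t K)
  | .all k z φ => (exAut t K k.code z (φ.aut t K).compl).compl

/-- One node of a formula, read from right to left, acts on a stack of automata. -/
def nodeStep (t K : ℕ) (node : List ℕ) (st : List Aut) : List Aut :=
  if node.getD 0 0 < 6 then
    atomAut t K (node.getD 0 0) (node.getD 1 0) (node.getD 2 0) (node.getD 3 0) :: st
  else if node.getD 0 0 = 6 then st.headI.compl :: st.tail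
  else if node.getD 0 0 = 7 then Aut.prod Bool.and (2 ^ K) st.headI st.tail.headI :: st.tail.tail
  else if node.getD 0 0 = 8 then Aut.prod Bool.or (2 ^ K) st.headI st.tail.headI :: st.tail.tail
  else if node.getD 0 0 = 9 then Aut.prod impOp (2 ^ K) st.headI st.tail.headI :: st.tail.tail
  else if node.getD 0 0 = 10 then Aut.prod iffOp (2 ^ K) st.headI st.tail.headI :: st.tail.tail
  else if node.getD 0 0 = 11 then exAut t K (node.getD 1 0) (node.getD 2 0) st.headI :: st.tail
  else (exAut t K (node.getD 1 0) (node.getD 2 0) st.headI.compl).compl :: st.tail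

/-- Prefix notation read from right to left is evaluated with a stack: when a connective is met, its
operands lie on top, the left one first. This replaces recursion on formulas by a fold over a list,
which is visibly primitive recursive. -/
theorem foldr_nodeStep (t K : ℕ) (φ : Formula) : ∀ st : List Aut,
    φ.nodes.foldr (nodeStep t K) st = φ.aut t K :: st := by
  induction φ with
  | not φ ih | ex k z φ ih | all k z φ ih =>
    intro st; simp [Formula.nodes, Formula.aut, nodeStep, ih]
  | and φ ψ ih₁ ih₂ | or φ ψ ih₁ ih₂ | imp φ ψ ih₁ ih₂ | iff φ ψ ih₁ ih₂ =>
    intro st; simp [Formula.nodes, Formula.aut, nodeStep, ih₁, ih₂]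
  | _ => intro st; simp [Formula.nodes, Formula.aut, nodeStep]

/-- The number of bits of the letters for formulas whose code has the given sum. -/
def numBits (t n : ℕ) : ℕ := Nat.pair (t + 1) (6 + 4 * n)

/-! ### Computability -/

namespace IsPrimrec

variable {α : Type*} [Primcodable α]

@[fun_prop] theorem next_fun {A : α → Aut} {x i j : α → ℕ} (hA : IsPrimrec A) (hx : IsPrimrec x)
    (hi : IsPrimrec i) (hj : IsPrimrec j) :
    IsPrimrec fun a => (A a).next (x a) (i a) (j a) := by
  unfold Aut.next; fun_prop

@[fun_prop] theorem final_fun {A : α → Aut} {q : α → ℕ} (hA : IsPrimrec A) (hq : IsPrimrec q) :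
    IsPrimrec fun a => (A a).final (q a) := by
  unfold Aut.final; fun_prop

theorem tabulate_fun {L N : α → ℕ} {d : α → ℕ → ℕ → ℕ → ℕ} {f : α → ℕ → Bool}
    (hL : IsPrimrec L) (hN : IsPrimrec N)
    (hd : IsPrimrec fun p : α × ℕ × ℕ × ℕ => d p.1 p.2.1 p.2.2.1 p.2.2.2)
    (hf : IsPrimrec fun p : α × ℕ => f p.1 p.2) :
    IsPrimrec fun a => Aut.tabulate (L a) (N a) (d a) (f a) := by
  have h : IsPrimrec fun p : α × ℕ => d p.1 p.2.unpair.1 p.2.unpair.2.unpair.1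
      p.2.unpair.2.unpair.2 :=
    comp_fun hd (g := fun p : α × ℕ => (p.1, p.2.unpair.1, p.2.unpair.2.unpair.1,
      p.2.unpair.2.unpair.2)) (by fun_prop)
  unfold Aut.tabulate
  fun_prop

@[fun_prop] theorem compl_fun {A : α → Aut} (hA : IsPrimrec A) :
    IsPrimrec fun a => (A a).compl := by
  unfold Aut.compl; fun_prop

theorem bool₂_fun (op : Bool → Bool → Bool) {f g : α → Bool} (hf : IsPrimrec f)
    (hg : IsPrimrec g) : IsPrimrec fun a => op (f a) (g a) :=
  ⟨(_root_.Primrec.dom_bool₂ op).comp hf.prim hg.prim⟩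

@[fun_prop] theorem prod_fun (op : Bool → Bool → Bool) {L : α → ℕ} {A A' : α → Aut}
    (hL : IsPrimrec L) (hA : IsPrimrec A) (hA' : IsPrimrec A') :
    IsPrimrec fun a => Aut.prod op (L a) (A a) (A' a) := by
  unfold Aut.prod
  exact tabulate_fun (by fun_prop) (by fun_prop) (by fun_prop)
    (bool₂_fun op (by fun_prop) (by fun_prop))

@[fun_prop] theorem bexists_fun {n : α → ℕ} {P : α → ℕ → Bool} (hn : IsPrimrec n)
    (hP : IsPrimrec fun p : α × ℕ => P p.1 p.2) :
    IsPrimrec fun a => Aut.bexists (n a) (P a) := by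
  unfold Aut.bexists; fun_prop

@[fun_prop] theorem mask_fun {n : α → ℕ} {P : α → ℕ → Bool} (hn : IsPrimrec n)
    (hP : IsPrimrec fun p : α × ℕ => P p.1 p.2) :
    IsPrimrec fun a => Aut.mask (n a) (P a) := by
  unfold Aut.mask; fun_prop

@[fun_prop] theorem count_fun {n : α → ℕ} {P : α → ℕ → Bool} (hn : IsPrimrec n)
    (hP : IsPrimrec fun p : α × ℕ => P p.1 p.2) :
    IsPrimrec fun a => count (n a) (P a) := by
  unfold count; fun_prop

@[fun_prop] theorem memSet_fun {I i : α → ℕ} (hI : IsPrimrec I) (hi : IsPrimrec i) :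
    IsPrimrec fun a => Aut.memSet (I a) (i a) := by
  unfold Aut.memSet; fun_prop

theorem proj_fun {L : α → ℕ} {R : α → ℕ → ℕ → Bool} {A : α → Aut}
    (hL : IsPrimrec L) (hR : IsPrimrec fun p : α × ℕ × ℕ => R p.1 p.2.1 p.2.2)
    (hA : IsPrimrec A) : IsPrimrec fun a => Aut.proj (L a) (R a) (A a) := by
  unfold Aut.proj
  refine tabulate_fun hL (by fun_prop) ?_ (by fun_prop)
  have h : IsPrimrec fun p : ((α × ℕ × ℕ × ℕ) × ℕ) × ℕ => R p.1.1.1 p.1.1.2.1 p.2 :=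
    comp_fun hR (g := fun p : ((α × ℕ × ℕ × ℕ) × ℕ) × ℕ => (p.1.1.1, p.1.1.2.1, p.2))
      (by fun_prop)
  fun_prop

@[fun_prop] theorem red_fun {r n : α → ℕ} (hr : IsPrimrec r) (hn : IsPrimrec n) :
    IsPrimrec fun a => Aut.red (r a) (n a) := by
  unfold Aut.red; fun_prop

theorem atom_fun {L r : α → ℕ} {w : α → ℕ → ℕ → ℕ} {acc : α → ℕ → Bool}
    (hL : IsPrimrec L) (hr : IsPrimrec r)
    (hw : IsPrimrec fun p : α × ℕ × ℕ => w p.1 p.2.1 p.2.2)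
    (hacc : IsPrimrec fun p : α × ℕ => acc p.1 p.2) :
    IsPrimrec fun a => Aut.atom (L a) (r a) (w a) (acc a) := by
  have hc : IsPrimrec fun p : α × ℕ × ℕ => Aut.contrib (w p.1) p.2.1 p.2.2 := by
    have : IsPrimrec fun p : α × ℕ × ℕ => w p.1 (p.2.1 + 1) (p.2.2 - 1).unpair.1 :=
      comp_fun hw (g := fun p : α × ℕ × ℕ => (p.1, p.2.1 + 1, (p.2.2 - 1).unpair.1)) (by fun_prop)
    unfold Aut.contrib
    fun_prop
  have h₁ : IsPrimrec fun p : α × ℕ × ℕ × ℕ => Aut.contrib (w p.1) p.2.1 p.2.2.1 :=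
    comp_fun hc (g := fun p : α × ℕ × ℕ × ℕ => (p.1, p.2.1, p.2.2.1)) (by fun_prop)
  have h₂ : IsPrimrec fun p : α × ℕ × ℕ × ℕ => Aut.contrib (w p.1) p.2.1 p.2.2.2 :=
    comp_fun hc (g := fun p : α × ℕ × ℕ × ℕ => (p.1, p.2.1, p.2.2.2)) (by fun_prop)
  have h₃ : IsPrimrec fun p : α × ℕ => w p.1 0 (p.2 - 1).unpair.1 :=
    comp_fun hw (g := fun p : α × ℕ => (p.1, 0, (p.2 - 1).unpair.1)) (by fun_prop)
  have h₄ : IsPrimrec fun p : α × ℕ =>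
      acc p.1 (Aut.red (r p.1) ((p.2 - 1).unpair.2 + w p.1 0 (p.2 - 1).unpair.1)) :=
    comp_fun hacc (g := fun p : α × ℕ =>
      (p.1, Aut.red (r p.1) ((p.2 - 1).unpair.2 + w p.1 0 (p.2 - 1).unpair.1))) (by fun_prop)
  unfold Aut.atom
  exact tabulate_fun hL (by fun_prop) (by fun_prop) h₄

@[fun_prop] theorem varIx_fun {k z : α → ℕ} (hk : IsPrimrec k) (hz : IsPrimrec z) :
    IsPrimrec fun a => varIx (k a) (z a) := by
  unfold varIx; fun_prop

@[fun_prop] theorem bit_fun {x s v : α → ℕ} (hx : IsPrimrec x) (hs : IsPrimrec s)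
    (hv : IsPrimrec v) : IsPrimrec fun a => bit (x a) (s a) (v a) := by
  unfold bit; fun_prop

@[fun_prop] theorem inB_fun {x s : α → ℕ} (hx : IsPrimrec x) (hs : IsPrimrec s) :
    IsPrimrec fun a => inB (x a) (s a) := by
  unfold inB; fun_prop

@[fun_prop] theorem inb_fun {x s : α → ℕ} (hx : IsPrimrec x) (hs : IsPrimrec s) :
    IsPrimrec fun a => inb (x a) (s a) := by
  unfold inb; fun_prop

@[fun_prop] theorem site_fun {t x s : α → ℕ} {e : α → Bool} (ht : IsPrimrec t) (he : IsPrimrec e)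
    (hx : IsPrimrec x) (hs : IsPrimrec s) : IsPrimrec fun a => site (t a) (e a) (x a) (s a) := by
  unfold site; fun_prop

@[fun_prop] theorem memW_fun {t v v' y x : α → ℕ} {e : α → Bool} (ht : IsPrimrec t)
    (he : IsPrimrec e) (hv : IsPrimrec v) (hv' : IsPrimrec v') (hx : IsPrimrec x) :
    IsPrimrec fun a => memW (t a) (e a) (v a) (v' a) (y a) (x a) := by
  unfold memW; fun_prop

@[fun_prop] theorem neW_fun {t v v' y x : α → ℕ} {e : α → Bool} (ht : IsPrimrec t)
    (he : IsPrimrec e) (hv : IsPrimrec v) (hv' : IsPrimrec v') (hx : IsPrimrec x) :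
    IsPrimrec fun a => neW (t a) (e a) (v a) (v' a) (y a) (x a) := by
  unfold neW; fun_prop

@[fun_prop] theorem incW_fun {t v v' y x : α → ℕ} (ht : IsPrimrec t)
    (hv : IsPrimrec v) (hv' : IsPrimrec v') (hx : IsPrimrec x) :
    IsPrimrec fun a => incW (t a) (v a) (v' a) (y a) (x a) := by
  unfold incW; fun_prop

@[fun_prop] theorem topW_fun {t v y x : α → ℕ} {e : α → Bool} (ht : IsPrimrec t)
    (he : IsPrimrec e) (hv : IsPrimrec v) (hy : IsPrimrec y) (hx : IsPrimrec x) :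
    IsPrimrec fun a => topW (t a) (e a) (v a) (y a) (x a) := by
  unfold topW; fun_prop

@[fun_prop] theorem conflictW_fun {t v y x : α → ℕ} (ht : IsPrimrec t) (hv : IsPrimrec v)
    (hy : IsPrimrec y) (hx : IsPrimrec x) :
    IsPrimrec fun a => conflictW (t a) (v a) (y a) (x a) := by
  unfold conflictW; fun_prop

@[fun_prop] theorem validW_fun {t k v y x : α → ℕ} (ht : IsPrimrec t) (hk : IsPrimrec k)
    (hv : IsPrimrec v) (hy : IsPrimrec y) (hx : IsPrimrec x) :
    IsPrimrec fun a => validW (t a) (k a) (v a) (y a) (x a) := by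
  unfold validW; fun_prop

@[fun_prop] theorem validTarget_fun {k : α → ℕ} (hk : IsPrimrec k) :
    IsPrimrec fun a => validTarget (k a) := by
  unfold validTarget; fun_prop

@[fun_prop] theorem agree_fun {K v x x' : α → ℕ} (hK : IsPrimrec K) (hv : IsPrimrec v)
    (hx : IsPrimrec x) (hx' : IsPrimrec x') :
    IsPrimrec fun a => agree (K a) (v a) (x a) (x' a) := by
  unfold agree; fun_prop

@[fun_prop] theorem exAut_fun {t K k z : α → ℕ} {A : α → Aut} (ht : IsPrimrec t)
    (hK : IsPrimrec K) (hk : IsPrimrec k) (hz : IsPrimrec z) (hA : IsPrimrec A) :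
    IsPrimrec fun a => exAut (t a) (K a) (k a) (z a) (A a) := by
  have h : IsPrimrec fun a => Aut.atom (2 ^ K a) 1 (validW (t a) (k a) (varIx (k a) (z a)))
      fun n => decide (n = validTarget (k a)) :=
    atom_fun (by fun_prop) (by fun_prop) (by fun_prop) (by fun_prop)
  unfold exAut
  exact proj_fun (by fun_prop) (by fun_prop) (by fun_prop)

@[fun_prop] theorem atomAut_fun {t K tag x y z : α → ℕ} (ht : IsPrimrec t) (hK : IsPrimrec K)
    (htag : IsPrimrec tag) (hx : IsPrimrec x) (hy : IsPrimrec y) (hz : IsPrimrec z) :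
    IsPrimrec fun a => atomAut (t a) (K a) (tag a) (x a) (y a) (z a) := by
  unfold atomAut
  refine ite_fun (by fun_prop) ?_ (ite_fun (by fun_prop) ?_ (ite_fun (by fun_prop) ?_
    (ite_fun (by fun_prop) ?_ (ite_fun (by fun_prop) ?_ ?_)))) <;>
  exact atom_fun (by fun_prop) (by fun_prop) (by fun_prop) (by fun_prop)

@[fun_prop] theorem nodeStep_fun {t K : α → ℕ} {node : α → List ℕ} {st : α → List Aut}
    (ht : IsPrimrec t) (hK : IsPrimrec K) (hn : IsPrimrec node) (hs : IsPrimrec st) :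
    IsPrimrec fun a => nodeStep (t a) (K a) (node a) (st a) := by
  unfold nodeStep
  fun_prop

@[fun_prop] theorem numBits_fun {t n : α → ℕ} (ht : IsPrimrec t) (hn : IsPrimrec n) :
    IsPrimrec fun a => numBits (t a) (n a) := by
  unfold numBits; fun_prop

end IsPrimrec

end ConcreteCMSO

namespace ConcreteCMSO

/-! ### Positions -/

namespace Term

variable {B : Type}

theorem nil_mem_positions (T : Term B) : [] ∈ T.positions := by
  cases T <;> simp [positions]

theorem mem_positions_of_concat {T : Term B} {p : List ℕ} {j : ℕ}
    (h : p ++ [j] ∈ T.positions) : p ∈ T.positions := by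
  induction T generalizing p with
  | leaf a => simp [positions] at h
  | unary a T ih =>
    cases p with
    | nil => exact nil_mem_positions _
    | cons i p =>
      simp only [positions, Finset.mem_union, Finset.mem_singleton, Finset.mem_image,
        List.cons_append, List.cons.injEq, reduceCtorEq, false_or] at h ⊢
      obtain ⟨q, hq, rfl, rfl⟩ := h
      exact ⟨p, ih hq, rfl, rfl⟩
  | binary a T₁ T₂ ih₁ ih₂ =>
    cases p with
    | nil => exact nil_mem_positions _
    | cons i p =>
      simp only [positions, Finset.mem_union, Finset.mem_singleton, Finset.mem_image,
        List.cons_append, List.cons.injEq, reduceCtorEq, false_or] at h ⊢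
      rcases h with ⟨q, hq, rfl, rfl⟩ | ⟨q, hq, rfl, rfl⟩
      exacts [.inl ⟨p, ih₁ hq, rfl, rfl⟩, .inr ⟨p, ih₂ hq, rfl, rfl⟩]

theorem sum_positions_unary {M : Type*} [AddCommMonoid M] (a : B) (T : Term B)
    (f : List ℕ → M) :
    ∑ p ∈ (unary a T).positions, f p = f [] + ∑ p ∈ T.positions, f (1 :: p) := by
  rw [positions, Finset.sum_union (by simp), Finset.sum_singleton, Finset.sum_image (by simp)]

theorem sum_positions_binary {M : Type*} [AddCommMonoid M] (a : B) (T₁ T₂ : Term B)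
    (f : List ℕ → M) : ∑ p ∈ (binary a T₁ T₂).positions, f p =
      f [] + (∑ p ∈ T₁.positions, f (1 :: p) + ∑ p ∈ T₂.positions, f (2 :: p)) := by
  rw [positions, Finset.sum_union (by simp), Finset.sum_singleton, Finset.sum_union,
    Finset.sum_image (by simp), Finset.sum_image (by simp)]
  rw [Finset.disjoint_left]
  simp only [Finset.mem_image]
  rintro _ ⟨p, -, rfl⟩ ⟨q, -, h⟩
  simp at h

end Term

namespace Aut

variable {B : Type}

/-- The free value `c` stands for the weight of the root, whose dependence on a parent lies outside
`T`; in the induction it is instantiated with the weight that a child receives from the node above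
it. -/
theorem innerWeight_add (w : ℕ → ℕ → ℕ) (T : Term B) : ∀ (ℓ : List ℕ → ℕ) (c : ℕ),
    innerWeight w T ℓ + c =
      ∑ p ∈ T.positions, if p = [] then c else w (ℓ p.dropLast + 1) (ℓ p) := by
  have key : ∀ (ℓ : List ℕ → ℕ) (c i : ℕ) (p : List ℕ),
      (if i :: p = [] then c else w (ℓ (i :: p).dropLast + 1) (ℓ (i :: p))) =
        if p = [] then w (ℓ [] + 1) (ℓ [i]) else
          w ((fun p => ℓ (i :: p)) p.dropLast + 1) ((fun p => ℓ (i :: p)) p) := by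
    intro ℓ c i p
    cases p <;> simp
  induction T with
  | leaf a => intro ℓ c; simp [innerWeight, Term.positions]
  | unary a T ih =>
    intro ℓ c
    rw [Term.sum_positions_unary, Finset.sum_congr rfl fun p _ => key ℓ c 1 p,
      ← ih fun p => ℓ (1 :: p), innerWeight, if_pos rfl, add_comm]
  | binary a T₁ T₂ ih₁ ih₂ =>
    intro ℓ c
    rw [Term.sum_positions_binary, Finset.sum_congr rfl fun p _ => key ℓ c 1 p,
      Finset.sum_congr rfl fun p _ => key ℓ c 2 p, ← ih₁ fun p => ℓ (1 :: p),
      ← ih₂ fun p => ℓ (2 :: p), innerWeight, if_pos rfl, add_comm]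

/-- The label of the parent of `p` plus one, and `0` if `p` is the root. -/
def parent (ℓ : List ℕ → ℕ) (p : List ℕ) : ℕ := if p = [] then 0 else ℓ p.dropLast + 1

theorem weight_eq_sum (w : ℕ → ℕ → ℕ) (T : Term B) (ℓ : List ℕ → ℕ) :
    weight w T ℓ = ∑ p ∈ T.positions, w (parent ℓ p) (ℓ p) := by
  rw [weight, innerWeight_add]
  refine Finset.sum_congr rfl fun p _ => ?_
  unfold parent
  split_ifs with h
  · rw [h]
  · rfl

theorem weight_count (t : ℕ) (F : ℕ → ℕ → ℕ → Bool) (T : Term B) (ℓ : List ℕ → ℕ) :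
    weight (fun y x => count t (F y x)) T ℓ =
      ((T.positions ×ˢ Finset.range t).filter fun q => F (parent ℓ q.1) (ℓ q.1) q.2 = true).card := by
  rw [weight_eq_sum, Finset.card_filter, Finset.sum_product]
  refine Finset.sum_congr rfl fun p _ => Finset.sum_congr rfl fun s _ => ?_
  cases F (parent ℓ p) (ℓ p) s <;> rfl

theorem weight_count_eq_zero_iff (t : ℕ) (F : ℕ → ℕ → ℕ → Bool) (T : Term B) (ℓ : List ℕ → ℕ) :
    weight (fun y x => count t (F y x)) T ℓ = 0 ↔
      ∀ (p : T.Pos) (s : Fin t), F (parent ℓ p) (ℓ p) s = false := by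
  rw [weight_count, Finset.card_eq_zero, Finset.filter_eq_empty_iff]
  simp only [Finset.mem_product, Finset.mem_range, Bool.not_eq_true, Prod.forall]
  exact ⟨fun h p s => h p.1 s.1 ⟨p.2, s.2⟩, fun h p s hp => h ⟨p, hp.1⟩ ⟨s, hp.2⟩⟩

end Aut

/-! ### Maximal sets of positions -/

namespace ConcreteDecomp

variable {t : ℕ} {T : ConcreteDecomp t} {s : Fin t} {P : Set T.Pos}

/-- Induction along a walk inside `P`: local propagation suffices on a connected set. -/
theorem IsConn.forall_of_adj (hP : IsConn T s P) {f : T.Pos → Prop}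
    (hf : ∀ p ∈ P, ∀ q ∈ P, T.tree.Adj p q → f p → f q) {p q : T.Pos} (hp : p ∈ P) (hq : q ∈ P)
    (h : f p) : f q := by
  obtain ⟨w⟩ := hP.1.preconnected ⟨p, hp⟩ ⟨q, hq⟩
  suffices H : ∀ {a b : P} (_ : (T.tree.induce P).Walk a b), f a.1 → f b.1 from H w h
  intro a b w
  induction w with
  | nil => exact id
  | cons hab _ ih => exact fun ha => ih (hf _ (Subtype.prop _) _ (Subtype.prop _) hab ha)

/-- The pair `{p, q}` is itself connected and meets `P`, so maximality absorbs it. -/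
theorem IsMaximal.mem_of_adj (hP : IsMaximal T s P) {p q : T.Pos} (hp : p ∈ P)
    (h : T.tree.Adj p q) (hq : s ∈ (T.symbol q).B) : q ∈ P := by
  have hconn : IsConn T s {p, q} := by
    refine ⟨SimpleGraph.induce_pair_connected_of_adj h, ?_⟩
    rintro r (rfl | rfl)
    exacts [hP.2.1.2 _ hp, hq]
  rcases hP.2.2 _ hconn with h' | h'
  · exact absurd (show p ∈ P ∩ {p, q} from ⟨hp, by simp⟩) (by simp [h'])
  · exact h' (by simp)

/-- No parent of `p` has `s` in its bag. -/
def IsTop (T : ConcreteDecomp t) (s : Fin t) (p : T.Pos) : Prop :=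
  ∀ (q : T.Pos) (j : ℕ), p.1 = q.1 ++ [j] → s ∉ (T.symbol q).B

theorem IsMaximal.exists_isTop (hP : IsMaximal T s P) : ∃ p ∈ P, IsTop T s p := by
  obtain ⟨p, hp, hmin⟩ := (measure fun p : T.Pos => p.1.length).wf.has_min P hP.1
  refine ⟨p, hp, fun q j h hs => hmin q (hP.mem_of_adj hp (.inr ⟨j, h⟩) hs) ?_⟩
  change q.1.length < p.1.length
  simp [h]

/-- A top is a prefix of every position of `P`: a step to a child preserves this, and a step to a
parent could only fail when leaving the top itself, whose parent lacks `s`. Two tops are thus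
prefixes of each other. -/
theorem IsMaximal.isTop_unique (hP : IsMaximal T s P) {p q : T.Pos} (hp : p ∈ P) (hq : q ∈ P)
    (hp' : IsTop T s p) (hq' : IsTop T s q) : p = q := by
  have H : ∀ p ∈ P, IsTop T s p → ∀ q ∈ P, p.1 <+: q.1 := by
    intro p hp hp' q hq
    refine hP.2.1.forall_of_adj (f := fun q => p.1 <+: q.1) ?_ hp hq (List.prefix_refl _)
    rintro a ha b hb (⟨j, h⟩ | ⟨j, h⟩) hpa
    · rw [h]; exact hpa.trans (List.prefix_append _ _)
    · rw [h, List.prefix_concat_iff] at hpa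
      rcases hpa with hpa | hpa
      · exact absurd (hP.2.1.2 b hb) (hp' b j hpa)
      · exact hpa
  exact Subtype.ext ((H p hp hp' q hq).eq_of_length_le (H q hq hq' p hp).length_le)

theorem exists_vert (p : T.Pos) (hs : s ∈ (T.symbol p).B) :
    ∃ u : T.Vert, u.1.1 = s ∧ p ∈ u.1.2 := by
  obtain ⟨P, ⟨hP, hp⟩, -⟩ := existsUnique_isMaximal T s p hs
  exact ⟨⟨(s, P), hP⟩, rfl, hp⟩

theorem Vert.mem_B (u : T.Vert) {p : T.Pos} (hp : p ∈ u.1.2) : u.1.1 ∈ (T.symbol p).B :=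
  u.2.2.1.2 p hp

theorem Vert.eq_of_mem {u u' : T.Vert} (h : u.1.1 = u'.1.1) {p : T.Pos} (hp : p ∈ u.1.2)
    (hp' : p ∈ u'.1.2) : u = u' := by
  obtain ⟨⟨s, P⟩, hP⟩ := u
  obtain ⟨⟨s', P'⟩, hP'⟩ := u'
  obtain rfl : s = s' := h
  have := (existsUnique_isMaximal T s p (hP.2.1.2 p hp)).unique ⟨hP, hp⟩ ⟨hP', hp'⟩
  simpa using this

end ConcreteDecomp

end ConcreteCMSO

namespace ConcreteCMSO

/-! ### Encoding vertices and edges by marks -/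

namespace ConcreteDecomp

variable {t : ℕ}

/-- The letters of the labels agree with the bags of `T`. -/
structure Compat (T : ConcreteDecomp t) (ℓ : List ℕ → ℕ) : Prop where
  inB : ∀ (p : T.Pos) (s : Fin t), inB (ℓ p) s = true ↔ s ∈ (T.symbol p).B
  inb : ∀ (p : T.Pos) (s : Fin t), inb (ℓ p) s = true ↔ s ∈ (T.symbol p).b

/-- The marks `v` of the labels encode the set `S` of vertices. -/
def EncodesVerts (T : ConcreteDecomp t) (ℓ : List ℕ → ℕ) (v : ℕ) (S : Set T.Vert) : Prop :=
  ∀ u : T.Vert, ∀ p ∈ u.1.2, bit (ℓ p) u.1.1 v = true ↔ u ∈ S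

/-- The marks `v` of the labels encode the set `S` of edges. -/
def EncodesEdges (T : ConcreteDecomp t) (ℓ : List ℕ → ℕ) (v : ℕ) (S : Set T.Edge) : Prop :=
  ∀ e : T.Edge, bit (ℓ e.1) 0 v = true ↔ e ∈ S

/-- The marks `v` of the labels encode the object `u`. -/
def Encodes (T : ConcreteDecomp t) (ℓ : List ℕ → ℕ) (v : ℕ) : (k : Sort4) → T.graph.Dom k → Prop
  | .vertex, u => T.EncodesVerts ℓ v {u}
  | .edge, u => T.EncodesEdges ℓ v {u}
  | .vertexSet, S => T.EncodesVerts ℓ v S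
  | .edgeSet, S => T.EncodesEdges ℓ v S

variable {T : ConcreteDecomp t} {ℓ : List ℕ → ℕ}

theorem Compat.site_false (hc : T.Compat ℓ) (p : T.Pos) (s : Fin t) :
    site t false (ℓ p) s = true ↔ s ∈ (T.symbol p).B := by
  simp [site, hc.inB]

theorem Compat.site_true (hc : T.Compat ℓ) (p : T.Pos) (s : Fin t) :
    site t true (ℓ p) s = true ↔ s.1 = 0 ∧ (T.symbol p).b ≠ ∅ := by
  simp only [site, cond_true, Bool.and_eq_true, decide_eq_true_eq, Aut.bexists_iff,
    ← Finset.nonempty_iff_ne_empty]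
  refine and_congr_right fun _ => ⟨?_, ?_⟩
  · rintro ⟨i, hi, h⟩
    exact ⟨⟨i, hi⟩, (hc.inb p ⟨i, hi⟩).1 h⟩
  · rintro ⟨i, h⟩
    exact ⟨i, i.2, (hc.inb p i).2 h⟩

theorem Edge.pos (e : T.Edge) : 0 < t := by
  obtain ⟨s, -⟩ := Finset.nonempty_iff_ne_empty.2 e.2
  exact s.pos

theorem parent_of_eq_concat {p q : List ℕ} {j : ℕ} (h : p = q ++ [j]) :
    Aut.parent ℓ p = ℓ q + 1 := by
  simp [Aut.parent, h]

theorem pos_cases (p : T.Pos) : p.1 = [] ∨ ∃ (q : T.Pos) (j : ℕ), p.1 = q.1 ++ [j] := by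
  rcases List.eq_nil_or_concat p.1 with h | ⟨q, j, h⟩
  · exact .inl h
  · rw [List.concat_eq_append] at h
    exact .inr ⟨⟨q, Term.mem_positions_of_concat (h ▸ p.2)⟩, j, h⟩

/-- Every place in a bag belongs to a unique vertex, so a place carrying both marks is the same as a
common element. Membership is the case where one of the sets is a singleton. -/
theorem weight_memW_false {v v' : ℕ} {S S' : Set T.Vert} (hc : T.Compat ℓ)
    (hS : T.EncodesVerts ℓ v S) (hS' : T.EncodesVerts ℓ v' S') :
    Aut.weight (memW t false v v') T ℓ = 0 ↔ Disjoint S S' := by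
  refine (Aut.weight_count_eq_zero_iff t
    (fun _ x s => site t false x s && (bit x s v && bit x s v')) T ℓ).trans ?_
  rw [Set.disjoint_left]
  constructor
  · intro h u hu hu'
    obtain ⟨p, hp⟩ := u.2.1
    have := h p u.1.1
    rw [(hc.site_false p _).2 (u.mem_B hp), (hS u p hp).2 hu, (hS' u p hp).2 hu'] at this
    simp at this
  · intro h p s
    rw [Bool.eq_false_iff, Ne, Bool.and_eq_true, Bool.and_eq_true, hc.site_false]
    rintro ⟨hs, h₁, h₂⟩
    obtain ⟨u, rfl, hp⟩ := exists_vert p hs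
    exact h ((hS u p hp).1 h₁) ((hS' u p hp).1 h₂)

theorem weight_memW_true {v v' : ℕ} {S S' : Set T.Edge} (hc : T.Compat ℓ)
    (hS : T.EncodesEdges ℓ v S) (hS' : T.EncodesEdges ℓ v' S') :
    Aut.weight (memW t true v v') T ℓ = 0 ↔ Disjoint S S' := by
  refine (Aut.weight_count_eq_zero_iff t
    (fun _ x s => site t true x s && (bit x s v && bit x s v')) T ℓ).trans ?_
  rw [Set.disjoint_left]
  constructor
  · intro h e he he'
    have := h e.1 ⟨0, e.pos⟩
    rw [(hc.site_true e.1 ⟨0, e.pos⟩).2 ⟨rfl, e.2⟩] at this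
    simp [(hS e).2 he, (hS' e).2 he'] at this
  · intro h p s
    rw [Bool.eq_false_iff, Ne, Bool.and_eq_true, Bool.and_eq_true, hc.site_true]
    rintro ⟨⟨hs, he⟩, h₁, h₂⟩
    rw [hs] at h₁ h₂
    exact h ((hS ⟨p, he⟩).1 h₁) ((hS' ⟨p, he⟩).1 h₂)

theorem weight_neW_false {v v' : ℕ} {S S' : Set T.Vert} (hc : T.Compat ℓ)
    (hS : T.EncodesVerts ℓ v S) (hS' : T.EncodesVerts ℓ v' S') :
    Aut.weight (neW t false v v') T ℓ = 0 ↔ S = S' := by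
  refine (Aut.weight_count_eq_zero_iff t
    (fun _ x s => site t false x s && xor (bit x s v) (bit x s v')) T ℓ).trans ?_
  rw [Set.ext_iff]
  constructor
  · intro h u
    obtain ⟨p, hp⟩ := u.2.1
    have := h p u.1.1
    rw [(hc.site_false p _).2 (u.mem_B hp)] at this
    rw [← hS u p hp, ← hS' u p hp]
    simpa using this
  · intro h p s
    rw [Bool.eq_false_iff, Ne, Bool.and_eq_true, hc.site_false]
    rintro ⟨hs, h₁⟩
    obtain ⟨u, rfl, hp⟩ := exists_vert p hs
    have := h u
    rw [← hS u p hp, ← hS' u p hp, ← Bool.eq_iff_iff] at this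
    simp [this] at h₁

theorem weight_neW_true {v v' : ℕ} {S S' : Set T.Edge} (hc : T.Compat ℓ)
    (hS : T.EncodesEdges ℓ v S) (hS' : T.EncodesEdges ℓ v' S') :
    Aut.weight (neW t true v v') T ℓ = 0 ↔ S = S' := by
  refine (Aut.weight_count_eq_zero_iff t
    (fun _ x s => site t true x s && xor (bit x s v) (bit x s v')) T ℓ).trans ?_
  rw [Set.ext_iff]
  constructor
  · intro h e
    have := h e.1 ⟨0, e.pos⟩
    rw [(hc.site_true e.1 ⟨0, e.pos⟩).2 ⟨rfl, e.2⟩] at this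
    rw [← hS e, ← hS' e]
    simpa using this
  · intro h p s
    rw [Bool.eq_false_iff, Ne, Bool.and_eq_true, hc.site_true]
    rintro ⟨⟨hs, he⟩, h₁⟩
    have := h ⟨p, he⟩
    rw [← hS ⟨p, he⟩, ← hS' ⟨p, he⟩, ← Bool.eq_iff_iff] at this
    simp [hs, this] at h₁

theorem weight_incW {v v' : ℕ} {S : Set T.Vert} {S' : Set T.Edge} (hc : T.Compat ℓ)
    (hS : T.EncodesVerts ℓ v S) (hS' : T.EncodesEdges ℓ v' S') :
    Aut.weight (incW t v v') T ℓ = 0 ↔ ∀ u ∈ S, ∀ e ∈ S', ¬ Incident T e u := by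
  refine (Aut.weight_count_eq_zero_iff t
    (fun _ x s => inb x s && (bit x s v && bit x 0 v')) T ℓ).trans ?_
  constructor
  · rintro h u hu e he ⟨hs, hp⟩
    have := h e.1 u.1.1
    rw [(hc.inb _ _).2 hs, (hS u _ hp).2 hu, (hS' e).2 he] at this
    simp at this
  · intro h p s
    rw [Bool.eq_false_iff, Ne, Bool.and_eq_true, Bool.and_eq_true, hc.inb]
    rintro ⟨hs, h₁, h₂⟩
    obtain ⟨u, rfl, hp⟩ := exists_vert p ((T.symbol p).sub hs)
    have he : (T.symbol p).b ≠ ∅ := Finset.ne_empty_of_mem hs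
    exact h u ((hS u p hp).1 h₁) ⟨p, he⟩ ((hS' ⟨p, he⟩).1 h₂) ⟨hs, hp⟩

/-- Absence of local disagreement makes the marks constant on each maximal set, by connectedness;
constant marks are exactly those of a set of vertices. -/
theorem weight_conflictW {v : ℕ} (hc : T.Compat ℓ) :
    Aut.weight (conflictW t v) T ℓ = 0 ↔ ∃ S, T.EncodesVerts ℓ v S := by
  refine (Aut.weight_count_eq_zero_iff t (fun y x s => !decide (y = 0) && (inB (y - 1) s &&
    (inB x s && xor (bit (y - 1) s v) (bit x s v)))) T ℓ).trans ?_
  constructor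
  · intro h
    have key : ∀ (q p : T.Pos) (j : ℕ) (s : Fin t), p.1 = q.1 ++ [j] → s ∈ (T.symbol q).B →
        s ∈ (T.symbol p).B → bit (ℓ q) s v = bit (ℓ p) s v := by
      intro q p j s hj hq hp
      have := h p s
      rw [parent_of_eq_concat hj] at this
      simpa [(hc.inB _ _).2 hp, (hc.inB _ _).2 hq] using this
    refine ⟨{u | ∃ p ∈ u.1.2, bit (ℓ p) u.1.1 v = true}, fun u p hp => ⟨fun h => ⟨p, hp, h⟩, ?_⟩⟩
    rintro ⟨q, hq, h⟩
    refine u.2.2.1.forall_of_adj (f := fun p => bit (ℓ p) u.1.1 v = true) ?_ hq hp h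
    rintro a ha b hb (⟨j, hj⟩ | ⟨j, hj⟩) hab
    · rwa [← key a b j _ hj (u.mem_B ha) (u.mem_B hb)]
    · rwa [key b a j _ hj (u.mem_B hb) (u.mem_B ha)]
  · rintro ⟨S, hS⟩ p s
    rcases pos_cases p with h | ⟨q, j, hj⟩
    · simp [Aut.parent, h]
    · rw [parent_of_eq_concat hj, Bool.eq_false_iff, Ne]
      simp only [Nat.add_eq_zero_iff, one_ne_zero, and_false, decide_false, Bool.not_false,
        Nat.add_sub_cancel, Bool.and_eq_true, hc.inB, true_and]
      rintro ⟨hq, hp, h⟩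
      obtain ⟨u, rfl, hu⟩ := exists_vert q hq
      have h₁ := hS u q hu
      rw [← hS u p (u.2.mem_of_adj hu (.inl ⟨j, hj⟩) hp), ← Bool.eq_iff_iff] at h₁
      simp [h₁] at h

/-- An edge has a single site, place `0` of its position, so the counted pairs are the images of the
edges under $e_p \mapsto (p, 0)$. -/
theorem weight_topW_true {v : ℕ} {S : Set T.Edge} (hc : T.Compat ℓ)
    (hS : T.EncodesEdges ℓ v S) : Aut.weight (topW t true v) T ℓ = S.ncard := by
  refine (Aut.weight_count t (fun y x s => site t true x s && (bit x s v &&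
    (true || (decide (y = 0) || !inB (y - 1) s)))) T ℓ).trans ?_
  rw [← Set.ncard_coe_finset, ← Set.ncard_image_of_injective S
    (f := fun e => ((e.1.1, 0) : List ℕ × ℕ))
    (fun e e' h => Subtype.ext (Subtype.ext (Prod.ext_iff.1 h).1))]
  congr 1
  ext ⟨p, s⟩
  simp only [Finset.coe_filter, Finset.mem_product, Finset.mem_range, Bool.true_or, Bool.and_true,
    Bool.and_eq_true, Set.mem_ofPred_eq, Set.mem_image, Prod.mk.injEq]
  constructor
  · rintro ⟨⟨hp, hs⟩, h₁, h₂⟩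
    obtain ⟨h0, he⟩ := (hc.site_true ⟨p, hp⟩ ⟨s, hs⟩).1 h₁
    obtain rfl : s = 0 := h0
    exact ⟨⟨⟨p, hp⟩, he⟩, (hS _).1 h₂, rfl, rfl⟩
  · rintro ⟨e, he, rfl, rfl⟩
    exact ⟨⟨e.1.2, e.pos⟩, (hc.site_true e.1 ⟨0, e.pos⟩).2 ⟨rfl, e.2⟩, (hS e).2 he⟩

theorem Compat.isTop_iff (hc : T.Compat ℓ) (s : Fin t) (p : T.Pos) :
    (decide (Aut.parent ℓ p = 0) ||
      !ConcreteCMSO.inB (Aut.parent ℓ p - 1) s) = true ↔ IsTop T s p := by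
  rw [Bool.or_eq_true, Bool.not_eq_true', Bool.eq_false_iff, Ne]
  constructor
  · rintro h q j hj
    rw [parent_of_eq_concat hj, Nat.add_sub_cancel, hc.inB] at h
    simpa using h
  · intro h
    rcases pos_cases p with hp | ⟨q, j, hj⟩
    · simp [Aut.parent, hp]
    · right
      rw [parent_of_eq_concat hj, Nat.add_sub_cancel, hc.inB]
      exact h q j hj

/-- A vertex occupies many positions but has one top. Sending it to that top together with its index
$s$ is injective, and the image of `S` is the set of counted pairs. -/
theorem weight_topW_false {v : ℕ} {S : Set T.Vert} (hc : T.Compat ℓ)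
    (hS : T.EncodesVerts ℓ v S) : Aut.weight (topW t false v) T ℓ = S.ncard := by
  refine (Aut.weight_count t (fun y x s => site t false x s && (bit x s v &&
    (false || (decide (y = 0) || !inB (y - 1) s)))) T ℓ).trans ?_
  choose top htop htop' using fun u : T.Vert => u.2.exists_isTop
  rw [← Set.ncard_coe_finset, ← Set.ncard_image_of_injective S
    (f := fun u => (((top u).1, u.1.1.1) : List ℕ × ℕ)) ?_]
  · congr 1
    ext ⟨p, s⟩
    simp only [Finset.coe_filter, Finset.mem_product, Finset.mem_range, Bool.false_or,
      Set.mem_ofPred_eq, Set.mem_image, Prod.mk.injEq]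
    rw [Bool.and_eq_true, Bool.and_eq_true]
    constructor
    · rintro ⟨⟨hp, hs⟩, h₁, h₂, h₃⟩
      obtain ⟨u, hu, hpu⟩ := exists_vert ⟨p, hp⟩ ((hc.site_false ⟨p, hp⟩ ⟨s, hs⟩).1 h₁)
      have h₃ := (hc.isTop_iff ⟨s, hs⟩ ⟨p, hp⟩).1 h₃
      rw [← hu] at h₃
      have hs' : u.1.1.1 = s := by rw [hu]
      refine ⟨u, (hS u _ hpu).1 (by rw [hs']; exact h₂), ?_, hs'⟩
      rw [u.2.isTop_unique (htop u) hpu (htop' u) h₃]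
    · rintro ⟨u, hu, rfl, rfl⟩
      exact ⟨⟨(top u).2, u.1.1.2⟩, (hc.site_false _ _).2 (u.mem_B (htop u)),
        (hS u _ (htop u)).2 hu, (hc.isTop_iff _ _).2 (htop' u)⟩
  · intro u u' h
    obtain ⟨h₁, h₂⟩ := Prod.ext_iff.1 h
    refine Vert.eq_of_mem (Fin.ext h₂) (htop u) ?_
    rw [Subtype.ext h₁]
    exact htop u'

theorem weight_validW {v : ℕ} (hc : T.Compat ℓ) (k : Sort4) :
    Aut.weight (validW t k.code v) T ℓ = validTarget k.code ↔
      ∃ u : T.graph.Dom k, T.Encodes ℓ v k u := by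
  cases k with
  | vertex =>
    have h : Aut.weight (validW t 0 v) T ℓ =
        2 * Aut.weight (conflictW t v) T ℓ + Aut.weight (topW t false v) T ℓ := by
      simp only [Aut.weight_eq_sum, Finset.mul_sum, ← Finset.sum_add_distrib]
      rfl
    change Aut.weight (validW t 0 v) T ℓ = 1 ↔ ∃ u, T.EncodesVerts ℓ v {u}
    rw [h]
    constructor
    · intro h
      -- The factor `2` pays off here: a total of `1` excludes conflicts and leaves exactly one
      -- marked top.
      obtain ⟨S, hS⟩ := (weight_conflictW hc (v := v)).1 (by omega)
      rw [weight_topW_false hc hS] at h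
      obtain ⟨u, rfl⟩ := Set.ncard_eq_one.1 (show S.ncard = 1 by omega)
      exact ⟨u, hS⟩
    · rintro ⟨u, hu⟩
      rw [weight_topW_false hc hu, (weight_conflictW hc).2 ⟨_, hu⟩, Set.ncard_singleton]
  | edge =>
    change Aut.weight (topW t true v) T ℓ = 1 ↔ ∃ e, T.EncodesEdges ℓ v {e}
    constructor
    · intro h
      have hS : T.EncodesEdges ℓ v {e | bit (ℓ e.1) 0 v = true} := fun _ => Iff.rfl
      rw [weight_topW_true hc hS, Set.ncard_eq_one] at h
      obtain ⟨e, he⟩ := h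
      exact ⟨e, he ▸ hS⟩
    · rintro ⟨e, he⟩
      rw [weight_topW_true hc he, Set.ncard_singleton]
  | vertexSet => exact weight_conflictW hc
  | edgeSet =>
    -- Any marks encode a set of edges, since each edge has only one site.
    refine iff_of_true ?_ ⟨({e : T.Edge | bit (ℓ e.1) 0 v = true} : Set T.Edge), fun _ => Iff.rfl⟩
    rw [Aut.weight_eq_sum]
    exact Finset.sum_eq_zero fun _ _ => rfl

end ConcreteDecomp

end ConcreteCMSO

namespace ConcreteCMSO

/-! ### Truth of atomic formulas -/

namespace IncGraph

variable {G : IncGraph} {I : G.Interp}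

theorem sat_memV {x X : ℕ} {u : G.V} {S : Set G.V} (hu : I .vertex x = some u)
    (hS : I .vertexSet X = some S) : G.Sat (.memV x X) I ↔ u ∈ S := by
  constructor
  · rintro ⟨u', S', hu', hS', h⟩
    rwa [Option.some.inj (hu.symm.trans hu'), Option.some.inj (hS.symm.trans hS')]
  · exact fun h => ⟨u, S, hu, hS, h⟩

theorem sat_memE {y Y : ℕ} {e : G.E} {S : Set G.E} (he : I .edge y = some e)
    (hS : I .edgeSet Y = some S) : G.Sat (.memE y Y) I ↔ e ∈ S := by
  constructor
  · rintro ⟨e', S', he', hS', h⟩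
    rwa [Option.some.inj (he.symm.trans he'), Option.some.inj (hS.symm.trans hS')]
  · exact fun h => ⟨e, S, he, hS, h⟩

theorem sat_inc {x y : ℕ} {u : G.V} {e : G.E} (hu : I .vertex x = some u)
    (he : I .edge y = some e) : G.Sat (.inc x y) I ↔ G.Inc e u := by
  constructor
  · rintro ⟨u', e', hu', he', h⟩
    rwa [Option.some.inj (hu.symm.trans hu'), Option.some.inj (he.symm.trans he')]
  · exact fun h => ⟨u, e, hu, he, h⟩

theorem sat_cardV {a r : ℕ} {har : a < r} {hr : 2 ≤ r} {X : ℕ} {S : Set G.V}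
    (hS : I .vertexSet X = some S) : G.Sat (.cardV a r har hr X) I ↔ S.ncard % r = a := by
  have hmod : ∀ m, m ≡ a [MOD r] ↔ m % r = a := fun m => by
    rw [Nat.ModEq, Nat.mod_eq_of_lt har]
  simp only [Sat, hmod]
  constructor
  · rintro ⟨S', hS', h⟩
    rwa [Option.some.inj (hS.symm.trans hS')]
  · exact fun h => ⟨S, hS, h⟩

theorem sat_cardE {a r : ℕ} {har : a < r} {hr : 2 ≤ r} {Y : ℕ} {S : Set G.E}
    (hS : I .edgeSet Y = some S) : G.Sat (.cardE a r har hr Y) I ↔ S.ncard % r = a := by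
  have hmod : ∀ m, m ≡ a [MOD r] ↔ m % r = a := fun m => by
    rw [Nat.ModEq, Nat.mod_eq_of_lt har]
  simp only [Sat, hmod]
  constructor
  · rintro ⟨S', hS', h⟩
    rwa [Option.some.inj (hS.symm.trans hS')]
  · exact fun h => ⟨S, hS, h⟩

end IncGraph

/-! ### Correctness of the automaton of a formula -/

theorem varIx_injective {k k' : Sort4} {z z' : ℕ} (h : varIx k.code z = varIx k'.code z') :
    k = k' ∧ z = z' := by
  unfold varIx at h
  cases k <;> cases k' <;> simp only [Sort4.code] at h <;>
    first | exact ⟨rfl, by omega⟩ | omega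

/-- Testing the bits below `K` is enough, as all higher bits of both letters vanish. -/
theorem agree_iff {K v x x' : ℕ} (hx : x < 2 ^ K) (hx' : x' < 2 ^ K) :
    agree K v x x' = true ↔ ∀ s v', v' ≠ v → bit x s v' = bit x' s v' := by
  rw [agree, Bool.not_eq_true', Bool.eq_false_iff, Ne, Aut.bexists_iff]
  constructor
  · intro h s v' hv
    by_contra hne
    refine h ⟨Nat.pair s v', ?_, ?_⟩
    · by_contra hK
      have hle := Nat.pow_le_pow_right (show 0 < 2 by simp) (not_lt.1 hK)
      exact hne ((Nat.testBit_lt_two_pow (hx.trans_le hle)).trans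
        (Nat.testBit_lt_two_pow (hx'.trans_le hle)).symm)
    · have h' : (x.testBit (Nat.pair s v') ^^ x'.testBit (Nat.pair s v')) = true :=
        Bool.xor_iff_ne.2 hne
      simp [h', hv]
  · rintro h ⟨i, -, hi⟩
    rw [Bool.and_eq_true, Bool.xor_iff_ne, Bool.not_eq_true', decide_eq_false_iff_not] at hi
    refine hi.1 ?_
    have := h i.unpair.1 i.unpair.2 hi.2
    rwa [bit, bit, Nat.pair_unpair] at this

theorem agree_self (K v x : ℕ) : agree K v x x = true := by
  rw [agree, Bool.not_eq_true', Bool.eq_false_iff, Ne, Aut.bexists_iff]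
  simp

/-- The labels `ℓ` with the marks `v` replaced by `m`. -/
def mark (K v : ℕ) (m : List ℕ → ℕ → Bool) (ℓ : List ℕ → ℕ) (p : List ℕ) : ℕ :=
  Aut.mask K fun i => if i.unpair.2 = v then m p i.unpair.1 else (ℓ p).testBit i

theorem bit_mark {K v : ℕ} (m : List ℕ → ℕ → Bool) (ℓ : List ℕ → ℕ) (p : List ℕ) {s : ℕ}
    (h : Nat.pair s v < K) : bit (mark K v m ℓ p) s v = m p s := by
  simp [bit, mark, Aut.testBit_mask, h]

theorem agree_mark {K v : ℕ} (m : List ℕ → ℕ → Bool) {ℓ : List ℕ → ℕ} (p : List ℕ)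
    (hℓ : ℓ p < 2 ^ K) : agree K v (ℓ p) (mark K v m ℓ p) = true := by
  refine (agree_iff hℓ (Aut.mask_lt _ _)).2 fun s v' hv => ?_
  unfold bit
  rw [Aut.testBit_mask, Nat.unpair_pair, if_neg hv, Bool.eq_and_self, decide_eq_true_eq]
  intro h
  by_contra hK
  rw [Nat.testBit_lt_two_pow (hℓ.trans_le (Nat.pow_le_pow_right (by simp) (not_lt.1 hK)))] at h
  cases h

namespace ConcreteDecomp

variable {t : ℕ} {T : ConcreteDecomp t} {ℓ ℓ' : List ℕ → ℕ}

theorem Compat.congr {v : ℕ} (hv : 2 ≤ v)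
    (h : ∀ p s v', v' ≠ v → bit (ℓ p) s v' = bit (ℓ' p) s v') (hc : T.Compat ℓ) :
    T.Compat ℓ' where
  inB p s := by
    rw [← hc.inB p s, ConcreteCMSO.inB, ConcreteCMSO.inB, h _ _ 0 (by omega), h _ _ 1 (by omega)]
  inb p s := by
    rw [← hc.inb p s, ConcreteCMSO.inb, ConcreteCMSO.inb, h _ _ 1 (by omega)]

theorem Encodes.congr {v : ℕ} {k : Sort4} {u : T.graph.Dom k}
    (h : ∀ p s, bit (ℓ p) s v = bit (ℓ' p) s v) (hu : T.Encodes ℓ v k u) :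
    T.Encodes ℓ' v k u := by
  cases k <;> simpa only [Encodes, EncodesVerts, EncodesEdges, h] using hu

/-- Supplies the witness for the projection: the marks `v` are overwritten by those of the object.
The bound covers `s ≤ t` so that place `0`, which carries the edge marks, is included whatever `t`
is. -/
theorem exists_encodes {K v : ℕ} (hK : ∀ s ≤ t, Nat.pair s v < K) (hℓ : ∀ p, ℓ p < 2 ^ K)
    (k : Sort4) (u : T.graph.Dom k) : ∃ ℓ' : List ℕ → ℕ, (∀ p, ℓ' p < 2 ^ K) ∧
      (∀ p, agree K v (ℓ p) (ℓ' p) = true) ∧ T.Encodes ℓ' v k u := by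
  classical
  have hV : ∀ S : Set T.Vert, ∃ m, T.EncodesVerts (mark K v m ℓ) v S := by
    intro S
    refine ⟨fun p s => decide (∃ u ∈ S, u.1.1.1 = s ∧ ∃ hp : p ∈ T.positions, ⟨p, hp⟩ ∈ u.1.2),
      fun u p hp => ?_⟩
    rw [bit_mark _ _ _ (hK _ u.1.1.2.le), decide_eq_true_eq]
    constructor
    · rintro ⟨u', hu', hs, hp', h⟩
      rwa [Vert.eq_of_mem (Fin.ext hs.symm) hp h]
    · exact fun hu => ⟨u, hu, rfl, p.2, hp⟩
  have hE : ∀ S : Set T.Edge, ∃ m, T.EncodesEdges (mark K v m ℓ) v S := by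
    intro S
    refine ⟨fun p _ => decide (∃ e ∈ S, e.1.1 = p), fun e => ?_⟩
    rw [bit_mark _ _ _ (hK _ (Nat.zero_le _)), decide_eq_true_eq]
    constructor
    · rintro ⟨e', he', h⟩
      rwa [← Subtype.ext (Subtype.ext h)]
    · exact fun he => ⟨e, he, rfl⟩
  obtain ⟨m, hm⟩ : ∃ m, T.Encodes (mark K v m ℓ) v k u := by
    cases k
    exacts [hV _, hE _, hV _, hE _]
  exact ⟨_, fun p => Aut.mask_lt _ _, fun p => agree_mark m p (hℓ p), hm⟩

end ConcreteDecomp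

open ConcreteDecomp

section

variable {t K n : ℕ} {T : ConcreteDecomp t}

theorem bounded_validAut (B : Type) (t K k v : ℕ) :
    (Aut.atom (2 ^ K) 1 (validW t k v) fun n => decide (n = validTarget k)).Bounded B (2 ^ K) :=
  Aut.Bounded.atom one_pos _ _

theorem bounded_exAut {B : Type} {A : Aut} (hA : A.Bounded B (2 ^ K)) (k z : ℕ) :
    (exAut t K k z A).Bounded B (2 ^ K) :=
  Aut.Bounded.proj (fun x _ => agree_self _ _ x) ((bounded_validAut B t K k _).prod _ hA)

theorem bounded_aut (B : Type) (φ : Formula) : (φ.aut t K).Bounded B (2 ^ K) := by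
  induction φ with
  | memV | memE | inc | eq => simpa [Formula.aut, atomAut] using Aut.Bounded.atom one_pos _ _
  | cardV _ r _ hr | cardE _ r _ hr =>
    simpa [Formula.aut, atomAut] using Aut.Bounded.atom (show 0 < r by omega) _ _
  | not φ ih => exact ih.compl
  | and φ ψ ih₁ ih₂ | or φ ψ ih₁ ih₂ | imp φ ψ ih₁ ih₂ | iff φ ψ ih₁ ih₂ => exact ih₁.prod _ ih₂
  | ex k z φ ih => exact bounded_exAut ih _ _
  | all k z φ ih => exact (bounded_exAut ih.compl _ _).compl

/-- Relabelled trees that pass the validity test encode an object, and every object is encoded by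
some relabelling. The predicate `X` is left open so that the same statement serves $\exists$ and,
with a negated body, $\forall$. -/
theorem accepts_exAut {A : Aut} (hA : A.Bounded (ConcreteBag t) (2 ^ K)) {k : Sort4} {z : ℕ}
    (hK : ∀ s ≤ t, Nat.pair s (varIx k.code z) < K) {ℓ : List ℕ → ℕ} (hℓ : ∀ p, ℓ p < 2 ^ K)
    (hc : T.Compat ℓ) {X : T.graph.Dom k → Prop}
    (hX : ∀ (u : T.graph.Dom k) (ℓ' : List ℕ → ℕ), (∀ p, ℓ' p < 2 ^ K) → T.Compat ℓ' →
      (∀ p s v, v ≠ varIx k.code z → bit (ℓ p) s v = bit (ℓ' p) s v) →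
      T.Encodes ℓ' (varIx k.code z) k u → (A.Accepts T ℓ' ↔ X u)) :
    (exAut t K k.code z A).Accepts T ℓ ↔ ∃ u, X u := by
  have hB := bounded_validAut (ConcreteBag t) t K k.code (varIx k.code z)
  have hv : 2 ≤ varIx k.code z := by unfold varIx; omega
  have hvalid : ∀ ℓ' : List ℕ → ℕ, (∀ p, ℓ' p < 2 ^ K) → T.Compat ℓ' →
      ((Aut.atom (2 ^ K) 1 (validW t k.code (varIx k.code z)) fun n =>
        decide (n = validTarget k.code)).Accepts T ℓ' ↔
        ∃ u, T.Encodes ℓ' (varIx k.code z) k u) := by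
    intro ℓ' hℓ' hc'
    rw [Aut.accepts_atom one_pos _ _ T hℓ', decide_eq_true_eq, ← weight_validW hc']
    unfold validTarget
    split_ifs
    exacts [Aut.red_eq_one_iff, Aut.red_eq_zero_iff]
  rw [exAut, Aut.accepts_proj (fun x _ => agree_self _ _ x) (hB.prod _ hA) T hℓ]
  have hprod : ∀ ℓ' : List ℕ → ℕ, (∀ p, ℓ' p < 2 ^ K) →
      ((Aut.prod Bool.and (2 ^ K) (Aut.atom (2 ^ K) 1 (validW t k.code (varIx k.code z)) fun n =>
        decide (n = validTarget k.code)) A).Accepts T ℓ' ↔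
      (Aut.atom (2 ^ K) 1 (validW t k.code (varIx k.code z)) fun n =>
        decide (n = validTarget k.code)).Accepts T ℓ' ∧ A.Accepts T ℓ') := by
    intro ℓ' hℓ'
    rw [Aut.accepts_prod _ hB hA T hℓ', Bool.and_eq_true]
    rfl
  constructor
  · rintro ⟨ℓ', hℓ', hag, hacc⟩
    have hag' := fun p => (agree_iff (hℓ p) (hℓ' p)).1 (hag p)
    have hc' := hc.congr hv hag'
    obtain ⟨h₁, h₂⟩ := (hprod ℓ' hℓ').1 hacc
    obtain ⟨u, hu⟩ := (hvalid ℓ' hℓ' hc').1 h₁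
    exact ⟨u, (hX u ℓ' hℓ' hc' hag' hu).1 h₂⟩
  · rintro ⟨u, hu⟩
    obtain ⟨ℓ', hℓ', hag, henc⟩ := exists_encodes hK hℓ k u
    have hag' := fun p => (agree_iff (hℓ p) (hℓ' p)).1 (hag p)
    have hc' := hc.congr hv hag'
    exact ⟨ℓ', hℓ', hag, (hprod ℓ' hℓ').2 ⟨(hvalid ℓ' hℓ' hc').2 ⟨u, henc⟩,
      (hX u ℓ' hℓ' hc' hag' henc).2 hu⟩⟩

/-- The marks of the labels encode the values of the variables in `V`. -/
def EncodesOn (T : ConcreteDecomp t) (V : Set (Sort4 × ℕ)) (ℓ : List ℕ → ℕ)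
    (I : T.graph.Interp) : Prop :=
  ∀ k z, (k, z) ∈ V → ∃ u, I k z = some u ∧ T.Encodes ℓ (varIx k.code z) k u

/-- Distinct variables own distinct indices, so overwriting the marks of one leaves the encodings of
the others intact; an older value of the same variable is shadowed. -/
theorem EncodesOn.set {V : Set (Sort4 × ℕ)} {ℓ ℓ' : List ℕ → ℕ} {I : T.graph.Interp} {k : Sort4}
    {z : ℕ} {u : T.graph.Dom k} (h : EncodesOn T (V \ {(k, z)}) ℓ I)
    (hag : ∀ p s v, v ≠ varIx k.code z → bit (ℓ p) s v = bit (ℓ' p) s v)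
    (hu : T.Encodes ℓ' (varIx k.code z) k u) : EncodesOn T V ℓ' (I.set k z u) := by
  intro k' z' hV
  by_cases hk : k' = k
  · subst hk
    by_cases hz : z' = z
    · subst hz
      exact ⟨u, by simp [IncGraph.Interp.set], hu⟩
    · obtain ⟨u', hI, hu'⟩ := h k' z' ⟨hV, by simp [hz]⟩
      exact ⟨u', by simp [IncGraph.Interp.set, hz, hI],
        hu'.congr fun p s => hag p s _ fun e => hz (varIx_injective e).2⟩
  · obtain ⟨u', hI, hu'⟩ := h k' z' ⟨hV, by simp [hk]⟩
    exact ⟨u', by simp [IncGraph.Interp.set, hk, hI],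
      hu'.congr fun p s => hag p s _ fun e => hk (varIx_injective e).1⟩

theorem accepts_weight {w : ℕ → ℕ → ℕ} {ℓ : List ℕ → ℕ} (hℓ : ∀ p, ℓ p < 2 ^ K) :
    (Aut.atom (2 ^ K) 1 w fun n => !decide (n = 0)).Accepts T ℓ ↔ ¬ Aut.weight w T ℓ = 0 := by
  rw [Aut.accepts_atom one_pos _ _ T hℓ, Bool.not_eq_true', decide_eq_false_iff_not,
    Aut.red_eq_zero_iff]

/-- Only free variables need to be encoded, so the convention for uninterpreted variables never
enters. The bound `6 + 4 * n` exceeds the index of every variable named by a number up to `n`. -/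
theorem accepts_aut (hK : ∀ s ≤ t, ∀ v < 6 + 4 * n, Nat.pair s v < K) (φ : Formula)
    (hφ : ∀ i ∈ φ.code, i ≤ n) : ∀ (ℓ : List ℕ → ℕ) (I : T.graph.Interp), (∀ p, ℓ p < 2 ^ K) →
      T.Compat ℓ → EncodesOn T φ.freeVars ℓ I → ((φ.aut t K).Accepts T ℓ ↔ T.graph.Sat φ I) := by
  have hix : ∀ (k : Sort4) (z : ℕ), z ≤ n → varIx k.code z < 6 + 4 * n := by
    intro k z hz
    unfold varIx
    cases k <;> simp only [Sort4.code] <;> omega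
  induction φ with
  | memV x X =>
    intro ℓ I hℓ hc henc
    obtain ⟨u, hu, hu'⟩ := henc .vertex x (by simp [Formula.freeVars])
    obtain ⟨S, hS, hS'⟩ := henc .vertexSet X (by simp [Formula.freeVars])
    change (Aut.atom (2 ^ K) 1 (memW t false (varIx 0 x) (varIx 2 X)) fun n =>
      !decide (n = 0)).Accepts T ℓ ↔ _
    refine (accepts_weight hℓ).trans ?_
    refine (not_congr (weight_memW_false hc (S := {u}) hu' hS')).trans ?_
    rw [IncGraph.sat_memV hu hS]
    exact (not_congr Set.disjoint_singleton_left).trans not_not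
  | memE x X =>
    intro ℓ I hℓ hc henc
    obtain ⟨u, hu, hu'⟩ := henc .edge x (by simp [Formula.freeVars])
    obtain ⟨S, hS, hS'⟩ := henc .edgeSet X (by simp [Formula.freeVars])
    change (Aut.atom (2 ^ K) 1 (memW t true (varIx 1 x) (varIx 3 X)) fun n =>
      !decide (n = 0)).Accepts T ℓ ↔ _
    refine (accepts_weight hℓ).trans ?_
    refine (not_congr (weight_memW_true hc (S := {u}) hu' hS')).trans ?_
    rw [IncGraph.sat_memE hu hS]
    exact (not_congr Set.disjoint_singleton_left).trans not_not
  | inc x y =>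
    intro ℓ I hℓ hc henc
    obtain ⟨u, hu, hu'⟩ := henc .vertex x (by simp [Formula.freeVars])
    obtain ⟨e, he, he'⟩ := henc .edge y (by simp [Formula.freeVars])
    change (Aut.atom (2 ^ K) 1 (incW t (varIx 0 x) (varIx 1 y)) fun n =>
      !decide (n = 0)).Accepts T ℓ ↔ _
    refine (accepts_weight hℓ).trans ?_
    refine (not_congr (weight_incW hc (S := {u}) (S' := {e}) hu' he')).trans ?_
    rw [IncGraph.sat_inc hu he]
    refine (not_congr ⟨fun h => h u rfl e rfl, ?_⟩).trans not_not
    rintro h _ rfl _ rfl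
    exact h
  | cardV a r har hr X =>
    intro ℓ I hℓ hc henc
    obtain ⟨S, hS, hS'⟩ := henc .vertexSet X (by simp [Formula.freeVars])
    change (Aut.atom (2 ^ K) r (topW t false (varIx 2 X)) fun n =>
      decide (n % r = a)).Accepts T ℓ ↔ _
    refine (Aut.accepts_atom (show 0 < r by omega) _ _ T hℓ).trans ?_
    rw [weight_topW_false hc (v := varIx 2 X) hS', Aut.red_mod, decide_eq_true_eq,
      IncGraph.sat_cardV hS]
    rfl
  | cardE a r har hr X =>
    intro ℓ I hℓ hc henc
    obtain ⟨S, hS, hS'⟩ := henc .edgeSet X (by simp [Formula.freeVars])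
    change (Aut.atom (2 ^ K) r (topW t true (varIx 3 X)) fun n =>
      decide (n % r = a)).Accepts T ℓ ↔ _
    refine (Aut.accepts_atom (show 0 < r by omega) _ _ T hℓ).trans ?_
    rw [weight_topW_true hc (v := varIx 3 X) hS', Aut.red_mod, decide_eq_true_eq,
      IncGraph.sat_cardE hS]
    rfl
  | eq k z z' =>
    intro ℓ I hℓ hc henc
    obtain ⟨u, hu, he⟩ := henc k z (by simp [Formula.freeVars])
    obtain ⟨u', hu', he'⟩ := henc k z' (by simp [Formula.freeVars])
    change (Aut.atom (2 ^ K) 1 (neW t (decide (k.code % 2 = 1)) (varIx k.code z) (varIx k.code z')) fun n =>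
      decide (n = 0)).Accepts T ℓ ↔ _
    refine (Aut.accepts_atom one_pos _ _ T hℓ).trans ?_
    rw [decide_eq_true_eq, Aut.red_eq_zero_iff]
    have hsat : T.graph.Sat (.eq k z z') I ↔ u = u' := by
      simp [IncGraph.Sat, hu, hu', eq_comm]
    rw [hsat]
    cases k with
    | vertex => exact (weight_neW_false hc he he').trans Set.singleton_eq_singleton_iff
    | edge => exact (weight_neW_true hc he he').trans Set.singleton_eq_singleton_iff
    | vertexSet => exact weight_neW_false hc he he'
    | edgeSet => exact weight_neW_true hc he he'
  | not φ ih =>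
    intro ℓ I hℓ hc henc
    refine (Aut.accepts_compl (bounded_aut _ φ) T hℓ).trans (not_congr ?_)
    exact ih (fun i hi => hφ i (by simp [Formula.code, hi])) ℓ I hℓ hc henc
  | and φ ψ ih₁ ih₂ | or φ ψ ih₁ ih₂ | imp φ ψ ih₁ ih₂ | iff φ ψ ih₁ ih₂ =>
    intro ℓ I hℓ hc henc
    have h₁ := ih₁ (fun i hi => hφ i (by simp [Formula.code, hi])) ℓ I hℓ hc
      fun k z h => henc k z (.inl h)
    have h₂ := ih₂ (fun i hi => hφ i (by simp [Formula.code, hi])) ℓ I hℓ hc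
      fun k z h => henc k z (.inr h)
    refine (Aut.accepts_prod _ (bounded_aut _ φ) (bounded_aut _ ψ) T hℓ).trans ?_
    rw [IncGraph.Sat, ← h₁, ← h₂, Aut.Accepts, Aut.Accepts]
    -- What remains is the truth table of the connective.
    cases (φ.aut t K).final ((φ.aut t K).run T ℓ) <;>
      cases (ψ.aut t K).final ((ψ.aut t K).run T ℓ) <;> simp [impOp, iffOp]
  | ex k z φ ih =>
    intro ℓ I hℓ hc henc
    refine accepts_exAut (bounded_aut _ φ)
      (fun s hs => hK s hs _ (hix k z (hφ z (by simp [Formula.code])))) hℓ hc ?_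
    intro u ℓ' hℓ' hc' hag hu
    exact ih (fun i hi => hφ i (by simp [Formula.code, hi])) ℓ' _ hℓ' hc' (henc.set hag hu)
  | all k z φ ih =>
    intro ℓ I hℓ hc henc
    refine (Aut.accepts_compl (bounded_exAut (bounded_aut _ φ).compl _ _) T hℓ).trans ?_
    rw [accepts_exAut (X := fun u => ¬ T.graph.Sat φ (I.set k z u)) (bounded_aut _ φ).compl
      (fun s hs => hK s hs _ (hix k z (hφ z (by simp [Formula.code])))) hℓ hc]
    · rw [not_exists_not]; rfl
    · intro u ℓ' hℓ' hc' hag hu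
      rw [Aut.accepts_compl (bounded_aut _ φ) T hℓ']
      exact not_congr
        (ih (fun i hi => hφ i (by simp [Formula.code, hi])) ℓ' _ hℓ' hc' (henc.set hag hu))

end

end ConcreteCMSO

namespace ConcreteCMSO

open ConcreteDecomp

/-! ### The tree automaton over concrete bags -/

/-- The bits of the letter `x` describe the bag `β`. -/
def Matches {t : ℕ} (x : ℕ) (β : ConcreteBag t) : Prop :=
  ∀ s : Fin t, (inB x s = true ↔ s ∈ β.B) ∧ (inb x s = true ↔ s ∈ β.b)

/-- The bits of the letter describe a bag. -/
def isBag (t x : ℕ) : Bool := decide (count t (inb x) = 0) || decide (count t (inb x) = 2)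

theorem count_eq_card (t : ℕ) (P : ℕ → Bool) :
    count t P = (Finset.univ.filter fun s : Fin t => P s = true).card := by
  rw [count, Finset.sum_range, Finset.card_filter]
  refine Finset.sum_congr rfl fun s _ => ?_
  cases P s <;> rfl

/-- The bag that the bits of a letter describe. -/
def letterBag (t x : ℕ) (h : isBag t x = true) : ConcreteBag t where
  B := Finset.univ.filter fun s => inB x s = true
  b := Finset.univ.filter fun s => inb x s = true
  sub := Finset.monotone_filter_right _ fun s _ hs => by
    rw [inB, Bool.or_eq_true]; exact .inr hs
  card_b := by
    rw [← Finset.card_eq_zero, ← count_eq_card]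
    simpa [isBag] using h

/-- A letter determines its bag, and a decidable test tells whether it has one. The transitions can
thus be listed by running through letters. -/
theorem matches_iff {t x : ℕ} {β : ConcreteBag t} :
    Matches x β ↔ ∃ h : isBag t x = true, letterBag t x h = β := by
  constructor
  · intro h
    have hB : (Finset.univ.filter fun s : Fin t => inB x s = true) = β.B := by
      ext s; simp [(h s).1]
    have hb : (Finset.univ.filter fun s : Fin t => inb x s = true) = β.b := by
      ext s; simp [(h s).2]
    refine ⟨?_, ?_⟩
    · simpa [isBag, count_eq_card, hb] using β.card_b
    · obtain ⟨B, b, _, _⟩ := β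
      simp only [letterBag, ConcreteBag.mk.injEq]
      exact ⟨hB, hb⟩
  · rintro ⟨h, rfl⟩ s
    simp [letterBag]

/-- The digits of the bag that the bits of a letter describe. -/
def digits (t x : ℕ) : List ℕ :=
  (List.range t).map fun s => if inb x s = true then 2 else if inB x s = true then 1 else 0

theorem code_letterBag {t x : ℕ} (h : isBag t x = true) : (letterBag t x h).code = digits t x := by
  refine List.ext_getElem (by simp [ConcreteBag.code, digits]) fun i h₁ h₂ => ?_
  simp [ConcreteBag.code, digits, letterBag]

namespace Aut

/-- The states of an automaton as a finite type. -/
def toState (A : Aut) (q : ℕ) : Fin (A.1 + 1) := Fin.ofNat (A.1 + 1) q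

theorem toState_val (A : Aut) (q : Fin (A.1 + 1)) : A.toState q = q := by
  simp [toState]

theorem val_toState_of_le {A : Aut} {q : ℕ} (h : q ≤ A.1) : (A.toState q).val = q :=
  Nat.mod_eq_of_lt (Nat.lt_succ_of_le h)

/-- The final states of the tree automaton of `A`. -/
def treeFinal (A : Aut) : List (Fin (A.1 + 1)) :=
  (List.range (A.1 + 1)).flatMap fun q => if A.final q = true then [A.toState q] else []

/-- The transitions of the tree automaton of `A`. -/
def treeTransitions (A : Aut) (t L : ℕ) : List (Transition (Fin (A.1 + 1)) (ConcreteBag t)) :=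
  (List.range L).flatMap fun x => if h : isBag t x = true then
      .leaf (letterBag t x h) (A.toState (A.next x 0 0)) ::
        (List.range (A.1 + 1)).flatMap fun i =>
          .unary (A.toState i) (letterBag t x h) (A.toState (A.next x i 0)) ::
            (List.range (A.1 + 1)).map fun j =>
              .binary (A.toState i) (A.toState j) (letterBag t x h) (A.toState (A.next x i j))
    else []

/-- The tree automaton over the concrete bags that guesses the marks of the letters below `L` and
runs the automaton `A`. -/
def toTree (A : Aut) (t L : ℕ) : TreeAutomaton (ConcreteBag t) where
  numStates := A.1 + 1
  final := A.treeFinal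
  transitions := A.treeTransitions t L

/-- The codes of the transitions of the tree automaton. -/
def transitionCodes (A : Aut) (t L : ℕ) : List (List ℕ) :=
  (List.range L).flatMap fun x => if isBag t x = true then
      (0 :: (digits t x ++ [A.next x 0 0 % (A.1 + 1)])) ::
        (List.range (A.1 + 1)).flatMap fun i =>
          (1 :: i % (A.1 + 1) :: (digits t x ++ [A.next x i 0 % (A.1 + 1)])) ::
            (List.range (A.1 + 1)).map fun j =>
              2 :: i % (A.1 + 1) :: j % (A.1 + 1) :: (digits t x ++ [A.next x i j % (A.1 + 1)])
    else []

/-- The final states of the tree automaton. -/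
def finalCodes (A : Aut) : List ℕ :=
  (List.range (A.1 + 1)).flatMap fun q => if A.final q = true then [q % (A.1 + 1)] else []

/-- The code of the tree automaton. -/
def treeCode (A : Aut) (t L : ℕ) : List ℕ :=
  (A.1 + 1) :: A.finalCodes.length ::
    (A.finalCodes ++ (A.transitionCodes t L).length :: (A.transitionCodes t L).flatten)

theorem map_val_treeFinal (A : Aut) : A.treeFinal.map Fin.val = A.finalCodes := by
  rw [treeFinal, finalCodes, List.map_flatMap]
  refine congrArg (fun f => List.flatMap f _) (funext fun q => ?_)
  split_ifs <;> rfl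

theorem map_code_treeTransitions (A : Aut) (t L : ℕ) :
    (A.treeTransitions t L).map Transition.code = A.transitionCodes t L := by
  rw [treeTransitions, transitionCodes, List.map_flatMap]
  refine congrArg (fun f => List.flatMap f _) (funext fun x => ?_)
  split_ifs with h
  · simp only [List.map_cons, List.map_flatMap, List.map_map,
      Function.comp_def, Transition.code, code_letterBag]
    rfl
  · rfl

/-- The automaton has dependent types; its code is recomputed with plain numbers, with remainders
modulo `A.1 + 1` mirroring the values of `toState`, to be accessible to primitive recursion. -/
theorem code_toTree (A : Aut) (t L : ℕ) : (A.toTree t L).code = A.treeCode t L := by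
  rw [TreeAutomaton.code, treeCode, ← map_code_treeTransitions, ← map_val_treeFinal, List.length_map,
    List.length_map, List.flatMap_def]
  rfl

section Language

variable {A : Aut} {t L : ℕ}

theorem mem_treeFinal {q : Fin (A.1 + 1)} : q ∈ A.treeFinal ↔ A.final q = true := by
  simp only [treeFinal, List.mem_flatMap, List.mem_range]
  constructor
  · rintro ⟨i, hi, h⟩
    split_ifs at h with hf
    · rw [List.mem_singleton] at h
      rwa [h, val_toState_of_le (by omega)]
    · cases h
  · intro h
    exact ⟨q, q.2, by simp [h, toState_val]⟩

theorem leaf_mem {β : ConcreteBag t} {q : Fin (A.1 + 1)} :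
    .leaf β q ∈ A.treeTransitions t L ↔
      ∃ x < L, Matches x β ∧ A.toState (A.next x 0 0) = q := by
  simp only [treeTransitions, List.mem_flatMap, List.mem_range, matches_iff]
  refine exists_congr fun x => and_congr_right fun _ => ?_
  split_ifs with h
  · simp [h, eq_comm]
  · simp [h]

theorem unary_mem {β : ConcreteBag t} {q₁ q : Fin (A.1 + 1)} :
    .unary q₁ β q ∈ A.treeTransitions t L ↔
      ∃ x < L, Matches x β ∧ A.toState (A.next x q₁ 0) = q := by
  simp only [treeTransitions, List.mem_flatMap, List.mem_range, matches_iff]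
  refine exists_congr fun x => and_congr_right fun _ => ?_
  split_ifs with h
  · simp only [List.mem_cons, List.mem_flatMap, List.mem_range, List.mem_map, reduceCtorEq,
      and_false, exists_false, or_false, false_or, Transition.unary.injEq, h, exists_true_left]
    constructor
    · rintro ⟨i, hi, rfl, rfl, rfl⟩
      rw [val_toState_of_le (by omega)]
      exact ⟨rfl, rfl⟩
    · rintro ⟨rfl, rfl⟩
      exact ⟨q₁, q₁.2, (toState_val _ _).symm, rfl, rfl⟩
  · simp [h]

theorem binary_mem {β : ConcreteBag t} {q₁ q₂ q : Fin (A.1 + 1)} :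
    .binary q₁ q₂ β q ∈ A.treeTransitions t L ↔
      ∃ x < L, Matches x β ∧ A.toState (A.next x q₁ q₂) = q := by
  simp only [treeTransitions, List.mem_flatMap, List.mem_range, matches_iff]
  refine exists_congr fun x => and_congr_right fun _ => ?_
  split_ifs with h
  · simp only [List.mem_cons, List.mem_flatMap, List.mem_range, List.mem_map, reduceCtorEq,
      false_or, Transition.binary.injEq, h, exists_true_left]
    constructor
    · rintro ⟨i, hi, j, hj, rfl, rfl, rfl, rfl⟩
      rw [val_toState_of_le (by omega), val_toState_of_le (by omega)]
      exact ⟨rfl, rfl⟩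
    · rintro ⟨rfl, rfl⟩
      exact ⟨q₁, q₁.2, q₂, q₂.2, toState_val _ _, toState_val _ _, rfl, rfl⟩
  · simp [h]

end Language

end Aut

/-! ### The language of the tree automaton -/

namespace ConcreteDecomp

variable {t : ℕ}

theorem compat_iff {T : ConcreteDecomp t} {ℓ : List ℕ → ℕ} :
    T.Compat ℓ ↔ ∀ p : T.Pos, Matches (ℓ p) (T.symbol p) :=
  ⟨fun h p s => ⟨h.inB p s, h.inb p s⟩, fun h => ⟨fun p s => (h p s).1, fun p s => (h p s).2⟩⟩

theorem compat_leaf {β : ConcreteBag t} {ℓ : List ℕ → ℕ} :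
    Compat (.leaf β) ℓ ↔ Matches (ℓ []) β := by
  rw [compat_iff]
  refine ⟨fun h => h ⟨[], Term.nil_mem_positions _⟩, ?_⟩
  rintro h ⟨p, hp⟩
  obtain rfl : p = [] := by simpa [Term.positions] using hp
  exact h

theorem compat_unary {β : ConcreteBag t} {T : ConcreteDecomp t} {ℓ : List ℕ → ℕ} :
    Compat (.unary β T) ℓ ↔ Matches (ℓ []) β ∧ T.Compat fun p => ℓ (1 :: p) := by
  rw [compat_iff, compat_iff]
  constructor
  · intro h
    exact ⟨h ⟨[], Term.nil_mem_positions _⟩,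
      fun p => h ⟨1 :: p.1, by simp [Term.positions, p.2]⟩⟩
  · rintro ⟨h₀, h⟩ ⟨p, hp⟩
    have hp' := hp
    simp only [Term.positions, Finset.mem_union, Finset.mem_singleton, Finset.mem_image] at hp'
    rcases hp' with rfl | ⟨q, hq, rfl⟩
    exacts [h₀, h ⟨q, hq⟩]

theorem compat_binary {β : ConcreteBag t} {T₁ T₂ : ConcreteDecomp t} {ℓ : List ℕ → ℕ} :
    Compat (.binary β T₁ T₂) ℓ ↔ Matches (ℓ []) β ∧ (T₁.Compat fun p => ℓ (1 :: p)) ∧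
      T₂.Compat fun p => ℓ (2 :: p) := by
  rw [compat_iff, compat_iff, compat_iff]
  constructor
  · intro h
    exact ⟨h ⟨[], Term.nil_mem_positions _⟩,
      fun p => h ⟨1 :: p.1, by simp [Term.positions, p.2]⟩,
      fun p => h ⟨2 :: p.1, by simp [Term.positions, p.2]⟩⟩
  · rintro ⟨h₀, h₁, h₂⟩ ⟨p, hp⟩
    have hp' := hp
    simp only [Term.positions, Finset.mem_union, Finset.mem_singleton, Finset.mem_image] at hp'
    rcases hp' with rfl | ⟨q, hq, rfl⟩ | ⟨q, hq, rfl⟩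
    exacts [h₀, h₁ ⟨q, hq⟩, h₂ ⟨q, hq⟩]

theorem exists_compat (T : ConcreteDecomp t) {K : ℕ} (hK : ∀ s ≤ t, ∀ v < 2, Nat.pair s v < K) :
    ∃ ℓ : List ℕ → ℕ, (∀ p, ℓ p < 2 ^ K) ∧ T.Compat ℓ := by
  classical
  refine ⟨fun p => Aut.mask K fun i => decide (∃ (hp : p ∈ T.positions) (hs : i.unpair.1 < t),
    (i.unpair.2 = 0 ∧ ⟨_, hs⟩ ∈ (T.symbol ⟨p, hp⟩).B) ∨
      (i.unpair.2 = 1 ∧ ⟨_, hs⟩ ∈ (T.symbol ⟨p, hp⟩).b)), fun p => Aut.mask_lt _ _, ?_⟩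
  rw [compat_iff]
  intro p s
  simp only [inB, inb, bit, Aut.testBit_mask, Nat.unpair_pair, hK s.1 s.2.le 0 (by simp),
    hK s.1 s.2.le 1 (by simp), decide_true, Bool.true_and, Bool.or_eq_true, decide_eq_true_eq]
  have hsub := @(T.symbol p).sub s
  constructor
  · constructor
    · rintro (⟨_, _, h | h⟩ | ⟨_, _, h | h⟩)
      exacts [h.2, absurd h.1 (by simp), absurd h.1 (by simp), hsub h.2]
    · exact fun h => .inl ⟨p.2, s.2, .inl ⟨trivial, h⟩⟩
  · constructor
    · rintro ⟨_, _, h | h⟩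
      exacts [absurd h.1 (by simp), h.2]
    · exact fun h => ⟨p.2, s.2, .inr ⟨trivial, h⟩⟩

end ConcreteDecomp

namespace Aut

variable {A : Aut} {t L : ℕ}

/-- Nondeterminism is exactly the choice of a letter matching each bag. A run of the tree automaton
is a compatible labelling together with the deterministic run on it. -/
theorem reaches_iff (hA : A.Bounded (ConcreteBag t) L) (T : ConcreteDecomp t) :
    ∀ q : Fin (A.1 + 1), (A.toTree t L).Reaches T q ↔
      ∃ ℓ : List ℕ → ℕ, (∀ p, ℓ p < L) ∧ T.Compat ℓ ∧ A.toState (A.run T ℓ) = q := by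
  have hval : ∀ (T : ConcreteDecomp t) (ℓ : List ℕ → ℕ), (∀ p, ℓ p < L) →
      (A.toState (A.run T ℓ)).val = A.run T ℓ :=
    fun T ℓ h => val_toState_of_le (hA T ℓ h).2
  induction T with
  | leaf β =>
    intro q
    refine leaf_mem.trans ?_
    simp only [compat_leaf, run]
    exact ⟨fun ⟨x, hx, h⟩ => ⟨fun _ => x, fun _ => hx, h⟩, fun ⟨ℓ, hℓ, h⟩ => ⟨_, hℓ _, h⟩⟩
  | unary β T ih =>
    intro q
    refine (exists_congr fun q₁ => and_congr (ih q₁) unary_mem).trans ?_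
    simp only [compat_unary, run]
    constructor
    · rintro ⟨_, ⟨ℓ, hℓ, hc, rfl⟩, x, hx, hm, rfl⟩
      -- The value `x` at strings outside the term only serves to keep all labels below `L`.
      refine ⟨fun p => match p with | [] => x | 1 :: p => ℓ p | _ => x, ?_, ⟨hm, hc⟩, ?_⟩
      · intro p; dsimp only; split; exacts [hx, hℓ _, hx]
      · rw [hval T ℓ hℓ]; rfl
    · rintro ⟨ℓ, hℓ, ⟨hm, hc⟩, rfl⟩
      refine ⟨_, ⟨_, fun p => hℓ _, hc, rfl⟩, _, hℓ _, hm, ?_⟩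
      rw [hval _ _ fun p => hℓ _]
  | binary β T₁ T₂ ih₁ ih₂ =>
    intro q
    refine (exists_congr fun q₁ => exists_congr fun q₂ =>
      and_congr (ih₁ q₁) (and_congr (ih₂ q₂) binary_mem)).trans ?_
    simp only [compat_binary, run]
    constructor
    · rintro ⟨_, _, ⟨ℓ₁, hℓ₁, hc₁, rfl⟩, ⟨ℓ₂, hℓ₂, hc₂, rfl⟩, x, hx, hm, rfl⟩
      refine ⟨fun p => match p with | [] => x | 1 :: p => ℓ₁ p | 2 :: p => ℓ₂ p | _ => x, ?_,
        ⟨hm, hc₁, hc₂⟩, ?_⟩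
      · intro p; dsimp only; split; exacts [hx, hℓ₁ _, hℓ₂ _, hx]
      · rw [hval T₁ ℓ₁ hℓ₁, hval T₂ ℓ₂ hℓ₂]; rfl
    · rintro ⟨ℓ, hℓ, ⟨hm, hc₁, hc₂⟩, rfl⟩
      refine ⟨_, _, ⟨_, fun p => hℓ _, hc₁, rfl⟩, ⟨_, fun p => hℓ _, hc₂, rfl⟩, _, hℓ _, hm, ?_⟩
      rw [hval _ _ fun p => hℓ _, hval _ _ fun p => hℓ _]

theorem mem_language_toTree (hA : A.Bounded (ConcreteBag t) L) (T : ConcreteDecomp t) :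
    T ∈ (A.toTree t L).language ↔
      ∃ ℓ : List ℕ → ℕ, (∀ p, ℓ p < L) ∧ T.Compat ℓ ∧ A.Accepts T ℓ := by
  refine (exists_congr fun q => and_congr mem_treeFinal (reaches_iff hA T q)).trans ?_
  constructor
  · rintro ⟨_, hf, ℓ, hℓ, hc, rfl⟩
    rw [val_toState_of_le (hA T ℓ hℓ).2] at hf
    exact ⟨ℓ, hℓ, hc, hf⟩
  · rintro ⟨ℓ, hℓ, hc, hf⟩
    refine ⟨_, ?_, ℓ, hℓ, hc, rfl⟩
    rwa [val_toState_of_le (hA T ℓ hℓ).2]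

end Aut

/-! ### The automaton of a sentence -/

theorem pair_lt_numBits {t n s v : ℕ} (hs : s ≤ t) (hv : v < 6 + 4 * n) :
    Nat.pair s v < numBits t n :=
  (Nat.pair_lt_pair_left _ (Nat.lt_succ_of_le hs)).trans (Nat.pair_lt_pair_right _ hv)

/-- The tree automaton of a sentence. -/
def Sentence.aut (φ : Sentence) (t : ℕ) : TreeAutomaton (ConcreteBag t) :=
  (φ.1.aut t (numBits t φ.1.code.sum)).toTree t (2 ^ numBits t φ.1.code.sum)

/-- Without free variables, every compatible labelling gives the same verdict, so accepting for some
labelling is truth as soon as one compatible labelling exists. -/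
theorem Sentence.language_aut (φ : Sentence) (t : ℕ) :
    (φ.aut t).language = {T : ConcreteDecomp t | T.graph.Models φ} := by
  refine Set.ext fun (T : ConcreteDecomp t) => ?_
  refine (Aut.mem_language_toTree (bounded_aut _ φ.1) T).trans ?_
  have key : ∀ ℓ : List ℕ → ℕ, (∀ p, ℓ p < 2 ^ numBits t φ.1.code.sum) → T.Compat ℓ →
      ((φ.1.aut t (numBits t φ.1.code.sum)).Accepts T ℓ ↔ T.graph.Models φ) := by
    intro ℓ hℓ hc
    refine accepts_aut (fun s hs v hv => pair_lt_numBits hs hv) φ.1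
      -- The sum of the code is a crude bound for all variable names, chosen because it is easy to
      -- compute.
      (fun i hi => List.le_sum_of_mem hi) ℓ _ hℓ hc fun k z h => ?_
    rw [φ.2] at h
    cases h
  constructor
  · rintro ⟨ℓ, hℓ, hc, h⟩
    exact (key ℓ hℓ hc).1 h
  · intro h
    obtain ⟨ℓ, hℓ, hc⟩ := exists_compat T (K := numBits t φ.1.code.sum)
      fun s hs v hv => pair_lt_numBits hs (by omega)
    exact ⟨ℓ, hℓ, hc, (key ℓ hℓ hc).2 h⟩

/-- The code of the tree automaton of a sentence, computed from the nodes of the sentence. -/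
def autCode (t : ℕ) (nodes : List (List ℕ)) : List ℕ :=
  (nodes.foldr (nodeStep t (numBits t nodes.flatten.sum)) []).headI.treeCode t
    (2 ^ numBits t nodes.flatten.sum)

theorem Sentence.code_aut (φ : Sentence) (t : ℕ) : (φ.aut t).code = autCode t φ.1.nodes := by
  rw [Sentence.aut, Aut.code_toTree, autCode, foldr_nodeStep, Formula.flatten_nodes, List.headI_cons]

namespace IsPrimrec

variable {α : Type*} [Primcodable α]

@[fun_prop] theorem isBag_fun {t x : α → ℕ} (ht : IsPrimrec t) (hx : IsPrimrec x) :
    IsPrimrec fun a => isBag (t a) (x a) := by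
  unfold isBag; fun_prop

@[fun_prop] theorem digits_fun {t x : α → ℕ} (ht : IsPrimrec t) (hx : IsPrimrec x) :
    IsPrimrec fun a => digits (t a) (x a) := by
  unfold digits; fun_prop

@[fun_prop] theorem finalCodes_fun {A : α → Aut} (hA : IsPrimrec A) :
    IsPrimrec fun a => (A a).finalCodes := by
  unfold Aut.finalCodes; fun_prop

@[fun_prop] theorem transitionCodes_fun {A : α → Aut} {t L : α → ℕ} (hA : IsPrimrec A)
    (ht : IsPrimrec t) (hL : IsPrimrec L) :
    IsPrimrec fun a => (A a).transitionCodes (t a) (L a) := by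
  unfold Aut.transitionCodes; fun_prop

@[fun_prop] theorem treeCode_fun {A : α → Aut} {t L : α → ℕ} (hA : IsPrimrec A)
    (ht : IsPrimrec t) (hL : IsPrimrec L) :
    IsPrimrec fun a => (A a).treeCode (t a) (L a) := by
  unfold Aut.treeCode; fun_prop

theorem autCode_fun : IsPrimrec fun p : ℕ × List (List ℕ) => autCode p.1 p.2 := by
  unfold autCode; fun_prop

end IsPrimrec

end ConcreteCMSO

theorem mainTheorem2 :
    ∃ f : ℕ × ℕ → ℕ, Computable f ∧
      ∃ (M : Turing.TM2ComputableAux Turing.PartrecToTM2.Γ' Turing.PartrecToTM2.Γ')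
        (𝒜 : ConcreteCMSO.Sentence → (t : ℕ) →
          ConcreteCMSO.TreeAutomaton (ConcreteCMSO.ConcreteBag t)),
        ∀ (φ : ConcreteCMSO.Sentence) (t : ℕ),
          ConcreteCMSO.OutputsInTime M (t :: φ.1.code) (𝒜 φ t).code (f (φ.size, t)) ∧
          (𝒜 φ t).language =
            {T : ConcreteCMSO.ConcreteDecomp t | T.graph.Models φ} := by
  obtain ⟨c, hc, hcode⟩ := ConcreteCMSO.exists_code_of_nodes ConcreteCMSO.IsPrimrec.autCode_fun
  obtain ⟨f, hf, M, hM⟩ := ConcreteCMSO.exists_machine c hc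
  refine ⟨f, hf, M, fun φ t => φ.aut t, fun φ t => ⟨?_, φ.language_aut t⟩⟩
  have h := hM t φ.1.code
  simp only [hcode, Part.get_some] at h
  rw [φ.code_aut t]
  exact h
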